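/- **Conventions.** Let $\mathcal L_A=\{+,\cdot,S,<,0\}$ and let $\mathcal L_A(I)$ be its extension by a unary predicate $I$. $\mathrm{PA}(I)$ is Robinson's arithmetic $\mathrm Q$ together with the induction scheme for all $\mathcal L_A(I)$-formulas. $\mathrm{PAI}$ is $\mathrm{PA}(I)$ together with the sentence "$I$ is unbounded" and, for every $n$ and every $\mathcal L_A$-formula $\varphi(v_1,\dots,v_n)$, the sentence $\forall x_1,\dots,x_n,y_1,\dots,y_n\in I\ \bigl[x_1<\dots<x_n\wedge y_1<\dots<y_n\rightarrow(\varphi(x_1,\dots,x_n)\leftrightarrow\varphi(y_1,\dots,y_n))\bigr]$. $\mathrm{PAI}^\circ$ is obtained from $\mathrm{PAI}$ by adding, in each of these sentences, the premise $\ulcorner\varphi\urcorner<x_1\wedge\ulcorner\varphi\urcorner<y_1$. The sentence $\alpha$ of $\mathcal L_A(I)$ is defined as follows. For an $\mathcal L_A$-formula $\varphi$ built with $\neg,\vee,\exists$, let $\varphi^*$ be $\varphi$ if $\varphi$ is atomic, $(\neg\varphi)^*=\neg\varphi^*$, $(\varphi\vee\psi)^*=\varphi^*\vee\psi^*$, and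 $(\exists y\,\varphi)^*=\exists y<z_1\,\widetilde{\varphi^*}$, where $z_1,z_2,\dots$ are new variables and $\widetilde{\varphi^*}$ results from $\varphi^*$ by replacing each $z_i$ by $z_{i+1}$; thus $\varphi^*=\varphi^*(\bar x,z_1,\dots,z_k)$, where $k$ is the quantifier depth of $\varphi$, has only bounded quantifiers; this is formalized in arithmetic. The formula $\sigma(\varphi,\bar a)$ says: for some $m$, $\varphi$ is (the code of) an $\mathcal L_A$-formula in $m$ variables and $\bar a$ is an $m$-tuple, and $\varphi^*(\bar a,i_1,\dots,i_k)$ is true according to the arithmetical satisfaction predicate for formulas with bounded quantifiers, where $j$ is the first element of $I$ that is larger than $\ulcorner\varphi\urcorner$ and than all entries of $\bar a$, and $i_1<\dots<i_k$ are the first $k$ elements of $I$ above $j$. The sentence $\alpha$ says that $\sigma$ defines a full satisfaction class, i.e. that $\sigma$ satisfies Tarski's recursive conditions for all (codes of) $\mathcal L_A$-formulas and all tuples. "Definable" means definable with parameters. A structure $\mathcal N$ is interpreted in a structure $\mathcal M$, written $\mathcal M\trianglerighteq\mathcal N$, if the universe of $\mathcal N$ is a definable subset of $\mathcal M$ and all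 functions and relations of $\mathcal N$ are definable in $\mathcal M$. For a theory $U$ and a model $\mathcal M$ of $U$ let $(\mathbb S)$ be the property: for all models $\mathcal N,\mathcal M^*$ of $U$, if $\mathcal M\trianglerighteq\mathcal N\trianglerighteq\mathcal M^*$ and there is an $\mathcal M$-definable isomorphism $\mathcal M\to\mathcal M^*$, then there is an $\mathcal M$-definable isomorphism $\mathcal M\to\mathcal N$. $U$ is solid if $(\mathbb S)$ holds at every model of $U$, and nowhere solid if $(\mathbb S)$ fails at every model of $U$. **Theorem 5.5.** 1. Each $U\in\{\mathrm{PAI}^\circ,\ \mathrm{PAI},\ \mathrm{PAI}+\alpha\}$ is nowhere solid, and $U$ is not solid. 2. If $(\mathcal M,I)\models\mathrm{PAI}$ and $2I=\{2i:i\in I\}$, then $(\mathcal M,2I)\models\mathrm{PAI}$, each of $(\mathcal M,I)$ and $(\mathcal M,2I)$ is interpreted in the other (by the identity on the universe), and there is no $(\mathcal M,I)$-definable isomorphism between $(\mathcal M,I)$ and $(\mathcal M,2I)$. 3. Every model $(\mathcal M,I)$ of $\mathrm{PA}(I)$ is definably rigid: the identity is the only $(\mathcal M,I)$-definable automorphism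 of the $\mathcal L_A$-structure $\mathcal M$. -/

import Mathlib

universe u

namespace ArithInd

noncomputable section

open FirstOrder FirstOrder.Language

/-! ## Languages -/

/-- Function symbols of arithmetic: `0`, `S`, `+`, `·`. -/
inductive ArithFunc : ℕ → Type
  | zero : ArithFunc 0
  | succ : ArithFunc 1
  | add : ArithFunc 2
  | mul : ArithFunc 2

/-- Relation symbols of arithmetic: `<`. -/
inductive ArithRel : ℕ → Type
  | lt : ArithRel 2

/-- The language of arithmetic `{+, ·, S, <, 0}`. -/
def LA : FirstOrder.Language.{0, 0} := ⟨ArithFunc, ArithRel⟩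

/-- The single unary predicate `I`. -/
inductive IndRel : ℕ → Type
  | mem : IndRel 1

/-- The language with one unary predicate symbol `I`. -/
def LI : FirstOrder.Language.{0, 0} := ⟨fun _ => Empty, IndRel⟩

/-- The language of arithmetic together with the unary predicate `I`. -/
abbrev LAI : FirstOrder.Language.{0, 0} := LA.sum LI

/-! ## Terms and formulas

Formulas have free variables in `Fin n`.  `exF` and `allF` bind the variable with the largest
index: the variable bound by a quantifier that produces a formula in `n` variables has index `n`,
and all other variables keep their indices. -/

section Formulas

variable {α : Type} {n : ℕ} {L : FirstOrder.Language.{0, 0}}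

instance : Zero (LA.Term α) := ⟨Constants.term (L := LA) ArithFunc.zero⟩
instance : Add (LA.Term α) := ⟨Functions.apply₂ (L := LA) ArithFunc.add⟩
instance : Mul (LA.Term α) := ⟨Functions.apply₂ (L := LA) ArithFunc.mul⟩

/-- The successor term. -/
def sc (t : LA.Term α) : LA.Term α := Functions.apply₁ (L := LA) ArithFunc.succ t

/-- Numerals. -/
def num : ℕ → LA.Term α
  | 0 => 0
  | k + 1 => sc (num k)

/-- The variable with index `k`. -/
def v (k : Fin n) : LA.Term (Fin n) := Term.var k

/-- The formula `t = s`. -/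
def eqF (t s : LA.Term α) : LA.Formula α := t.equal s

/-- The formula `t < s`. -/
def ltF (t s : LA.Term α) : LA.Formula α := Relations.formula₂ (L := LA) ArithRel.lt t s

/-- The formula `t ≤ s`. -/
def leF (t s : LA.Term α) : LA.Formula α := ltF t s ⊔ eqF t s

/-- Universal quantification over the last variable. -/
def allF (φ : L.Formula (Fin (n + 1))) : L.Formula (Fin n) :=
  BoundedFormula.all (n := 0)
    (BoundedFormula.relabel (n := 1) (fun i : Fin (n + 1) =>
      (Fin.lastCases (Sum.inr 0) (fun j => Sum.inl j) i : Fin n ⊕ Fin 1)) φ)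

/-- Existential quantification over the last variable. -/
def exF (φ : L.Formula (Fin (n + 1))) : L.Formula (Fin n) := (allF φ.not).not

/-- Universal closure of a formula with finitely many free variables. -/
def closure {β : Type} [Finite β] (φ : L.Formula β) : L.Sentence :=
  Formula.iAlls β (φ.relabel Sum.inr : L.Formula (Empty ⊕ β))

/-- An arithmetical formula seen as a formula in the language with `I`. -/
def lift (φ : LA.Formula α) : LAI.Formula α := (LHom.sumInl : LA →ᴸ LAI).onFormula φ

/-- An arithmetical term seen as a term in the language with `I`. -/
def liftT (t : LA.Term α) : LAI.Term α := (LHom.sumInl : LA →ᴸ LAI).onTerm t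

/-- The formula `t ∈ I`. -/
def memI (t : LA.Term α) : LAI.Formula α :=
  Relations.formula₁ (L := LAI) (Sum.inr IndRel.mem) (liftT t)

end Formulas

/-! ## Peano arithmetic with a predicate -/

/-- Robinson's arithmetic `Q`. -/
def Q : LA.Theory :=
  { closure (β := Fin 1) (eqF (sc (v 0)) 0).not,
    closure (β := Fin 2) ((eqF (sc (v 0)) (sc (v 1))).imp (eqF (v 0) (v 1))),
    closure (β := Fin 1) ((eqF (v 0) 0).not.imp (exF (eqF (v 0) (sc (v 1))))),
    closure (β := Fin 1) (eqF (v 0 + 0) (v 0)),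
    closure (β := Fin 2) (eqF (v 0 + sc (v 1)) (sc (v 0 + v 1))),
    closure (β := Fin 1) (eqF (v 0 * 0) 0),
    closure (β := Fin 2) (eqF (v 0 * sc (v 1)) (v 0 * v 1 + v 0)),
    closure (β := Fin 2) ((ltF (v 0) (v 1)).iff (exF (eqF (sc (v 2) + v 0) (v 1)))) }

/-- The induction axiom for `φ(p, x)`: for all `p`, if `φ(p, 0)` and `φ(p, x) → φ(p, S x)` for
all `x`, then `φ(p, x)` for all `x`. -/
def induction {n : ℕ} (φ : LAI.Formula (Fin (n + 1))) : LAI.Sentence :=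
  closure (β := Fin n) <| Formula.imp
    (φ.subst (Fin.snoc (α := fun _ => LAI.Term (Fin n)) (fun i => Term.var i) (liftT 0)))
    (Formula.imp
      (allF (φ.imp (φ.subst (Fin.snoc (α := fun _ => LAI.Term (Fin (n + 1)))
        (fun i => Term.var i.castSucc) (liftT (sc (v (Fin.last n))))))))
      (allF φ))

/-- `PA(I)`: Robinson's arithmetic with induction for all formulas in the language with `I`. -/
def PAofI : LAI.Theory :=
  (LHom.sumInl : LA →ᴸ LAI).onTheory Q ∪
    {s | ∃ (n : ℕ) (φ : LAI.Formula (Fin (n + 1))), s = induction φ}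

/-! ## Gödel numbers

The codes of syntactic objects are built by the pairing function `⟨a, b⟩ = (a + b)² + a`.
Coded formulas use the connectives `¬`, `∨`, `∃` and de Bruijn indices: in the scope of a
quantifier the index `0` is the bound variable, and the index `i + 1` is the variable that has
index `i` outside.  There is a second sort of variables `z_0, z_1, …`. -/

section Codes

variable {T : Type*} [Zero T] [Add T] [Mul T]

/-- The pairing function, for numbers and for terms. -/
def pr (a b : T) : T := (a + b) * (a + b) + a

end Codes

section NatCodes

/-- Gödel number of the arithmetical term `t` whose variables are the free variables in `Fin n`
and the bound variables in `Fin k`. -/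
def gnTerm {n k : ℕ} : LA.Term (Fin n ⊕ Fin k) → ℕ
  | .var (Sum.inl i) => pr 0 (k + i)
  | .var (Sum.inr i) => pr 0 (k - 1 - i)
  | .func ArithFunc.zero _ => pr 2 0
  | .func ArithFunc.succ ts => pr 3 (gnTerm (ts 0))
  | .func ArithFunc.add ts => pr 4 (pr (gnTerm (ts 0)) (gnTerm (ts 1)))
  | .func ArithFunc.mul ts => pr 5 (pr (gnTerm (ts 0)) (gnTerm (ts 1)))

/-- Gödel number of an arithmetical formula, where `⊥`, `φ → ψ` and `∀ x φ` are read as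
`¬ 0 = 0`, `¬ φ ∨ ψ` and `¬ ∃ x ¬ φ`. -/
def gn {n : ℕ} : {k : ℕ} → LA.BoundedFormula (Fin n) k → ℕ
  | _, .falsum => pr 8 (pr 6 (pr (pr 2 0) (pr 2 0)))
  | _, .equal t s => pr 6 (pr (gnTerm t) (gnTerm s))
  | _, .rel ArithRel.lt ts => pr 7 (pr (gnTerm (ts 0)) (gnTerm (ts 1)))
  | _, .imp φ ψ => pr 9 (pr (pr 8 (gn φ)) (gn ψ))
  | _, .all φ => pr 8 (pr 10 (pr 8 (gn φ)))

end NatCodes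

/-! ## The theories `PAI` and `PAI°` -/

/-- `I` is unbounded. -/
def Ubd : LAI.Sentence :=
  closure (β := Fin 1) (exF (memI (v 1) ⊓ lift (ltF (v 0) (v 1))))

/-- The terms listed by `t` are elements of `I`, in increasing order. -/
def incrI {α : Type} {n : ℕ} (t : Fin n → LA.Term α) : LAI.Formula α :=
  Formula.iInf (fun i : Fin n => memI (t i)) ⊓
    Formula.iInf (fun p : {p : Fin n × Fin n // p.1 < p.2} => lift (ltF (t p.1.1) (t p.1.2)))

/-- The tuple `x` of variables. -/
def xs {n : ℕ} (i : Fin n) : LA.Term (Fin n ⊕ Fin n) := Term.var (Sum.inl i)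

/-- The tuple `y` of variables. -/
def ys {n : ℕ} (i : Fin n) : LA.Term (Fin n ⊕ Fin n) := Term.var (Sum.inr i)

/-- Any two increasing tuples `x`, `y` from `I` agree on `φ`. -/
def Indis {n : ℕ} (φ : LA.Formula (Fin n)) : LAI.Sentence :=
  closure (β := Fin n ⊕ Fin n) <|
    (incrI xs ⊓ incrI ys).imp ((lift (φ.subst xs)).iff (lift (φ.subst ys)))

/-- Any two increasing tuples `x`, `y` from `I` whose first entries exceed the Gödel number of `φ`
agree on `φ`. -/
def IndisCirc {n : ℕ} (φ : LA.Formula (Fin n)) : LAI.Sentence :=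
  closure (β := Fin n ⊕ Fin n) <|
    (incrI xs ⊓ incrI ys ⊓
      Formula.iInf (fun i : {i : Fin n // i.val = 0} =>
        lift (ltF (num (gn φ)) (xs i.1)) ⊓ lift (ltF (num (gn φ)) (ys i.1)))).imp
      ((lift (φ.subst xs)).iff (lift (φ.subst ys)))

/-- Peano arithmetic with indiscernibles. -/
def PAI : LAI.Theory :=
  PAofI ∪ {Ubd} ∪ {s | ∃ (n : ℕ) (φ : LA.Formula (Fin n)), s = Indis φ}

/-- The variant of `PAI` with the weakened indiscernibility scheme. -/
def PAICirc : LAI.Theory :=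
  PAofI ∪ {Ubd} ∪ {s | ∃ (n : ℕ) (φ : LA.Formula (Fin n)), s = IndisCirc φ}

/-! ## Arithmetized syntax

All the formulas below are arithmetical.  An inductively defined predicate is expressed by the
existence of a coded finite set `W` that contains the object in question and in which every member
is obtained from other members of `W` by one of the clauses. -/

section Arithmetization

variable {α : Type} {n : ℕ}

/-- Codes of variables, function terms and formulas. -/
def cVar (i : LA.Term α) : LA.Term α := pr (num 0) i
def cZ (i : LA.Term α) : LA.Term α := pr (num 1) i
def cZero : LA.Term α := pr (num 2) 0
def cSucc (t : LA.Term α) : LA.Term α := pr (num 3) t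
def cAdd (t s : LA.Term α) : LA.Term α := pr (num 4) (pr t s)
def cMul (t s : LA.Term α) : LA.Term α := pr (num 5) (pr t s)
def cEq (t s : LA.Term α) : LA.Term α := pr (num 6) (pr t s)
def cLt (t s : LA.Term α) : LA.Term α := pr (num 7) (pr t s)
def cNeg (φ : LA.Term α) : LA.Term α := pr (num 8) φ
def cOr (φ ψ : LA.Term α) : LA.Term α := pr (num 9) (pr φ ψ)
def cEx (φ : LA.Term α) : LA.Term α := pr (num 10) φ

/-- The code of the bounded quantification `∃ y < t, φ`, i.e. `∃ y ¬ (¬ y < t ∨ ¬ φ)`. -/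
def cBex (t φ : LA.Term α) : LA.Term α :=
  cEx (cNeg (cOr (cNeg (cLt (cVar 0) t)) (cNeg φ)))

/-- Tuples are coded as lists: the empty tuple is `0`, and `cons b a` has first entry `b`. -/
def cons (b a : LA.Term α) : LA.Term α := sc (pr b a)

/-- Variables `x, c, d`: `x` belongs to the finite set coded by `c = ⟨b, e⟩` and `d`, i.e. `x < b`
and `1 + (x + 1) · d` divides `e`. -/
def memF : LA.Formula (Fin 3) :=
  exF <| exF <| eqF (v 1) (pr (v 3) (v 4)) ⊓ ltF (v 0) (v 3) ⊓
    exF (eqF (sc (sc (v 0) * v 2) * v 5) (v 4))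

/-- `x` belongs to the finite set coded by `c`, `d`. -/
def inW (x c d : LA.Term (Fin n)) : LA.Formula (Fin n) := memF.subst ![x, c, d]

/-- Variables `l, m, k, t`: `t` is a term whose ordinary variables have indices in `[l, m)` and
whose `z`-variables have indices below `k`. -/
def termF : LA.Formula (Fin 4) :=
  exF <| exF <| inW (v 3) (v 4) (v 5) ⊓ allF ((inW (v 6) (v 4) (v 5)).imp
    (exF (leF (v 0) (v 7) ⊓ ltF (v 7) (v 1) ⊓ eqF (v 6) (cVar (v 7))) ⊔
     exF (ltF (v 7) (v 2) ⊓ eqF (v 6) (cZ (v 7))) ⊔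
     eqF (v 6) cZero ⊔
     exF (inW (v 7) (v 4) (v 5) ⊓ eqF (v 6) (cSucc (v 7))) ⊔
     exF (exF (inW (v 7) (v 4) (v 5) ⊓ inW (v 8) (v 4) (v 5) ⊓
       (eqF (v 6) (cAdd (v 7) (v 8)) ⊔ eqF (v 6) (cMul (v 7) (v 8)))))))

/-- `t` is a term whose ordinary variables have indices in `[l, m)` and whose `z`-variables have
indices below `k`. -/
def isTermIn (l m k t : LA.Term (Fin n)) : LA.Formula (Fin n) := termF.subst ![l, m, k, t]

/-- `t` is a term of arithmetic in the variables with indices below `m`. -/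
def isTerm (m t : LA.Term (Fin n)) : LA.Formula (Fin n) := isTermIn 0 m 0 t

/-- Variables `m, φ`: `φ` is a formula of arithmetic, with free variables of index below `m`.
The members of `W` are pairs `⟨m, φ⟩`. -/
def formF : LA.Formula (Fin 2) :=
  exF <| exF <| inW (pr (v 0) (v 1)) (v 2) (v 3) ⊓ allF ((inW (v 4) (v 2) (v 3)).imp
    (exF <| exF <| exF <|
      (isTerm (v 5) (v 6) ⊓ isTerm (v 5) (v 7) ⊓
        (eqF (v 4) (pr (v 5) (cEq (v 6) (v 7))) ⊔ eqF (v 4) (pr (v 5) (cLt (v 6) (v 7))))) ⊔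
      (inW (pr (v 5) (v 6)) (v 2) (v 3) ⊓ eqF (v 4) (pr (v 5) (cNeg (v 6)))) ⊔
      (inW (pr (v 5) (v 6)) (v 2) (v 3) ⊓ inW (pr (v 5) (v 7)) (v 2) (v 3) ⊓
        eqF (v 4) (pr (v 5) (cOr (v 6) (v 7)))) ⊔
      (inW (pr (sc (v 5)) (v 6)) (v 2) (v 3) ⊓ eqF (v 4) (pr (v 5) (cEx (v 6))))))

/-- `φ` is a formula of arithmetic in `m` variables. -/
def isForm (m φ : LA.Term (Fin n)) : LA.Formula (Fin n) := formF.subst ![m, φ]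

/-- Variables `m, a`: `a` is an `m`-tuple.  The members of `W` are pairs `⟨m, a⟩`. -/
def tupF : LA.Formula (Fin 2) :=
  exF <| exF <| inW (pr (v 0) (v 1)) (v 2) (v 3) ⊓ allF ((inW (v 4) (v 2) (v 3)).imp
    (eqF (v 4) (pr 0 0) ⊔
     exF (exF (exF (inW (pr (v 5) (v 6)) (v 2) (v 3) ⊓
       eqF (v 4) (pr (sc (v 5)) (cons (v 7) (v 6))))))))

/-- `a` is an `m`-tuple. -/
def isTup (m a : LA.Term (Fin n)) : LA.Formula (Fin n) := tupF.subst ![m, a]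

/-- Variables `a, i, x`: the entry of the tuple `a` with index `i` is `x`.
The members of `W` are pairs `⟨i, a⟩`. -/
def lookF : LA.Formula (Fin 3) :=
  exF <| exF <| inW (pr (v 1) (v 0)) (v 3) (v 4) ⊓ allF ((inW (v 5) (v 3) (v 4)).imp
    (exF (eqF (v 5) (pr 0 (cons (v 2) (v 6)))) ⊔
     exF (exF (exF (inW (pr (v 6) (v 7)) (v 3) (v 4) ⊓
       eqF (v 5) (pr (sc (v 6)) (cons (v 8) (v 7))))))))

/-- The entry of the tuple `a` with index `i` is `x`. -/
def entry (a i x : LA.Term (Fin n)) : LA.Formula (Fin n) := lookF.subst ![a, i, x]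

/-- Variables `a, g, t, x`: the term `t` has the value `x` when the ordinary variables are
evaluated by the tuple `a` and the `z`-variables by the tuple `g`.
The members of `W` are pairs `⟨t, x⟩`. -/
def valF : LA.Formula (Fin 4) :=
  exF <| exF <| inW (pr (v 2) (v 3)) (v 4) (v 5) ⊓ allF ((inW (v 6) (v 4) (v 5)).imp
    (exF (exF (entry (v 0) (v 7) (v 8) ⊓ eqF (v 6) (pr (cVar (v 7)) (v 8)))) ⊔
     exF (exF (entry (v 1) (v 7) (v 8) ⊓ eqF (v 6) (pr (cZ (v 7)) (v 8)))) ⊔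
     eqF (v 6) (pr cZero 0) ⊔
     exF (exF (inW (pr (v 7) (v 8)) (v 4) (v 5) ⊓ eqF (v 6) (pr (cSucc (v 7)) (sc (v 8))))) ⊔
     exF (exF (exF (exF (inW (pr (v 7) (v 8)) (v 4) (v 5) ⊓ inW (pr (v 9) (v 10)) (v 4) (v 5) ⊓
       (eqF (v 6) (pr (cAdd (v 7) (v 9)) (v 8 + v 10)) ⊔
        eqF (v 6) (pr (cMul (v 7) (v 9)) (v 8 * v 10)))))))))

/-- The value of the term `t` at `a`, `g` is `x`. -/
def val (a g t x : LA.Term (Fin n)) : LA.Formula (Fin n) := valF.subst ![a, g, t, x]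

/-- Variables `s, φ, ψ`: `ψ` is the result of bounding the quantifiers of `φ`, where a quantifier
in the scope of `i` other quantifiers is bounded by the variable `z_{s + i}`.  For `s = 0` this is
the transformation `φ ↦ φ*` with `(∃ y φ)* = ∃ y < z_0, φ*⁺`, where `φ*⁺` arises from `φ*` by
raising the indices of all `z`-variables by one.  The members of `W` are triples `⟨s, ⟨φ, ψ⟩⟩`. -/
def starF : LA.Formula (Fin 3) :=
  exF <| exF <| inW (pr (v 0) (pr (v 1) (v 2))) (v 3) (v 4) ⊓ allF ((inW (v 5) (v 3) (v 4)).imp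
    (exF <| exF <| exF <| exF <| exF <|
      eqF (v 5) (pr (v 6) (pr (cEq (v 7) (v 8)) (cEq (v 7) (v 8)))) ⊔
      eqF (v 5) (pr (v 6) (pr (cLt (v 7) (v 8)) (cLt (v 7) (v 8)))) ⊔
      (inW (pr (v 6) (pr (v 7) (v 8))) (v 3) (v 4) ⊓
        eqF (v 5) (pr (v 6) (pr (cNeg (v 7)) (cNeg (v 8))))) ⊔
      (inW (pr (v 6) (pr (v 7) (v 8))) (v 3) (v 4) ⊓
        inW (pr (v 6) (pr (v 9) (v 10))) (v 3) (v 4) ⊓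
        eqF (v 5) (pr (v 6) (pr (cOr (v 7) (v 9)) (cOr (v 8) (v 10))))) ⊔
      (inW (pr (sc (v 6)) (pr (v 7) (v 8))) (v 3) (v 4) ⊓
        eqF (v 5) (pr (v 6) (pr (cEx (v 7)) (cBex (cZ (v 6)) (v 8)))))))

/-- `ψ` is the formula `φ*`. -/
def isStar (φ ψ : LA.Term (Fin n)) : LA.Formula (Fin n) := starF.subst ![0, φ, ψ]

/-- Variables `φ, k`: the quantifier depth of `φ` is `k`.  The members of `W` are pairs
`⟨φ, k⟩`. -/
def depthF : LA.Formula (Fin 2) :=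
  exF <| exF <| inW (pr (v 0) (v 1)) (v 2) (v 3) ⊓ allF ((inW (v 4) (v 2) (v 3)).imp
    (exF <| exF <| exF <| exF <|
      eqF (v 4) (pr (cEq (v 5) (v 6)) 0) ⊔
      eqF (v 4) (pr (cLt (v 5) (v 6)) 0) ⊔
      (inW (pr (v 5) (v 6)) (v 2) (v 3) ⊓ eqF (v 4) (pr (cNeg (v 5)) (v 6))) ⊔
      (inW (pr (v 5) (v 6)) (v 2) (v 3) ⊓ inW (pr (v 7) (v 8)) (v 2) (v 3) ⊓
        ((leF (v 8) (v 6) ⊓ eqF (v 4) (pr (cOr (v 5) (v 7)) (v 6))) ⊔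
         (leF (v 6) (v 8) ⊓ eqF (v 4) (pr (cOr (v 5) (v 7)) (v 8))))) ⊔
      (inW (pr (v 5) (v 6)) (v 2) (v 3) ⊓ eqF (v 4) (pr (cEx (v 5)) (sc (v 6))))))

/-- The quantifier depth of `φ` is `k`. -/
def isDepth (φ k : LA.Term (Fin n)) : LA.Formula (Fin n) := depthF.subst ![φ, k]

/-- Variables `g, ψ, a, b`: the formula `ψ`, all of whose quantifiers are bounded by terms, has the
truth value `b` (`0` or `1`) when its ordinary variables are evaluated by the tuple `a` and its
`z`-variables by the tuple `g`.  The members of `W` are triples `⟨ψ, ⟨a, b⟩⟩`. -/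
def satF : LA.Formula (Fin 4) :=
  exF <| exF <| inW (pr (v 1) (pr (v 2) (v 3))) (v 4) (v 5) ⊓ allF ((inW (v 6) (v 4) (v 5)).imp
    (exF <|
      -- `7` is the evaluation `a` of the member, `8, 9` are terms with values `10, 11`
      (exF <| exF <| exF <| exF <| val (v 7) (v 0) (v 8) (v 10) ⊓ val (v 7) (v 0) (v 9) (v 11) ⊓
        ((eqF (v 10) (v 11) ⊓ eqF (v 6) (pr (cEq (v 8) (v 9)) (pr (v 7) (num 1)))) ⊔
         ((eqF (v 10) (v 11)).not ⊓ eqF (v 6) (pr (cEq (v 8) (v 9)) (pr (v 7) 0))) ⊔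
         (ltF (v 10) (v 11) ⊓ eqF (v 6) (pr (cLt (v 8) (v 9)) (pr (v 7) (num 1)))) ⊔
         ((ltF (v 10) (v 11)).not ⊓ eqF (v 6) (pr (cLt (v 8) (v 9)) (pr (v 7) 0))))) ⊔
      -- `8` is negated
      (exF <|
        (inW (pr (v 8) (pr (v 7) 0)) (v 4) (v 5) ⊓
          eqF (v 6) (pr (cNeg (v 8)) (pr (v 7) (num 1)))) ⊔
        (inW (pr (v 8) (pr (v 7) (num 1))) (v 4) (v 5) ⊓
          eqF (v 6) (pr (cNeg (v 8)) (pr (v 7) 0)))) ⊔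
      -- the disjunction of `8` and `9`
      (exF <| exF <|
        ((inW (pr (v 8) (pr (v 7) (num 1))) (v 4) (v 5) ⊔
            inW (pr (v 9) (pr (v 7) (num 1))) (v 4) (v 5)) ⊓
          eqF (v 6) (pr (cOr (v 8) (v 9)) (pr (v 7) (num 1)))) ⊔
        (inW (pr (v 8) (pr (v 7) 0)) (v 4) (v 5) ⊓ inW (pr (v 9) (pr (v 7) 0)) (v 4) (v 5) ⊓
          eqF (v 6) (pr (cOr (v 8) (v 9)) (pr (v 7) 0)))) ⊔
      -- `∃ y < 8, 9`, where the variable `y` does not occur in the term `8`, whose value is `10`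
      (exF <| exF <| exF <|
        exF (exF (isTermIn (num 1) (v 11) (v 12) (v 8))) ⊓
        val (cons 0 (v 7)) (v 0) (v 8) (v 10) ⊓
        ((exF (ltF (v 11) (v 10) ⊓
            inW (pr (v 9) (pr (cons (v 11) (v 7)) (num 1))) (v 4) (v 5)) ⊓
          eqF (v 6) (pr (cBex (v 8) (v 9)) (pr (v 7) (num 1)))) ⊔
         (allF ((ltF (v 11) (v 10)).imp
            (inW (pr (v 9) (pr (cons (v 11) (v 7)) 0)) (v 4) (v 5))) ⊓
          eqF (v 6) (pr (cBex (v 8) (v 9)) (pr (v 7) 0)))))))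

/-- The formula `ψ` with bounded quantifiers is true at `a`, `g`. -/
def sat (g ψ a : LA.Term (Fin n)) : LA.Formula (Fin n) := satF.subst ![g, ψ, a, num 1]

end Arithmetization

/-! ## The formula `σ` and the sentence `α` -/

section Alpha

variable {n : ℕ}

/-- Variables `φ, a, j`: `φ < j` and all entries of `a` are below `j`. -/
def belowF : LA.Formula (Fin 3) :=
  ltF (v 0) (v 2) ⊓ allF (allF ((entry (v 1) (v 3) (v 4)).imp (ltF (v 4) (v 2))))

/-- Variables `φ, a, j`: `j` is the first element of `I` above `φ` and all entries of `a`. -/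
def startF : LAI.Formula (Fin 3) :=
  memI (v 2) ⊓ lift belowF ⊓
    allF ((memI (v 3) ⊓ lift (belowF.subst ![v 0, v 1, v 3])).imp (lift (leF (v 2) (v 3))))

/-- Variables `j, g, i, w`: `w` is above `j` and above the entries of `g` of index below `i`. -/
def aboveF : LA.Formula (Fin 4) :=
  ltF (v 0) (v 3) ⊓
    allF (allF ((ltF (v 4) (v 2) ⊓ entry (v 1) (v 4) (v 5)).imp (ltF (v 5) (v 3))))

/-- Variables `j, g`: the tuple `g` lists, in increasing order and without omission, the first
elements of `I` above `j`. -/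
def firstF : LAI.Formula (Fin 2) :=
  allF <| allF <| (lift (entry (v 1) (v 2) (v 3))).imp
    (memI (v 3) ⊓ lift aboveF ⊓
      allF ((memI (v 4) ⊓ lift (aboveF.subst ![v 0, v 1, v 2, v 4])).imp
        (lift (leF (v 3) (v 4)))))

/-- The formula `σ`, with variables `φ, a`: for some `m`, `φ` is a formula in `m` variables and `a`
is an `m`-tuple; and `φ*(a, g)` is true, where `g` consists of the first `k` elements of `I` above
`j`, `k` is the quantifier depth of `φ`, and `j` is the first element of `I` above `φ` and all
entries of `a`. -/
def sigmaF : LAI.Formula (Fin 2) :=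
  -- the bound variables are `m, ψ, k, j, g`, where `ψ = φ*`
  exF <| exF <| exF <| exF <| exF <|
    lift (isForm (v 2) (v 0) ⊓ isTup (v 2) (v 1) ⊓ isStar (v 0) (v 3) ⊓ isDepth (v 0) (v 4)) ⊓
    startF.subst ![liftT (v 0), liftT (v 1), liftT (v 5)] ⊓
    lift (isTup (v 4) (v 6)) ⊓
    firstF.subst ![liftT (v 5), liftT (v 6)] ⊓
    lift (sat (v 6) (v 3) (v 1))

/-- `σ(φ, a)`. -/
def sigma (φ a : LA.Term (Fin n)) : LAI.Formula (Fin n) := sigmaF.subst ![liftT φ, liftT a]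

/-- The sentence `α`: the formula `σ` satisfies Tarski's conditions for a satisfaction predicate
for all arithmetical formulas and all tuples. -/
def alpha : LAI.Sentence :=
  -- `0` is the number of variables `m`, and `1` is an `m`-tuple `a`
  closure (β := Fin 2) <| (lift (isTup (v 0) (v 1))).imp <|
    allF (allF ((lift (isTerm (v 0) (v 2) ⊓ isTerm (v 0) (v 3))).imp
      (((sigma (cEq (v 2) (v 3)) (v 1)).iff
          (lift (exF (val (v 1) 0 (v 2) (v 4) ⊓ val (v 1) 0 (v 3) (v 4))))) ⊓
       ((sigma (cLt (v 2) (v 3)) (v 1)).iff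
          (lift (exF (exF (val (v 1) 0 (v 2) (v 4) ⊓ val (v 1) 0 (v 3) (v 5) ⊓
            ltF (v 4) (v 5))))))))) ⊓
    allF ((lift (isForm (v 0) (v 2))).imp
      ((sigma (cNeg (v 2)) (v 1)).iff (sigma (v 2) (v 1)).not)) ⊓
    allF (allF ((lift (isForm (v 0) (v 2) ⊓ isForm (v 0) (v 3))).imp
      ((sigma (cOr (v 2) (v 3)) (v 1)).iff (sigma (v 2) (v 1) ⊔ sigma (v 3) (v 1))))) ⊓
    allF ((lift (isForm (sc (v 0)) (v 2))).imp
      ((sigma (cEx (v 2)) (v 1)).iff (exF (sigma (v 2) (cons (v 3) (v 1))))))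

/-- The theory `PAI + α`. -/
def PAIalpha : LAI.Theory := PAI ∪ {alpha}

end Alpha

/-! ## Interpretations and solidity -/

section Solidity

variable (L : FirstOrder.Language.{0, 0})

/-- The map `f : N → M` identifies the structure `N` with a structure whose universe is a
definable subset of `M` and whose functions and relations are definable in `M`, with parameters
allowed everywhere. -/
structure IsInterpretation (N M : Type u) [L.Structure N] [L.Structure M] (f : N → M) : Prop where
  injective : Function.Injective f
  universe_definable : (Set.univ : Set M).Definable₁ L (Set.range f)
  function_definable : ∀ (n : ℕ) (F : L.Functions n), (Set.univ : Set M).Definable L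
    {x : Fin (n + 1) → M | ∃ y : Fin n → N,
      x = Fin.snoc (α := fun _ => M) (fun i => f (y i)) (f (Structure.funMap F y))}
  relation_definable : ∀ (n : ℕ) (R : L.Relations n), (Set.univ : Set M).Definable L
    {x : Fin n → M | ∃ y : Fin n → N, x = (fun i => f (y i)) ∧ Structure.RelMap R y}

/-- The map `f : M → M` is definable in `M`, with parameters allowed. -/
def DefinableMap (M : Type u) [L.Structure M] (f : M → M) : Prop :=
  (Set.univ : Set M).Definable₂ L {p : M × M | p.2 = f p.1}

variable {L}

/-- The solidity property at `M`: whenever `N` is interpreted in `M` (via `f`) and `M'` in `N`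
(via `g`), and there is an `M`-definable isomorphism from `M` to `M'`, then there is an
`M`-definable isomorphism from `M` to `N`. -/
def SolidAt (U : L.Theory) (M : Theory.ModelType.{0, 0, u} U) : Prop :=
  ∀ (N M' : Theory.ModelType.{0, 0, u} U) (f : N → M) (g : M' → N),
    IsInterpretation L N M f → IsInterpretation L M' N g →
      (∃ i₀ : M ≃[L] M', DefinableMap L M (fun x => f (g (i₀ x)))) →
        ∃ i : M ≃[L] N, DefinableMap L M (fun x => f (i x))

/-- `U` is solid. -/
def Solid (U : L.Theory) : Prop := ∀ M : Theory.ModelType.{0, 0, u} U, SolidAt U M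

/-- `U` is nowhere solid. -/
def NowhereSolid (U : L.Theory) : Prop := ∀ M : Theory.ModelType.{0, 0, u} U, ¬ SolidAt U M

end Solidity

/-! ## Expansions of a model of arithmetic by a subset -/

/-- The universe of the structure `(M, I)`. -/
def Expansion (M : Type u) (_I : Set M) : Type u := M

instance (M : Type u) [h : LA.Structure M] (I : Set M) : LA.Structure (Expansion M I) := h

instance (M : Type u) (I : Set M) : LI.Structure (Expansion M I) where
  funMap := fun f _ => nomatch f
  RelMap := fun {_} R => match R with
    | IndRel.mem => fun x => x 0 ∈ I

/-- The set `2I` of all `i + i` with `i ∈ I`. -/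
def double {M : Type u} [LA.Structure M] (I : Set M) : Set M :=
  {x | ∃ i ∈ I, x = Structure.funMap (L := LA) ArithFunc.add ![i, i]}

end

end ArithInd

open FirstOrder FirstOrder.Language ArithInd

/-!
Solidity fails at `(M, I)` because the least element `i₀` of `I` may be deleted. The sets `I` and
`I \ {i₀}` are definable from each other, so the identities interpret `(M, I)` and
`(M, I \ {i₀})` in each other. A definable isomorphism between them would be a definable
automorphism of `M`, hence the identity by induction, although the two sets differ. The same
argument applies to `2I`.

Deleting `i₀` preserves indiscernibility. It also preserves `α`, since the relation defined by `σ`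
does not change. Only pairs `(φ, a)` that already lie below `i₀` are affected. Such a `φ` is
equivalent, for `σ` computed from `I`, to `φ ∨ t < 0` for every closed term `t`. By indiscernibility
`t` can be chosen such that the code of this disjunction lies between `i₀` and the next element
`i₁`, and then the search for `j` starts at `i₁` for both sets.

To see that `PAI + α` has a model, use compactness. Ramsey's theorem yields for finitely many
formulas an unbounded set `I` of natural numbers that is homogeneous for them and in addition so
sparse that every bounded quantifier of `φ*` reaches beyond a witness, which makes `σ` agree with
truth in `ℕ`.
-/

namespace ArithInd

/-! ## Semantics of the formula builders -/

@[simp]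
theorem snoc_vecCons {M : Type*} {n : ℕ} (a : M) (e : Fin n → M) (x : M) :
    (Fin.snoc (α := fun _ => M) (Matrix.vecCons a e) x : Fin (n + 1 + 1) → M) =
      Matrix.vecCons a (Fin.snoc (α := fun _ => M) e x) :=
  (Fin.cons_snoc_eq_snoc_cons (β := M) a e x).symm

@[simp]
theorem snoc_vecEmpty {M : Type*} (x : M) :
    (Fin.snoc (α := fun _ => M) (![] : Fin 0 → M) x : Fin 1 → M) = ![x] :=
  (FinVec.etaExpand_eq _).symm

section Realize

variable {L : FirstOrder.Language.{0, 0}} {M : Type u} [L.Structure M] {n : ℕ}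

theorem realize_vecCons {α : Type*} (t : L.Term α) (ts : Fin n → L.Term α) (e : α → M) :
    (fun i => (Matrix.vecCons t ts i).realize e) =
      Matrix.vecCons (t.realize e) (fun i => (ts i).realize e) :=
  funext (Fin.cases rfl fun _ => rfl)

theorem realize_vecEmpty {α : Type*} (e : α → M) :
    (fun i => ((![] : Fin 0 → L.Term α) i).realize e) = ![] :=
  Subsingleton.elim _ _

theorem realize_snoc {α : Type*} (ts : Fin n → L.Term α) (t : L.Term α) (e : α → M) :
    (fun i => (Fin.snoc (α := fun _ => L.Term α) ts t i).realize e) =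
      Fin.snoc (α := fun _ => M) (fun i => (ts i).realize e) (t.realize e) :=
  funext (Fin.lastCases (by simp) fun _ => by simp)

@[simp]
theorem realize_allF (φ : L.Formula (Fin (n + 1))) (e : Fin n → M) :
    (allF φ).Realize e ↔ ∀ x, φ.Realize (Fin.snoc (α := fun _ => M) e x) := by
  unfold allF Formula.Realize
  simp only [BoundedFormula.realize_all, BoundedFormula.realize_relabel]
  refine forall_congr' fun x => ?_
  have h : (Sum.elim e ((Fin.snoc default x : Fin 1 → M) ∘ Fin.castAdd 0) ∘ fun i : Fin (n + 1) =>
      (Fin.lastCases (Sum.inr 0) (fun j => Sum.inl j) i : Fin n ⊕ Fin 1)) =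
      Fin.snoc (α := fun _ => M) e x :=
    funext (Fin.lastCases (by simp [Fin.snoc]) fun j => by simp)
  rw [h]
  exact iff_of_eq (congrArg _ (Subsingleton.elim _ _))

@[simp]
theorem realize_exF (φ : L.Formula (Fin (n + 1))) (e : Fin n → M) :
    (exF φ).Realize e ↔ ∃ x, φ.Realize (Fin.snoc (α := fun _ => M) e x) := by
  simp [exF]

theorem realize_closure {β : Type} [Finite β] (φ : L.Formula β) :
    M ⊨ closure φ ↔ ∀ e : β → M, φ.Realize e := by
  unfold closure Sentence.Realize
  rw [Formula.Realize, BoundedFormula.realize_iAlls]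
  exact forall_congr' fun e => Formula.realize_relabel

@[simp]
theorem realize_substF {α β : Type} (φ : L.Formula α) (tf : α → L.Term β) (e : β → M) :
    Formula.Realize (BoundedFormula.subst φ tf) e ↔ φ.Realize (fun a => (tf a).realize e) :=
  BoundedFormula.realize_subst

@[simp]
theorem realize_iInfF {α β : Type} [Finite β] (f : β → L.Formula α) (e : α → M) :
    (Formula.iInf f).Realize e ↔ ∀ b, (f b).Realize e := by
  simp [Formula.iInf, Formula.Realize]

end Realize

@[simp]
theorem realize_v {M : Type u} [LA.Structure M] {n : ℕ} (k : Fin n) (e : Fin n → M) :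
    (v k).realize e = e k :=
  rfl

@[simp]
theorem realize_eqF {M : Type u} [LA.Structure M] {α : Type} (t s : LA.Term α) (e : α → M) :
    (eqF t s).Realize e ↔ t.realize e = s.realize e :=
  Formula.realize_equal

/-! ## Models of arithmetic in algebraic notation -/

/-- The symbols of arithmetic are interpreted by the algebraic operations and the order of `M`;
the symbol `S` is interpreted by `x ↦ x + 1`. -/
class ArithCompat (M : Type u) [LA.Structure M] [Zero M] [One M] [Add M] [Mul M] [LT M] :
    Prop where
  funMap_zero (x : Fin 0 → M) : Structure.funMap (L := LA) ArithFunc.zero x = 0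
  funMap_succ (x : Fin 1 → M) : Structure.funMap (L := LA) ArithFunc.succ x = x 0 + 1
  funMap_add (x : Fin 2 → M) : Structure.funMap (L := LA) ArithFunc.add x = x 0 + x 1
  funMap_mul (x : Fin 2 → M) : Structure.funMap (L := LA) ArithFunc.mul x = x 0 * x 1
  relMap_lt (x : Fin 2 → M) : Structure.RelMap (L := LA) ArithRel.lt x ↔ x 0 < x 1

section ArithCompat

variable {M : Type u} [LA.Structure M] [Zero M] [One M] [Add M] [Mul M] [LT M] [ArithCompat M]
variable {α : Type}

@[simp]
theorem realize_zero (e : α → M) : (0 : LA.Term α).realize e = 0 :=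
  ArithCompat.funMap_zero _

@[simp]
theorem realize_sc (t : LA.Term α) (e : α → M) : (sc t).realize e = t.realize e + 1 :=
  ArithCompat.funMap_succ _

@[simp]
theorem realize_add (t s : LA.Term α) (e : α → M) :
    (t + s).realize e = t.realize e + s.realize e :=
  ArithCompat.funMap_add _

@[simp]
theorem realize_mul (t s : LA.Term α) (e : α → M) :
    (t * s).realize e = t.realize e * s.realize e :=
  ArithCompat.funMap_mul _

@[simp]
theorem realize_pr (t s : LA.Term α) (e : α → M) :
    (pr t s).realize e = pr (t.realize e) (s.realize e) := by
  simp only [pr, realize_add, realize_mul]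

@[simp]
theorem realize_ltF (t s : LA.Term α) (e : α → M) :
    (ltF t s).Realize e ↔ t.realize e < s.realize e :=
  (Formula.realize_rel₂ (L := LA) (R := ArithRel.lt)).trans (ArithCompat.relMap_lt _)

end ArithCompat

theorem realize_of_mem_Q {M : Type u} [LA.Structure M] (hQ : M ⊨ Q) {n : ℕ}
    (φ : LA.Formula (Fin n)) (e : Fin n → M) (hφ : closure φ ∈ Q) : φ.Realize e :=
  (realize_closure φ).1 (hQ.realize_of_mem _ hφ) e

theorem exists_arithCompat {M : Type u} [LA.Structure M] (hQ : M ⊨ Q) :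
    ∃ (_ : Zero M) (_ : One M) (_ : Add M) (_ : Mul M) (_ : LT M),
      ArithCompat M ∧ (0 : M) + 1 = 1 := by
  let zero : M := Structure.funMap (L := LA) ArithFunc.zero ![]
  let succ (x : M) : M := Structure.funMap (L := LA) ArithFunc.succ ![x]
  let add (x y : M) : M := Structure.funMap (L := LA) ArithFunc.add ![x, y]
  have realize_zero {α : Type} (e : α → M) : (0 : LA.Term α).realize e = zero :=
    Term.realize_constants (L := LA)
  have realize_sc {α : Type} (t : LA.Term α) (e : α → M) : (sc t).realize e = succ (t.realize e) :=
    Term.realize_functions_apply₁ (L := LA)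
  have realize_add {α : Type} (t s : LA.Term α) (e : α → M) :
      (t + s).realize e = add (t.realize e) (s.realize e) :=
    Term.realize_functions_apply₂ (L := LA)
  have add_zero (x : M) : add x zero = x := by
    have h := realize_of_mem_Q hQ (eqF (v 0 + 0) (v 0)) ![x] (by simp [Q])
    simpa [realize_zero, realize_add] using h
  have add_succ (x y : M) : add x (succ y) = succ (add x y) := by
    have h := realize_of_mem_Q hQ (eqF (v 0 + sc (v 1)) (sc (v 0 + v 1))) ![x, y] (by simp [Q])
    simpa [realize_sc, realize_add] using h
  let _ : Zero M := ⟨zero⟩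
  let _ : One M := ⟨succ zero⟩
  let _ : Add M := ⟨add⟩
  let _ : Mul M := ⟨fun x y => Structure.funMap (L := LA) ArithFunc.mul ![x, y]⟩
  let _ : LT M := ⟨fun x y => Structure.RelMap (L := LA) ArithRel.lt ![x, y]⟩
  have compat : ArithCompat M :=
    { funMap_zero := fun _ => congrArg _ (Subsingleton.elim _ _)
      funMap_succ := fun x => calc
        Structure.funMap (L := LA) ArithFunc.succ x = succ (x 0) :=
          congrArg _ (FinVec.etaExpand_eq x).symm
        _ = add (x 0) (succ zero) := by rw [add_succ, add_zero]
      funMap_add := fun x => congrArg _ (FinVec.etaExpand_eq x).symm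
      funMap_mul := fun x => congrArg _ (FinVec.etaExpand_eq x).symm
      relMap_lt := fun x => iff_of_eq (congrArg _ (FinVec.etaExpand_eq x).symm) }
  exact ⟨_, _, _, _, _, compat, (add_succ zero zero).trans (congrArg succ (add_zero zero))⟩

/-- The algebraic notation of `ArithCompat`, together with induction for arithmetical formulas with
parameters. -/
class ArithInduction (M : Type u) [LA.Structure M] [Zero M] [One M] [Add M] [Mul M] [LT M] : Prop
    extends ArithCompat M where
  ind {n : ℕ} (φ : LA.Formula (Fin (n + 1))) (p : Fin n → M) :
    φ.Realize (Fin.snoc (α := fun _ => M) p 0) →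
    (∀ x, φ.Realize (Fin.snoc (α := fun _ => M) p x) →
      φ.Realize (Fin.snoc (α := fun _ => M) p (x + 1))) →
    ∀ x, φ.Realize (Fin.snoc (α := fun _ => M) p x)

section ArithInduction

variable {M : Type u} [LA.Structure M] [Zero M] [One M] [Add M] [Mul M] [LT M] [ArithInduction M]

theorem arith_induction {n : ℕ} (φ : LA.Formula (Fin (n + 1))) (p : Fin n → M) (S : M → Prop)
    (hφ : ∀ x, φ.Realize (Fin.snoc (α := fun _ => M) p x) ↔ S x) (h0 : S 0)
    (hs : ∀ x, S x → S (x + 1)) (x : M) : S x := by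
  have h := ArithInduction.ind φ p
  simp only [hφ] at h
  exact h h0 hs x

theorem eq_zero_or_exists_add_one (x : M) : x = 0 ∨ ∃ y, x = y + 1 :=
  arith_induction (eqF (v 0) 0 ⊔ exF (eqF (v 0) (sc (v 1)))) ![]
    (fun x : M => x = 0 ∨ ∃ y, x = y + 1) (by simp) (Or.inl rfl) (fun x _ => Or.inr ⟨x, rfl⟩) x

end ArithInduction

/-! ## Peano arithmetic defines an ordered semiring -/

/-- A model of Peano arithmetic in algebraic notation, before any semiring law is known. -/
class PeanoAxioms (M : Type u) [LA.Structure M] [Zero M] [One M] [Add M] [Mul M] [LT M] : Prop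
    extends ArithInduction M where
  zero_add_one : (0 : M) + 1 = 1
  model_Q : M ⊨ Q

namespace PeanoAxioms

variable {M : Type u} [LA.Structure M] [Zero M] [One M] [Add M] [Mul M] [LT M] [PeanoAxioms M]

theorem add_one_ne_zero (x : M) : x + 1 ≠ 0 := by
  have h := realize_of_mem_Q model_Q ((eqF (sc (v 0)) 0).not)
    ![x] (by simp [Q])
  simpa using h

theorem add_one_inj {x y : M} : x + 1 = y + 1 → x = y := by
  have h := realize_of_mem_Q model_Q ((eqF (sc (v 0)) (sc (v 1))).imp (eqF (v 0) (v 1)))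
    ![x, y] (by simp [Q])
  simpa using h

protected theorem add_zero (x : M) : x + 0 = x := by
  have h := realize_of_mem_Q model_Q (eqF (v 0 + 0) (v 0))
    ![x] (by simp [Q])
  simpa using h

theorem add_add_one (x y : M) : x + (y + 1) = x + y + 1 := by
  have h := realize_of_mem_Q model_Q (eqF (v 0 + sc (v 1)) (sc (v 0 + v 1)))
    ![x, y] (by simp [Q])
  simpa using h

protected theorem mul_zero (x : M) : x * 0 = 0 := by
  have h := realize_of_mem_Q model_Q (eqF (v 0 * 0) 0)
    ![x] (by simp [Q])
  simpa using h

theorem mul_add_one (x y : M) : x * (y + 1) = x * y + x := by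
  have h := realize_of_mem_Q model_Q (eqF (v 0 * sc (v 1)) (v 0 * v 1 + v 0))
    ![x, y] (by simp [Q])
  simpa using h

theorem lt_iff_exists_add {x y : M} : x < y ↔ ∃ z, z + 1 + x = y := by
  have h := realize_of_mem_Q model_Q ((ltF (v 0) (v 1)).iff (exF (eqF (sc (v 2) + v 0) (v 1))))
    ![x, y] (by simp [Q])
  simpa using h

protected theorem zero_add (x : M) : 0 + x = x :=
  arith_induction (eqF (0 + v 0) (v 0)) ![] (fun x : M => 0 + x = x)
    (by simp) (PeanoAxioms.add_zero 0)
    (fun x hx => by rw [add_add_one, hx]) x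

protected theorem add_assoc (a b c : M) : a + b + c = a + (b + c) :=
  arith_induction (eqF (v 0 + v 1 + v 2) (v 0 + (v 1 + v 2))) ![a, b]
    (fun c => a + b + c = a + (b + c))
    (by simp) (by rw [PeanoAxioms.add_zero, PeanoAxioms.add_zero])
    (fun x hx => by rw [add_add_one, add_add_one, add_add_one, hx]) c

theorem add_one_add (a b : M) : a + 1 + b = a + b + 1 :=
  arith_induction (eqF (sc (v 0) + v 1) (sc (v 0 + v 1))) ![a]
    (fun b => a + 1 + b = a + b + 1) (by simp) (by rw [PeanoAxioms.add_zero, PeanoAxioms.add_zero])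
    (fun x hx => by rw [add_add_one, add_add_one, hx]) b

protected theorem add_comm (a b : M) : a + b = b + a :=
  arith_induction (eqF (v 0 + v 1) (v 1 + v 0)) ![a]
    (fun b => a + b = b + a) (by simp) (by rw [PeanoAxioms.add_zero, PeanoAxioms.zero_add])
    (fun x hx => by rw [add_add_one, add_one_add, hx]) b

protected theorem add_right_comm (a b c : M) : a + b + c = a + c + b := by
  rw [PeanoAxioms.add_assoc, PeanoAxioms.add_assoc, PeanoAxioms.add_comm b c]

protected theorem add_right_cancel {a b c : M} : a + c = b + c → a = b :=
  arith_induction ((eqF (v 0 + v 2) (v 1 + v 2)).imp (eqF (v 0) (v 1))) ![a, b]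
    (fun c => a + c = b + c → a = b) (by simp) (by simp [PeanoAxioms.add_zero])
    (fun x hx h => by rw [add_add_one, add_add_one] at h; exact hx (add_one_inj h)) c

protected theorem zero_mul (x : M) : 0 * x = 0 :=
  arith_induction (eqF (0 * v 0) 0) ![] (fun x : M => 0 * x = 0) (by simp) (PeanoAxioms.mul_zero 0)
    (fun x hx => by rw [mul_add_one, hx, PeanoAxioms.add_zero]) x

theorem add_one_mul (a b : M) : (a + 1) * b = a * b + b :=
  arith_induction (eqF (sc (v 0) * v 1) (v 0 * v 1 + v 1)) ![a]
    (fun b => (a + 1) * b = a * b + b)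
    (by simp) (by rw [PeanoAxioms.mul_zero, PeanoAxioms.mul_zero, PeanoAxioms.add_zero])
    (fun x hx => by
      rw [mul_add_one, mul_add_one, hx, add_add_one, add_add_one,
        PeanoAxioms.add_right_comm _ x a]) b

protected theorem mul_comm (a b : M) : a * b = b * a :=
  arith_induction (eqF (v 0 * v 1) (v 1 * v 0)) ![a]
    (fun b => a * b = b * a) (by simp) (by rw [PeanoAxioms.mul_zero, PeanoAxioms.zero_mul])
    (fun x hx => by rw [mul_add_one, add_one_mul, hx]) b

protected theorem mul_add (a b c : M) : a * (b + c) = a * b + a * c :=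
  arith_induction (eqF (v 0 * (v 1 + v 2)) (v 0 * v 1 + v 0 * v 2)) ![a, b]
    (fun c => a * (b + c) = a * b + a * c)
    (by simp) (by rw [PeanoAxioms.add_zero, PeanoAxioms.mul_zero, PeanoAxioms.add_zero])
    (fun x hx => by rw [add_add_one, mul_add_one, mul_add_one, hx, PeanoAxioms.add_assoc]) c

protected theorem mul_assoc (a b c : M) : a * b * c = a * (b * c) :=
  arith_induction (eqF (v 0 * v 1 * v 2) (v 0 * (v 1 * v 2))) ![a, b]
    (fun c => a * b * c = a * (b * c))
    (by simp) (by rw [PeanoAxioms.mul_zero, PeanoAxioms.mul_zero, PeanoAxioms.mul_zero])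
    (fun x hx => by rw [mul_add_one, mul_add_one, PeanoAxioms.mul_add, hx]) c

protected theorem mul_one (a : M) : a * 1 = a := by
  rw [← zero_add_one, mul_add_one, PeanoAxioms.mul_zero, PeanoAxioms.zero_add]

theorem eq_zero_of_add_eq_zero {a b : M} (h : a + b = 0) : b = 0 := by
  rcases eq_zero_or_exists_add_one b with rfl | ⟨y, rfl⟩
  · rfl
  · exact absurd ((add_add_one a y).symm.trans h) (add_one_ne_zero _)

theorem exists_add_eq_total (a b : M) : (∃ z, a + z = b) ∨ ∃ z, b + z = a := by
  refine arith_induction (exF (eqF (v 0 + v 2) (v 1)) ⊔ exF (eqF (v 1 + v 2) (v 0))) ![a]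
    (fun b => (∃ z, a + z = b) ∨ ∃ z, b + z = a) (by simp) (Or.inr ⟨a, PeanoAxioms.zero_add a⟩) ?_ b
  rintro _ (⟨z, rfl⟩ | ⟨z, rfl⟩)
  · exact Or.inl ⟨z + 1, add_add_one _ _⟩
  · rcases eq_zero_or_exists_add_one z with rfl | ⟨y, rfl⟩
    · exact Or.inl ⟨1, by rw [PeanoAxioms.add_zero]⟩
    · exact Or.inr ⟨y, by rw [add_one_add, add_add_one]⟩

variable (M)

/-- The semiring formed by a model of Peano arithmetic. -/
abbrev commSemiring : CommSemiring M where
  add_assoc := PeanoAxioms.add_assoc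
  zero_add := PeanoAxioms.zero_add
  add_zero := PeanoAxioms.add_zero
  add_comm := PeanoAxioms.add_comm
  left_distrib := PeanoAxioms.mul_add
  right_distrib a b c := by
    rw [PeanoAxioms.mul_comm, PeanoAxioms.mul_add, PeanoAxioms.mul_comm c, PeanoAxioms.mul_comm c]
  zero_mul := PeanoAxioms.zero_mul
  mul_zero := PeanoAxioms.mul_zero
  mul_assoc := PeanoAxioms.mul_assoc
  one_mul a := by rw [PeanoAxioms.mul_comm, PeanoAxioms.mul_one]
  mul_one := PeanoAxioms.mul_one
  mul_comm := PeanoAxioms.mul_comm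
  nsmul := nsmulRec

/-- The order of a model of Peano arithmetic, with `a ≤ b` meaning that `b = a + z` for some
`z`. -/
noncomputable abbrev linearOrder : LinearOrder M where
  le a b := ∃ z, a + z = b
  lt := (· < ·)
  le_refl a := ⟨0, PeanoAxioms.add_zero a⟩
  le_trans a b c := by
    rintro ⟨x, rfl⟩ ⟨y, rfl⟩
    exact ⟨x + y, (PeanoAxioms.add_assoc _ _ _).symm⟩
  le_antisymm a b := by
    rintro ⟨x, rfl⟩ ⟨y, hy⟩
    have h0 : y + x = 0 := PeanoAxioms.add_right_cancel (c := a) (by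
      rw [PeanoAxioms.add_comm, PeanoAxioms.add_comm y, ← PeanoAxioms.add_assoc, hy,
        PeanoAxioms.zero_add])
    rw [eq_zero_of_add_eq_zero h0, PeanoAxioms.add_zero]
  le_total := exists_add_eq_total
  lt_iff_le_not_ge a b := by
    rw [lt_iff_exists_add]
    constructor
    · rintro ⟨z, rfl⟩
      refine ⟨⟨z + 1, PeanoAxioms.add_comm _ _⟩, ?_⟩
      rintro ⟨y, hy⟩
      refine add_one_ne_zero (z + y) (PeanoAxioms.add_right_cancel (c := a) ?_)
      rw [PeanoAxioms.zero_add, ← add_one_add, PeanoAxioms.add_right_comm, hy]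
    · rintro ⟨⟨z, rfl⟩, h⟩
      rcases eq_zero_or_exists_add_one z with rfl | ⟨y, rfl⟩
      · exact absurd ⟨0, by rw [PeanoAxioms.add_zero, PeanoAxioms.add_zero]⟩ h
      · exact ⟨y, PeanoAxioms.add_comm _ _⟩
  toDecidableLE := Classical.decRel _

section Order

attribute [local instance] commSemiring linearOrder

theorem isOrderedCancelAddMonoid : IsOrderedCancelAddMonoid M where
  add_le_add_left := by
    rintro a b ⟨z, rfl⟩ c
    exact ⟨z, PeanoAxioms.add_right_comm _ _ _⟩
  le_of_add_le_add_left := by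
    rintro a b c ⟨z, hz⟩
    refine ⟨z, PeanoAxioms.add_right_cancel (c := a) ?_⟩
    rw [add_right_comm, add_comm b, hz, add_comm]

theorem canonicallyOrderedAdd : CanonicallyOrderedAdd M where
  exists_add_of_le := by
    rintro a b ⟨z, rfl⟩
    exact ⟨z, rfl⟩
  le_add_self a b := ⟨b, PeanoAxioms.add_comm _ _⟩
  le_self_add a b := ⟨b, rfl⟩

theorem isStrictOrderedRing : IsStrictOrderedRing M := by
  have : IsOrderedCancelAddMonoid M := isOrderedCancelAddMonoid M
  have : Nontrivial M := ⟨⟨0 + 1, 0, add_one_ne_zero 0⟩⟩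
  have : ZeroLEOneClass M := ⟨⟨1, PeanoAxioms.zero_add 1⟩⟩
  have mul_lt_mul_left (a : M) (ha : 0 < a) (b c : M) (hbc : b < c) : a * b < a * c := by
    obtain ⟨x, rfl⟩ := lt_iff_exists_add.1 ha
    obtain ⟨y, rfl⟩ := lt_iff_exists_add.1 hbc
    exact lt_iff_exists_add.2 ⟨(x + 1) * y + x, by ring⟩
  exact
    { mul_lt_mul_of_pos_left := fun a ha b c => mul_lt_mul_left a ha b c
      mul_lt_mul_of_pos_right := fun a ha b c hbc => by
        simpa only [mul_comm] using mul_lt_mul_left a ha b c hbc }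

end Order

end PeanoAxioms

/-- A model of Peano arithmetic with its ordered semiring structure: the symbols of arithmetic have
their algebraic meaning, and induction holds for arithmetical formulas with parameters. -/
class PeanoModel (M : Type u) [LA.Structure M] extends CommSemiring M, LinearOrder M,
  IsStrictOrderedRing M, CanonicallyOrderedAdd M, ArithInduction M

theorem PeanoAxioms.nonempty_peanoModel (M : Type u) [LA.Structure M] [Zero M] [One M] [Add M]
    [Mul M] [LT M] [PeanoAxioms M] : Nonempty (PeanoModel M) :=
  ⟨{ commSemiring M, linearOrder M, isStrictOrderedRing M, canonicallyOrderedAdd M,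
      (inferInstance : ArithInduction M) with }⟩

/-! ## Coded finite sets -/

section Moduli

variable {R : Type*} [CommSemiring R] [LinearOrder R] [IsStrictOrderedRing R]
  [CanonicallyOrderedAdd R]

theorem dvd_of_dvd_add {a b c : R} (h : a ∣ b + c) (hb : a ∣ b) : a ∣ c := by
  obtain ⟨u, rfl⟩ := hb
  obtain ⟨w, hw⟩ := h
  rcases eq_or_ne a 0 with rfl | ha
  · simp_all
  have huw : u ≤ w :=
    le_of_mul_le_mul_left (hw ▸ le_self_add : a * u ≤ a * w) (pos_iff_ne_zero.2 ha)
  obtain ⟨t, rfl⟩ := exists_add_of_le huw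
  rw [mul_add] at hw
  exact ⟨t, add_left_cancel hw⟩

/-- The moduli `(x + 1) d + 1` and `(y + 1) d + 1` are coprime because a common divisor divides
`(x - y) d`. -/
theorem modulus_dvd_of_dvd_mul {d x y e t : R} (hxy : x + t = y ∨ y + t = x) (ht : t ∣ d)
    (h : (x + 1) * d + 1 ∣ e * ((y + 1) * d + 1)) : (x + 1) * d + 1 ∣ e := by
  have hte : (x + 1) * d + 1 ∣ t * e := by
    have hx : (x + 1) * d + 1 ∣ (x + 1) * (e * ((y + 1) * d + 1)) := h.mul_left _
    have hy : (x + 1) * d + 1 ∣ (y + 1) * e * ((x + 1) * d + 1) := Dvd.intro_left _ rfl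
    rcases hxy with rfl | rfl
    · refine dvd_of_dvd_add ?_ hx
      convert hy using 1
      ring
    · refine dvd_of_dvd_add ?_ hy
      convert hx using 1
      ring
  obtain ⟨s, rfl⟩ := ht
  have hse : (x + 1) * (t * s) + 1 ∣ (x + 1) * s * (t * e) := hte.mul_left _
  exact dvd_of_dvd_add ⟨e, by ring⟩ hse

theorem modulus_dvd_of_dvd_mul_of_ne {b d x y e : R} (hd : ∀ t, 0 < t → t ≤ b → t ∣ d)
    (hx : x ≤ b) (hy : y ≤ b) (hxy : x ≠ y) (h : (x + 1) * d + 1 ∣ e * ((y + 1) * d + 1)) :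
    (x + 1) * d + 1 ∣ e := by
  rcases lt_or_gt_of_ne hxy with hlt | hlt
  · obtain ⟨t, ht, rfl⟩ := exists_pos_add_of_lt' hlt
    exact modulus_dvd_of_dvd_mul (Or.inl rfl) (hd t ht (le_add_self.trans hy)) h
  · obtain ⟨t, ht, rfl⟩ := exists_pos_add_of_lt' hlt
    exact modulus_dvd_of_dvd_mul (Or.inr rfl) (hd t ht (le_add_self.trans hx)) h

end Moduli

section PeanoModel

variable {M : Type u} [LA.Structure M]

/-- The semantic counterpart of `inW`: `x` belongs to the finite set coded by `c`, `d`. -/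
def InCoded (x c d : M) : Prop := memF.Realize ![x, c, d]

@[simp]
theorem realize_inW {n : ℕ} (x c d : LA.Term (Fin n)) (e : Fin n → M) :
    (inW x c d).Realize e ↔ InCoded (x.realize e) (c.realize e) (d.realize e) := by
  simp only [inW, InCoded, realize_substF, realize_vecCons, realize_vecEmpty]

/-- The elements generated by the operator `Φ`: `x` belongs to a coded finite set `W` all of whose
members `y` satisfy `Φ W y`. -/
def Gen (Φ : (M → Prop) → M → Prop) (x : M) : Prop :=
  ∃ c d, InCoded x c d ∧ ∀ y, InCoded y c d → Φ (InCoded · c d) y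

theorem Gen.elim {Φ : (M → Prop) → M → Prop} (hΦ : Monotone Φ) {x : M} (h : Gen Φ x) :
    Φ (Gen Φ) x := by
  obtain ⟨c, d, hx, h⟩ := h
  exact hΦ (fun _ hz => ⟨c, d, hz, h⟩) x (h x hx)

variable [PeanoModel M]

@[simp]
theorem realize_num {α : Type} (k : ℕ) (e : α → M) : (num k).realize e = (k : M) := by
  induction k with
  | zero => simp [num]
  | succ k ih => simp [num, ih]

@[simp]
theorem realize_leF {α : Type} (t s : LA.Term α) (e : α → M) :
    (leF t s).Realize e ↔ t.realize e ≤ s.realize e := by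
  simp [leF, le_iff_lt_or_eq]

theorem add_one_le_iff_lt {x y : M} : x + 1 ≤ y ↔ x < y := by
  refine ⟨(lt_add_one x).trans_le, fun h => ?_⟩
  obtain ⟨z, hz, rfl⟩ := exists_pos_add_of_lt' h
  obtain ⟨y, rfl⟩ := (eq_zero_or_exists_add_one z).resolve_left hz.ne'
  gcongr
  exact le_add_self

noncomputable instance : SuccAddOrder M :=
  { SuccOrder.ofSuccLeIff (fun x : M => x + 1) add_one_le_iff_lt with
    succ_eq_add_one := fun _ => rfl }

theorem pr_lt_of_add_lt {a b c d : M} (h : a + b < c + d) : pr a b < pr c d :=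
  calc pr a b ≤ (a + b) * (a + b) + (a + b) := by
        unfold pr
        gcongr
        exact le_self_add
    _ < (a + b + 1) * (a + b + 1) := by
        rw [show (a + b + 1) * (a + b + 1) = (a + b) * (a + b) + (a + b) + (a + b + 1) by ring]
        exact lt_add_of_pos_right _ (by positivity)
    _ ≤ (c + d) * (c + d) := by exact mul_self_le_mul_self zero_le (Order.add_one_le_of_lt h)
    _ ≤ pr c d := le_self_add

@[simp]
theorem pr_inj {a b c d : M} : pr a b = pr c d ↔ a = c ∧ b = d := by
  refine ⟨fun h => ?_, fun ⟨hac, hbd⟩ => by rw [hac, hbd]⟩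
  rcases lt_trichotomy (a + b) (c + d) with hlt | heq | hlt
  · exact absurd h (pr_lt_of_add_lt hlt).ne
  · have hac : a = c := by
      unfold pr at h
      rw [heq] at h
      exact add_left_cancel h
    subst hac
    exact ⟨rfl, add_left_cancel heq⟩
  · exact absurd h (pr_lt_of_add_lt hlt).ne'

theorem le_pr_left (a b : M) : a ≤ pr a b :=
  le_add_self

theorem le_pr_right (a b : M) : b ≤ pr a b := by
  rcases eq_or_ne b 0 with rfl | hb
  · exact zero_le
  · calc b = 1 * b := (one_mul b).symm
      _ ≤ (a + b) * (a + b) := by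
        gcongr
        · exact (Order.one_le_iff_pos.2 (pos_iff_ne_zero.2 hb)).trans le_add_self
        · exact le_add_self
      _ ≤ pr a b := le_self_add

theorem not_modulus_dvd_one {d : M} (hd : 0 < d) (x : M) : ¬ (x + 1) * d + 1 ∣ 1 := by
  rintro ⟨z, hz⟩
  have hz1 : 1 ≤ z := Order.one_le_iff_pos.2 (pos_iff_ne_zero.2 (by rintro rfl; simp at hz))
  have hlt : 1 < (x + 1) * d + 1 := lt_add_of_pos_left _ (by positivity)
  exact absurd hz (hlt.trans_le (le_mul_of_one_le_right zero_le hz1)).ne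

theorem exists_common_multiple (b : M) : ∃ d : M, 0 < d ∧ ∀ x, 0 < x → x ≤ b → x ∣ d := by
  refine arith_induction
    (exF (ltF 0 (v 1) ⊓ allF ((ltF 0 (v 2)).imp ((leF (v 2) (v 0)).imp
      (exF (eqF (v 1) (v 2 * v 3)))))))
    ![] (fun b : M => ∃ d : M, 0 < d ∧ ∀ x, 0 < x → x ≤ b → x ∣ d)
    (by simp [Dvd.dvd]) ?_ ?_ b
  · exact ⟨1, one_pos, fun x hx hx0 => absurd hx (not_lt.2 hx0)⟩
  · rintro b ⟨d, hd, h⟩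
    refine ⟨d * (b + 1), mul_pos hd (by positivity), fun x hx hxb => ?_⟩
    rcases hxb.lt_or_eq with hlt | rfl
    · exact (h x hx (Order.lt_add_one_iff.1 hlt)).mul_right _
    · exact dvd_mul_left _ _

theorem inCoded_iff {x c d : M} :
    InCoded x c d ↔ ∃ b e, c = pr b e ∧ x < b ∧ (x + 1) * d + 1 ∣ e := by
  simp [InCoded, memF, and_assoc, Dvd.dvd, eq_comm]

theorem inCoded_pr_iff {x b e d : M} : InCoded x (pr b e) d ↔ x < b ∧ (x + 1) * d + 1 ∣ e := by
  rw [inCoded_iff]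
  constructor
  · rintro ⟨b', e', h, hx⟩
    obtain ⟨rfl, rfl⟩ := pr_inj.1 h
    exact hx
  · exact fun hx => ⟨b, e, rfl, hx⟩

theorem InCoded.lt {x c d : M} (h : InCoded x c d) : x < c := by
  obtain ⟨b, e, rfl, hx, -⟩ := inCoded_iff.1 h
  exact hx.trans_le (le_pr_left _ _)

theorem exists_modulus_dvd_iff_succ {b d n : M} (hd : ∀ t, 0 < t → t ≤ b → t ∣ d) (hn : n < b)
    (S : M → Prop) {e : M} (he : ∀ x < b, (x + 1) * d + 1 ∣ e ↔ x < n ∧ S x) :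
    ∃ e' : M, ∀ x < b, (x + 1) * d + 1 ∣ e' ↔ x < n + 1 ∧ S x := by
  by_cases hS : S n
  · refine ⟨e * ((n + 1) * d + 1), fun x hx => ?_⟩
    rcases eq_or_ne x n with rfl | hxn
    · exact iff_of_true (dvd_mul_left _ _) ⟨lt_add_one x, hS⟩
    · rw [Order.lt_add_one_iff, hxn.le_iff_lt, ← he x hx]
      exact ⟨modulus_dvd_of_dvd_mul_of_ne hd hx.le hn.le hxn, fun h => h.mul_right _⟩
  · refine ⟨e, fun x hx => ?_⟩
    rw [he x hx, Order.lt_add_one_iff]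
    refine and_congr_left fun h => ?_
    have hxn : x ≠ n := by
      rintro rfl
      exact hS h
    rw [hxn.le_iff_lt]

theorem exists_modulus_dvd_iff {m : ℕ} (φ : LA.Formula (Fin (m + 1))) (p : Fin m → M) {b d : M}
    (hd0 : 0 < d) (hd : ∀ t, 0 < t → t ≤ b → t ∣ d) (n : M) (hn : n ≤ b) :
    ∃ e : M, ∀ x < b,
      (x + 1) * d + 1 ∣ e ↔ x < n ∧ φ.Realize (Fin.snoc (α := fun _ => M) p x) := by
  refine arith_induction (n := m + 1 + 1)
    ((leF (v (Fin.last _)) (v (Fin.last m).castSucc.castSucc)).imp <| exF <| allF <|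
      (ltF (v (Fin.last _)) (v (Fin.last m).castSucc.castSucc.castSucc.castSucc)).imp <|
        (exF (eqF (v (Fin.last (m + 1 + 1 + 1)).castSucc.castSucc)
          (sc (sc (v (Fin.last _).castSucc) *
            v (Fin.last (m + 1)).castSucc.castSucc.castSucc.castSucc) * v (Fin.last _)))).iff
        (ltF (v (Fin.last _)) (v (Fin.last (m + 1 + 1)).castSucc.castSucc) ⊓
          φ.subst (Fin.snoc (α := fun _ => LA.Term (Fin (m + 1 + 1 + 1 + 1 + 1)))
            (fun i => v i.castSucc.castSucc.castSucc.castSucc.castSucc) (v (Fin.last _)))))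
    (Fin.snoc (α := fun _ => M) (Fin.snoc (α := fun _ => M) p b) d)
    (fun n => n ≤ b → ∃ e : M, ∀ x < b,
      (x + 1) * d + 1 ∣ e ↔ x < n ∧ φ.Realize (Fin.snoc (α := fun _ => M) p x))
    (fun n => ?_) ?_ ?_ n hn
  · simp [realize_snoc, Dvd.dvd]
  · exact fun _ => ⟨1, fun x _ => iff_of_false (not_modulus_dvd_one hd0 x) fun h => not_lt_zero h.1⟩
  · intro n ih hn
    obtain ⟨e, he⟩ := ih (le_self_add.trans hn)
    exact exists_modulus_dvd_iff_succ hd (Order.add_one_le_iff.1 hn) _ he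

theorem exists_inCoded_iff {m : ℕ} (φ : LA.Formula (Fin (m + 1))) (p : Fin m → M) (b : M) :
    ∃ c d, ∀ x, InCoded x c d ↔ x < b ∧ φ.Realize (Fin.snoc (α := fun _ => M) p x) := by
  obtain ⟨d, hd0, hd⟩ := exists_common_multiple b
  obtain ⟨e, he⟩ := exists_modulus_dvd_iff φ p hd0 hd b le_rfl
  refine ⟨pr b e, d, fun x => inCoded_pr_iff.trans ⟨fun h => (he x h.1).1 h.2, fun h => ?_⟩⟩
  exact ⟨h.1, (he x h.1).2 h⟩

theorem exists_inCoded_iff_union_insert (c₁ d₁ c₂ d₂ y : M) :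
    ∃ c d, ∀ x, InCoded x c d ↔ InCoded x c₁ d₁ ∨ InCoded x c₂ d₂ ∨ x = y := by
  obtain ⟨c, d, h⟩ := exists_inCoded_iff
    (inW (v 5) (v 0) (v 1) ⊔ inW (v 5) (v 2) (v 3) ⊔ eqF (v 5) (v 4)) ![c₁, d₁, c₂, d₂, y]
    (c₁ + c₂ + (y + 1))
  refine ⟨c, d, fun x => (h x).trans ?_⟩
  simp only [snoc_vecCons, snoc_vecEmpty, Formula.realize_sup, realize_inW, realize_v, realize_eqF,
    or_assoc]
  change _ ∧ (InCoded x c₁ d₁ ∨ InCoded x c₂ d₂ ∨ x = y) ↔ _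
  refine and_iff_right_of_imp ?_
  rintro (hx | hx | rfl)
  · exact hx.lt.trans_le (le_self_add.trans le_self_add)
  · exact hx.lt.trans_le (le_add_self.trans le_self_add)
  · exact (lt_add_one _).trans_le le_add_self

theorem exists_forall_not_inCoded : ∃ c d : M, ∀ x, ¬ InCoded x c d :=
  ⟨pr 0 0, 0, fun _ h => not_lt_zero (inCoded_pr_iff.1 h).1⟩

theorem exists_inCoded_of_gen {Φ : (M → Prop) → M → Prop} (hΦ : Monotone Φ) {F : Set M}
    (hF : F.Finite) (h : ∀ y ∈ F, Gen Φ y) :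
    ∃ c d : M, (∀ y ∈ F, InCoded y c d) ∧ ∀ y, InCoded y c d → Φ (InCoded · c d) y := by
  induction F, hF using Set.Finite.induction_on with
  | empty =>
    obtain ⟨c, d, hcd⟩ := exists_forall_not_inCoded (M := M)
    exact ⟨c, d, by simp, fun y hy => absurd hy (hcd y)⟩
  | @insert a _ _ _ ih =>
    obtain ⟨c₁, d₁, hF₁, hΦ₁⟩ := ih fun y hy => h y (Set.mem_insert_of_mem _ hy)
    obtain ⟨c₂, d₂, ha, hΦ₂⟩ := h a (Set.mem_insert _ _)
    obtain ⟨c, d, hcd⟩ := exists_inCoded_iff_union_insert c₁ d₁ c₂ d₂ a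
    have hle₁ : (InCoded · c₁ d₁) ≤ (InCoded · c d) := fun z hz => (hcd z).2 (Or.inl hz)
    have hle₂ : (InCoded · c₂ d₂) ≤ (InCoded · c d) := fun z hz => (hcd z).2 (Or.inr (Or.inl hz))
    refine ⟨c, d, ?_, fun y hy => ?_⟩
    · rintro y (rfl | hy)
      · exact hle₂ _ ha
      · exact hle₁ _ (hF₁ y hy)
    · rcases (hcd y).1 hy with hy | hy | rfl
      · exact hΦ hle₁ y (hΦ₁ y hy)
      · exact hΦ hle₂ y (hΦ₂ y hy)
      · exact hΦ hle₂ y (hΦ₂ y ha)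

theorem Gen.intro {Φ : (M → Prop) → M → Prop} (hΦ : Monotone Φ) {x : M} {F : Set M}
    (hF : F.Finite) (hx : Φ (· ∈ F) x) (h : ∀ y ∈ F, Gen Φ y) : Gen Φ x := by
  obtain ⟨c, d, hFcd, hcd⟩ := exists_inCoded_of_gen hΦ hF h
  obtain ⟨c', d', h'⟩ := exists_inCoded_iff_union_insert c d c d x
  have hle : (InCoded · c d) ≤ (InCoded · c' d') := fun z hz => (h' z).2 (Or.inl hz)
  refine ⟨c', d', (h' x).2 (Or.inr (Or.inr rfl)), fun y hy => ?_⟩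
  rcases (h' y).1 hy with hy | hy | rfl
  · exact hΦ hle y (hcd y hy)
  · exact hΦ hle y (hcd y hy)
  · exact hΦ (fun z hz => hle z (hFcd z hz)) y hx

end PeanoModel

/-! ## Arithmetized syntax in a model of Peano arithmetic -/

section Finitary

variable {M : Type*}

/-- A monotone property of predicates that depends only on finite parts of the predicate. It is a
class so that instance search verifies it clause by clause for the operators below. -/
class Finitary (Ψ : (M → Prop) → Prop) : Prop where
  monotone : Monotone Ψ
  exists_finite {P : M → Prop} : Ψ P → ∃ F : Set M, F.Finite ∧ (∀ y ∈ F, P y) ∧ Ψ (· ∈ F)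

instance (p : Prop) : Finitary (fun _ : M → Prop => p) where
  monotone _ _ _ := id
  exists_finite h := ⟨∅, Set.finite_empty, by simp, h⟩

instance (a : M) : Finitary (fun P : M → Prop => P a) where
  monotone _ _ h := h a
  exists_finite h := ⟨{a}, Set.finite_singleton a, by simpa using h, rfl⟩

instance {Ψ Ξ : (M → Prop) → Prop} [Finitary Ψ] [Finitary Ξ] : Finitary fun P => Ψ P ∧ Ξ P where
  monotone _ _ hPQ hP := ⟨Finitary.monotone hPQ hP.1, Finitary.monotone hPQ hP.2⟩
  exists_finite hP := by
    obtain ⟨F, hF, hFP, hΨ⟩ := Finitary.exists_finite hP.1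
    obtain ⟨G, hG, hGP, hΞ⟩ := Finitary.exists_finite hP.2
    exact ⟨F ∪ G, hF.union hG, fun y hy => hy.elim (hFP y) (hGP y),
      Finitary.monotone (fun _ => Or.inl) hΨ, Finitary.monotone (fun _ => Or.inr) hΞ⟩

instance {Ψ Ξ : (M → Prop) → Prop} [Finitary Ψ] [Finitary Ξ] : Finitary fun P => Ψ P ∨ Ξ P where
  monotone _ _ hPQ hP := hP.imp (Finitary.monotone hPQ) (Finitary.monotone hPQ)
  exists_finite hP := by
    rcases hP with hP | hP
    · obtain ⟨F, hF, hFP, hΨ⟩ := Finitary.exists_finite hP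
      exact ⟨F, hF, hFP, Or.inl hΨ⟩
    · obtain ⟨F, hF, hFP, hΞ⟩ := Finitary.exists_finite hP
      exact ⟨F, hF, hFP, Or.inr hΞ⟩

instance {ι : Type*} {Ψ : ι → (M → Prop) → Prop} [∀ i, Finitary (Ψ i)] :
    Finitary fun P => ∃ i, Ψ i P where
  monotone _ _ hPQ := Exists.imp fun _ => Finitary.monotone hPQ
  exists_finite := by
    rintro P ⟨i, hP⟩
    obtain ⟨F, hF, hFP, hΨ⟩ := Finitary.exists_finite hP
    exact ⟨F, hF, hFP, i, hΨ⟩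

end Finitary

section Codes

variable {T : Type*} [CommSemiring T]

/-- The code of the variable with index `i`; this and the following codes are the values of the
terms `cVar`, …, `cBex`, `cons`. -/
abbrev varCode (i : T) : T := pr 0 i
/-- The code of the variable `z_i`. -/
abbrev zCode (i : T) : T := pr 1 i
/-- The code of the term `0`. -/
abbrev zeroCode : T := pr 2 0
/-- The code of a successor term. -/
abbrev succCode (t : T) : T := pr 3 t
/-- The code of a sum. -/
abbrev addCode (t s : T) : T := pr 4 (pr t s)
/-- The code of a product. -/
abbrev mulCode (t s : T) : T := pr 5 (pr t s)
/-- The code of an equation. -/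
abbrev eqCode (t s : T) : T := pr 6 (pr t s)
/-- The code of an inequality `t < s`. -/
abbrev ltCode (t s : T) : T := pr 7 (pr t s)
/-- The code of a negation. -/
abbrev negCode (φ : T) : T := pr 8 φ
/-- The code of a disjunction. -/
abbrev orCode (φ ψ : T) : T := pr 9 (pr φ ψ)
/-- The code of an existential quantification. -/
abbrev exCode (φ : T) : T := pr 10 φ
/-- The code of the bounded quantification `∃ y < t, φ`. -/
abbrev bexCode (t φ : T) : T :=
  exCode (negCode (orCode (negCode (ltCode (varCode 0) t)) (negCode φ)))
/-- The tuple with first entry `b` and remaining entries `a`. -/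
abbrev consCode (b a : T) : T := pr b a + 1

end Codes

section PeanoModel

variable {M : Type u} [LA.Structure M] [PeanoModel M]

theorem Gen.iff {Φ : (M → Prop) → M → Prop} (hΦ : ∀ x, Finitary fun P => Φ P x) (x : M) :
    Gen Φ x ↔ Φ (Gen Φ) x := by
  have hm : Monotone Φ := fun P Q h x => (hΦ x).monotone h
  refine ⟨Gen.elim hm, fun h => ?_⟩
  obtain ⟨F, hF, hFP, hx⟩ := (hΦ x).exists_finite h
  exact Gen.intro hm hF hx hFP

/-- The clauses of `termF`, defining terms. -/
def TermStep (l m k : M) (W : M → Prop) (y : M) : Prop :=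
  (∃ i, (l ≤ i ∧ i < m) ∧ y = varCode i) ∨ (∃ i, i < k ∧ y = zCode i) ∨ y = zeroCode ∨
    (∃ t, W t ∧ y = succCode t) ∨
    ∃ t s, (W t ∧ W s) ∧ (y = addCode t s ∨ y = mulCode t s)

/-- `t` is a term with ordinary variables in `[l, m)` and `z`-variables below `k`. -/
def IsTermIn (l m k t : M) : Prop := Gen (TermStep l m k) t

@[simp]
theorem realize_isTermIn {n : ℕ} (l m k t : LA.Term (Fin n)) (e : Fin n → M) :
    (isTermIn l m k t).Realize e ↔
      IsTermIn (l.realize e) (m.realize e) (k.realize e) (t.realize e) := by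
  simp only [isTermIn, realize_substF, realize_vecCons, realize_vecEmpty]
  simp [termF, IsTermIn, Gen, TermStep, cVar, cZ,
    cZero, cSucc, cAdd, cMul, or_assoc]

theorem isTermIn_iff (l m k t : M) : IsTermIn l m k t ↔ TermStep l m k (IsTermIn l m k) t :=
  Gen.iff (fun x => by unfold TermStep; infer_instance) t

@[simp]
theorem isTermIn_zCode {l m k i : M} : IsTermIn l m k (zCode i) ↔ i < k := by
  rw [isTermIn_iff]
  simp [TermStep]

theorem isTermIn_zeroCode {l m k : M} : IsTermIn l m k zeroCode := by
  rw [isTermIn_iff]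
  simp [TermStep]

@[simp]
theorem isTermIn_succCode {l m k t : M} : IsTermIn l m k (succCode t) ↔ IsTermIn l m k t := by
  rw [isTermIn_iff]
  simp [TermStep]

/-- The clauses of `formF`, defining formulas. -/
def FormStep (W : M → Prop) (y : M) : Prop :=
  ∃ m p q,
    ((IsTermIn 0 m 0 p ∧ IsTermIn 0 m 0 q) ∧ (y = pr m (eqCode p q) ∨ y = pr m (ltCode p q))) ∨
    (W (pr m p) ∧ y = pr m (negCode p)) ∨
    ((W (pr m p) ∧ W (pr m q)) ∧ y = pr m (orCode p q)) ∨
    (W (pr (m + 1) p) ∧ y = pr m (exCode p))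

/-- `φ` is a formula in `m` variables. -/
def IsForm (m φ : M) : Prop := Gen FormStep (pr m φ)

@[simp]
theorem realize_isForm {n : ℕ} (m φ : LA.Term (Fin n)) (e : Fin n → M) :
    (isForm m φ).Realize e ↔ IsForm (m.realize e) (φ.realize e) := by
  simp only [isForm, realize_substF, realize_vecCons, realize_vecEmpty]
  simp [formF, IsForm, Gen, FormStep, isTerm, cEq, cLt, cNeg, cOr, cEx, or_assoc]

theorem isForm_iff (m φ : M) : IsForm m φ ↔ FormStep (Gen FormStep) (pr m φ) :=
  Gen.iff (fun x => by unfold FormStep; infer_instance) _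

@[simp]
theorem isForm_ltCode {m t s : M} :
    IsForm m (ltCode t s) ↔ IsTermIn 0 m 0 t ∧ IsTermIn 0 m 0 s := by
  rw [isForm_iff]
  simp [FormStep]

@[simp]
theorem isForm_orCode {m φ ψ : M} : IsForm m (orCode φ ψ) ↔ IsForm m φ ∧ IsForm m ψ := by
  rw [isForm_iff]
  simp [FormStep, IsForm]

/-- The clauses of `tupF`, defining tuples. -/
def TupStep (W : M → Prop) (y : M) : Prop :=
  y = pr 0 0 ∨ ∃ m a b, W (pr m a) ∧ y = pr (m + 1) (consCode b a)

/-- `a` is an `m`-tuple. -/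
def IsTup (m a : M) : Prop := Gen TupStep (pr m a)

@[simp]
theorem realize_isTup {n : ℕ} (m a : LA.Term (Fin n)) (e : Fin n → M) :
    (isTup m a).Realize e ↔ IsTup (m.realize e) (a.realize e) := by
  simp only [isTup, realize_substF, realize_vecCons, realize_vecEmpty]
  simp [tupF, IsTup, Gen, TupStep, cons]

theorem isTup_iff (m a : M) :
    IsTup m a ↔ (m = 0 ∧ a = 0) ∨ ∃ m' a' b, IsTup m' a' ∧ m = m' + 1 ∧ a = consCode b a' := by
  have h : IsTup m a ↔ TupStep (Gen TupStep) (pr m a) :=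
    Gen.iff (fun x => by unfold TupStep; infer_instance) _
  rw [h]
  simp [TupStep, IsTup]

/-- The clauses of `lookF`, defining the entries of tuples. -/
def EntryStep (x : M) (W : M → Prop) (y : M) : Prop :=
  (∃ a, y = pr 0 (consCode x a)) ∨ ∃ i a b, W (pr i a) ∧ y = pr (i + 1) (consCode b a)

/-- The entry of the tuple `a` with index `i` is `x`. -/
def Entry (a i x : M) : Prop := Gen (EntryStep x) (pr i a)

@[simp]
theorem realize_entry {n : ℕ} (a i x : LA.Term (Fin n)) (e : Fin n → M) :
    (entry a i x).Realize e ↔ Entry (a.realize e) (i.realize e) (x.realize e) := by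
  simp only [entry, realize_substF, realize_vecCons, realize_vecEmpty]
  simp [lookF, Entry, Gen, EntryStep, cons]

theorem entry_iff (a i x : M) :
    Entry a i x ↔ (i = 0 ∧ ∃ a', a = consCode x a') ∨
      ∃ i' a' b, Entry a' i' x ∧ i = i' + 1 ∧ a = consCode b a' := by
  have h : Entry a i x ↔ EntryStep x (Gen (EntryStep x)) (pr i a) :=
    Gen.iff (fun x => by unfold EntryStep; infer_instance) _
  rw [h]
  simp [EntryStep, Entry]

/-- The clauses of `valF`, defining the values of terms. -/
def ValStep (a g : M) (W : M → Prop) (y : M) : Prop :=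
  (∃ i x, Entry a i x ∧ y = pr (varCode i) x) ∨ (∃ i x, Entry g i x ∧ y = pr (zCode i) x) ∨
    y = pr zeroCode 0 ∨ (∃ t x, W (pr t x) ∧ y = pr (succCode t) (x + 1)) ∨
    ∃ t x s z, (W (pr t x) ∧ W (pr s z)) ∧
      (y = pr (addCode t s) (x + z) ∨ y = pr (mulCode t s) (x * z))

/-- The value of the term `t` at `a`, `g` is `x`. -/
def Val (a g t x : M) : Prop := Gen (ValStep a g) (pr t x)

@[simp]
theorem realize_val {n : ℕ} (a g t x : LA.Term (Fin n)) (e : Fin n → M) :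
    (val a g t x).Realize e ↔ Val (a.realize e) (g.realize e) (t.realize e) (x.realize e) := by
  simp only [val, realize_substF, realize_vecCons, realize_vecEmpty]
  simp [valF, Val, Gen, ValStep, cVar, cZ, cZero, cSucc, cAdd, cMul, or_assoc]

theorem val_iff (a g t x : M) : Val a g t x ↔ ValStep a g (Gen (ValStep a g)) (pr t x) :=
  Gen.iff (fun x => by unfold ValStep; infer_instance) _

theorem val_zeroCode {a g x : M} : Val a g zeroCode x ↔ x = 0 := by
  rw [val_iff]
  simp [ValStep]

/-- The clauses of `starF`, defining the bounding of quantifiers. -/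
def StarStep (W : M → Prop) (y : M) : Prop :=
  ∃ s p q p' q',
    y = pr s (pr (eqCode p q) (eqCode p q)) ∨
    y = pr s (pr (ltCode p q) (ltCode p q)) ∨
    (W (pr s (pr p q)) ∧ y = pr s (pr (negCode p) (negCode q))) ∨
    ((W (pr s (pr p q)) ∧ W (pr s (pr p' q'))) ∧ y = pr s (pr (orCode p p') (orCode q q'))) ∨
    (W (pr (s + 1) (pr p q)) ∧ y = pr s (pr (exCode p) (bexCode (zCode s) q)))

/-- `ψ` arises from `φ` by bounding the quantifiers, starting with the variable `z_s`. -/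
def IsStar (s φ ψ : M) : Prop := Gen StarStep (pr s (pr φ ψ))

@[simp]
theorem realize_isStar {n : ℕ} (φ ψ : LA.Term (Fin n)) (e : Fin n → M) :
    (isStar φ ψ).Realize e ↔ IsStar 0 (φ.realize e) (ψ.realize e) := by
  simp only [isStar, realize_substF, realize_vecCons, realize_vecEmpty]
  simp [starF, IsStar, Gen, StarStep, cEq, cLt, cNeg, cOr, cEx, cBex, cVar, cZ, or_assoc]

theorem isStar_iff (s φ ψ : M) : IsStar s φ ψ ↔ StarStep (Gen StarStep) (pr s (pr φ ψ)) :=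
  Gen.iff (fun x => by unfold StarStep; infer_instance) _

theorem isStar_ltCode {s t u ψ : M} : IsStar s (ltCode t u) ψ ↔ ψ = ltCode t u := by
  rw [isStar_iff]
  simp [StarStep]

theorem isStar_orCode {s φ φ' ψ : M} :
    IsStar s (orCode φ φ') ψ ↔ ∃ q q', IsStar s φ q ∧ IsStar s φ' q' ∧ ψ = orCode q q' := by
  rw [isStar_iff]
  simp [StarStep, IsStar, and_assoc]

/-- The clauses of `depthF`, defining the quantifier depth. -/
def DepthStep (W : M → Prop) (y : M) : Prop :=
  ∃ p k q l,
    y = pr (eqCode p k) 0 ∨ y = pr (ltCode p k) 0 ∨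
    (W (pr p k) ∧ y = pr (negCode p) k) ∨
    ((W (pr p k) ∧ W (pr q l)) ∧
      ((l ≤ k ∧ y = pr (orCode p q) k) ∨ (k ≤ l ∧ y = pr (orCode p q) l))) ∨
    (W (pr p k) ∧ y = pr (exCode p) (k + 1))

/-- The quantifier depth of `φ` is `k`. -/
def IsDepth (φ k : M) : Prop := Gen DepthStep (pr φ k)

@[simp]
theorem realize_isDepth {n : ℕ} (φ k : LA.Term (Fin n)) (e : Fin n → M) :
    (isDepth φ k).Realize e ↔ IsDepth (φ.realize e) (k.realize e) := by
  simp only [isDepth, realize_substF, realize_vecCons, realize_vecEmpty]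
  simp [depthF, IsDepth, Gen, DepthStep, cEq, cLt, cNeg, cOr, cEx, or_assoc]

theorem isDepth_iff (φ k : M) : IsDepth φ k ↔ DepthStep (Gen DepthStep) (pr φ k) :=
  Gen.iff (fun x => by unfold DepthStep; infer_instance) _

theorem isDepth_ltCode {t s k : M} : IsDepth (ltCode t s) k ↔ k = 0 := by
  rw [isDepth_iff]
  simp [DepthStep]

theorem isDepth_orCode {φ φ' k : M} : IsDepth (orCode φ φ') k ↔
    ∃ l l', IsDepth φ l ∧ IsDepth φ' l' ∧ (l' ≤ l ∧ k = l ∨ l ≤ l' ∧ k = l') := by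
  rw [isDepth_iff]
  constructor
  · rintro ⟨p, l, q, l', h⟩
    obtain ⟨⟨hl, hl'⟩, ⟨hle, ⟨rfl, rfl⟩, rfl⟩ | ⟨hle, ⟨rfl, rfl⟩, rfl⟩⟩ := by simpa using h
    · exact ⟨_, _, hl, hl', Or.inl ⟨hle, rfl⟩⟩
    · exact ⟨_, _, hl, hl', Or.inr ⟨hle, rfl⟩⟩
  · rintro ⟨l, l', hl, hl', h⟩
    exact ⟨φ, l, φ', l', Or.inr (Or.inr (Or.inr (Or.inl ⟨⟨hl, hl'⟩, by simpa using h⟩)))⟩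

/-- The clauses of `satF`, defining truth of formulas with bounded quantifiers. -/
def SatStep (g : M) (W : M → Prop) (y : M) : Prop :=
  ∃ a,
    (∃ t u x z, (Val a g t x ∧ Val a g u z) ∧
      ((x = z ∧ y = pr (eqCode t u) (pr a 1)) ∨ (x ≠ z ∧ y = pr (eqCode t u) (pr a 0)) ∨
        (x < z ∧ y = pr (ltCode t u) (pr a 1)) ∨ (¬ x < z ∧ y = pr (ltCode t u) (pr a 0)))) ∨
    (∃ p, (W (pr p (pr a 0)) ∧ y = pr (negCode p) (pr a 1)) ∨
      (W (pr p (pr a 1)) ∧ y = pr (negCode p) (pr a 0))) ∨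
    (∃ p q,
      ((W (pr p (pr a 1)) ∨ W (pr q (pr a 1))) ∧ y = pr (orCode p q) (pr a 1)) ∨
      ((W (pr p (pr a 0)) ∧ W (pr q (pr a 0))) ∧ y = pr (orCode p q) (pr a 0))) ∨
    ∃ t p x, ((∃ m k, IsTermIn 1 m k t) ∧ Val (consCode 0 a) g t x) ∧
      (((∃ z, z < x ∧ W (pr p (pr (consCode z a) 1))) ∧ y = pr (bexCode t p) (pr a 1)) ∨
        ((∀ z, z < x → W (pr p (pr (consCode z a) 0))) ∧ y = pr (bexCode t p) (pr a 0)))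

/-- The formula `ψ` with bounded quantifiers has the truth value `b` at `a`, `g`. -/
def Sat (g ψ a b : M) : Prop := Gen (SatStep g) (pr ψ (pr a b))

@[simp]
theorem realize_sat {n : ℕ} (g ψ a : LA.Term (Fin n)) (e : Fin n → M) :
    (sat g ψ a).Realize e ↔ Sat (g.realize e) (ψ.realize e) (a.realize e) 1 := by
  simp only [sat, realize_substF, realize_vecCons, realize_vecEmpty]
  simp [satF, Sat, Gen, SatStep, cEq, cLt, cNeg, cOr, cEx, cBex, cVar, cons, or_assoc]

theorem satStep_mono (g : M) : Monotone (SatStep g) := by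
  rintro W W' h y ⟨a, hatom | ⟨p, hneg⟩ | ⟨p, q, hor⟩ | ⟨t, p, x, ht, hex⟩⟩
  · exact ⟨a, Or.inl hatom⟩
  · exact ⟨a, Or.inr (Or.inl ⟨p, hneg.imp (And.imp_left (h _)) (And.imp_left (h _))⟩)⟩
  · exact ⟨a, Or.inr (Or.inr (Or.inl ⟨p, q, hor.imp (And.imp_left (Or.imp (h _) (h _)))
      (And.imp_left (And.imp (h _) (h _)))⟩))⟩
  · exact ⟨a, Or.inr (Or.inr (Or.inr ⟨t, p, x, ht, hex.imp
      (And.imp_left (Exists.imp fun z => And.imp_right (h _)))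
      (And.imp_left fun hall z hz => h _ (hall z hz))⟩))⟩

theorem Sat.elim {g ψ a b : M} (h : Sat g ψ a b) : SatStep g (Gen (SatStep g)) (pr ψ (pr a b)) :=
  Gen.elim (satStep_mono g) h

theorem sat_orCode_one {g p q a : M} : Sat g (orCode p q) a 1 ↔ Sat g p a 1 ∨ Sat g q a 1 := by
  constructor
  · intro h
    simpa [SatStep, Sat] using h.elim
  · rintro (h | h)
    · exact Gen.intro (satStep_mono g) (F := {pr p (pr a 1)}) (Set.finite_singleton _)
        (by simp [SatStep]) (by simpa [Sat] using h)
    · exact Gen.intro (satStep_mono g) (F := {pr q (pr a 1)}) (Set.finite_singleton _)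
        (by simp [SatStep]) (by simpa [Sat] using h)

theorem not_sat_ltCode_zeroCode {g t a : M} : ¬ Sat g (ltCode t zeroCode) a 1 := by
  intro h
  simpa [SatStep, val_zeroCode] using h.elim

end PeanoModel

/-! ## Truth and definability in expansions by a subset -/

section Expansion

variable {M : Type u} [LA.Structure M] {α : Type*} {n : ℕ}

/-- Truth of a formula in the structure `(M, I)`, for an evaluation by elements of `M`. -/
def TrueIn (I : Set M) (φ : LAI.Formula α) (e : α → M) : Prop :=
  Formula.Realize (M := Expansion M I) φ e

/-- The value of a term in the structure `(M, I)`, for an evaluation by elements of `M`. -/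
def valueIn (I : Set M) (t : LAI.Term α) (e : α → M) : M :=
  Term.realize (M := Expansion M I) e t

theorem valueIn_eq_valueIn (I J : Set M) (t : LAI.Term α) (e : α → M) :
    valueIn I t e = valueIn J t e := by
  induction t with
  | var => rfl
  | func f ts ih =>
    rcases f with f | f
    · exact congrArg (Structure.funMap (L := LA) (M := M) f) (funext ih)
    · exact f.elim

variable (I : Set M)

@[simp]
theorem valueIn_var (a : α) (e : α → M) : valueIn I (Term.var a) e = e a := rfl

@[simp]
theorem valueIn_liftT {α : Type} (t : LA.Term α) (e : α → M) :
    valueIn I (liftT t) e = t.realize e :=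
  LHom.realize_onTerm (M := Expansion M I) _ t e

theorem valueIn_vecCons (t : LAI.Term α) (ts : Fin n → LAI.Term α) (e : α → M) :
    (fun i => valueIn I (Matrix.vecCons t ts i) e) =
      Matrix.vecCons (valueIn I t e) (fun i => valueIn I (ts i) e) :=
  realize_vecCons (M := Expansion M I) t ts e

theorem valueIn_vecEmpty (e : α → M) :
    (fun i => valueIn I ((![] : Fin 0 → LAI.Term α) i) e) = ![] :=
  Subsingleton.elim _ _

theorem valueIn_snoc (ts : Fin n → LAI.Term α) (t : LAI.Term α) (e : α → M) :
    (fun i => valueIn I (Fin.snoc (α := fun _ => LAI.Term α) ts t i) e) =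
      Fin.snoc (α := fun _ => M) (fun i => valueIn I (ts i) e) (valueIn I t e) :=
  realize_snoc (M := Expansion M I) ts t e

@[simp]
theorem trueIn_not (φ : LAI.Formula α) (e : α → M) : TrueIn I φ.not e ↔ ¬ TrueIn I φ e := Iff.rfl

@[simp]
theorem trueIn_inf (φ ψ : LAI.Formula α) (e : α → M) :
    TrueIn I (φ ⊓ ψ) e ↔ TrueIn I φ e ∧ TrueIn I ψ e :=
  Formula.realize_inf

@[simp]
theorem trueIn_sup (φ ψ : LAI.Formula α) (e : α → M) :
    TrueIn I (φ ⊔ ψ) e ↔ TrueIn I φ e ∨ TrueIn I ψ e :=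
  Formula.realize_sup

@[simp]
theorem trueIn_imp (φ ψ : LAI.Formula α) (e : α → M) :
    TrueIn I (φ.imp ψ) e ↔ (TrueIn I φ e → TrueIn I ψ e) :=
  Formula.realize_imp

@[simp]
theorem trueIn_iff (φ ψ : LAI.Formula α) (e : α → M) :
    TrueIn I (φ.iff ψ) e ↔ (TrueIn I φ e ↔ TrueIn I ψ e) :=
  Formula.realize_iff

@[simp]
theorem trueIn_allF (φ : LAI.Formula (Fin (n + 1))) (e : Fin n → M) :
    TrueIn I (allF φ) e ↔ ∀ x : M, TrueIn I φ (Fin.snoc (α := fun _ => M) e x) :=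
  realize_allF (M := Expansion M I) φ e

@[simp]
theorem trueIn_exF (φ : LAI.Formula (Fin (n + 1))) (e : Fin n → M) :
    TrueIn I (exF φ) e ↔ ∃ x : M, TrueIn I φ (Fin.snoc (α := fun _ => M) e x) :=
  realize_exF (M := Expansion M I) φ e

@[simp]
theorem trueIn_iInf {α β : Type} [Finite β] (f : β → LAI.Formula α) (e : α → M) :
    TrueIn I (Formula.iInf f) e ↔ ∀ b, TrueIn I (f b) e :=
  realize_iInfF (M := Expansion M I) f e

@[simp]
theorem trueIn_lift {α : Type} (φ : LA.Formula α) (e : α → M) :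
    TrueIn I (lift φ) e ↔ φ.Realize e :=
  LHom.realize_onFormula (M := Expansion M I) _ φ

@[simp]
theorem trueIn_memI {α : Type} (t : LA.Term α) (e : α → M) :
    TrueIn I (memI t) e ↔ t.realize e ∈ I := by
  rw [← valueIn_liftT I]
  exact Formula.realize_rel₁ (M := Expansion M I)

@[simp]
theorem trueIn_subst {α β : Type} (φ : LAI.Formula α) (ts : α → LAI.Term β) (e : β → M) :
    TrueIn I (BoundedFormula.subst φ ts) e ↔ TrueIn I φ (fun a => valueIn I (ts a) e) :=
  realize_substF (M := Expansion M I) φ ts e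

theorem trueIn_relabel {β : Type*} (φ : LAI.Formula α) (f : α → β) (e : β → M) :
    TrueIn I (φ.relabel f) e ↔ TrueIn I φ (e ∘ f) :=
  Formula.realize_relabel (M := Expansion M I)

theorem model_closure {β : Type} [Finite β] (φ : LAI.Formula β) :
    Expansion M I ⊨ closure φ ↔ ∀ e : β → M, TrueIn I φ e :=
  realize_closure (M := Expansion M I) φ

/-- The set `S` of tuples is definable in `(M, I)`, with parameters. -/
abbrev DefinableIn (S : Set (α → M)) : Prop :=
  (Set.univ : Set (Expansion M I)).Definable LAI (M := Expansion M I) S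

/-- The subset `S` of `M` is definable in `(M, I)`, with parameters. -/
abbrev DefinableIn₁ (S : Set M) : Prop :=
  (Set.univ : Set (Expansion M I)).Definable₁ LAI (M := Expansion M I) S

variable {I}

theorem definableIn_iff_exists_formula {S : Set (α → M)} :
    DefinableIn I S ↔ ∃ φ : LAI.Formula (M ⊕ α), ∀ e, TrueIn I φ (Sum.elim id e) ↔ e ∈ S := by
  refine Set.definable_iff_exists_formula_sum.trans ⟨?_, ?_⟩
  · rintro ⟨φ, rfl⟩
    refine ⟨φ.relabel (Sum.map Subtype.val id), fun e => (trueIn_relabel I φ _ _).trans ?_⟩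
    exact iff_of_eq (congrArg (TrueIn I φ) (Sum.elim_comp_map ..))
  · rintro ⟨φ, hφ⟩
    refine ⟨φ.relabel (Sum.map (fun x => ⟨x, trivial⟩) id), Set.ext fun e => (hφ e).symm.trans ?_⟩
    refine Iff.trans (iff_of_eq (congrArg (TrueIn I φ) (funext ?_))) (trueIn_relabel I φ _ _).symm
    rintro (x | a) <;> rfl

theorem definableIn₁_of_formula (φ : LAI.Formula (Fin (n + 1))) (p : Fin n → M) :
    DefinableIn₁ I {x | TrueIn I φ (Fin.snoc (α := fun _ => M) p x)} := by
  refine definableIn_iff_exists_formula.2 ⟨φ.relabel (Fin.snoc (α := fun _ => M ⊕ Fin 1)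
    (fun i => Sum.inl (p i)) (Sum.inr 0)), fun e => ?_⟩
  rw [trueIn_relabel]
  refine iff_of_eq (congrArg (TrueIn I φ) (funext fun i => ?_))
  refine Fin.lastCases ?_ (fun j => ?_) i <;> simp

theorem DefinableIn₁.exists_formula {S : Set M} (hS : DefinableIn₁ I S) :
    ∃ (n : ℕ) (φ : LAI.Formula (Fin (n + 1))) (p : Fin n → M),
      ∀ x, TrueIn I φ (Fin.snoc (α := fun _ => M) p x) ↔ x ∈ S := by
  obtain ⟨A, -, hA⟩ := Set.definable_iff_finitely_definable.1 hS
  obtain ⟨φ, hφ⟩ := Set.definable_iff_exists_formula_sum.1 hA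
  let params (i : Fin A.card) : M := (A.equivFin.symm i).1
  refine ⟨A.card, φ.relabel (Sum.elim (fun a => (A.equivFin a).castSucc) fun _ => Fin.last _),
    params, fun x => (trueIn_relabel I φ _ _).trans (Iff.trans ?_ (Set.ext_iff.1 hφ ![x]).symm)⟩
  refine iff_of_eq (congrArg (TrueIn I φ) (funext ?_))
  rintro (a | i)
  · exact (Fin.snoc_castSucc (α := fun _ => M) _ _ _).trans
      (congrArg Subtype.val (A.equivFin.symm_apply_apply a))
  · simp [Subsingleton.elim i 0]

/-- The only atomic formulas whose truth depends on the interpretation of the predicate. -/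
theorem DefinableIn₁.exists_boundedFormula_mem {J : Set M} (hJ : DefinableIn₁ I J)
    (t : LAI.Term ((M ⊕ α) ⊕ Fin n)) : ∃ ψ : LAI.BoundedFormula (M ⊕ α) n,
      ∀ (e : α → M) (xs : Fin n → M),
        BoundedFormula.Realize (M := Expansion M I) ψ (Sum.elim id e) xs ↔
          valueIn J t (Sum.elim (Sum.elim id e) xs) ∈ J := by
  obtain ⟨θ, hθ⟩ := definableIn_iff_exists_formula.1 hJ
  refine ⟨BoundedFormula.relabel (n := n) (k := 0) id (BoundedFormula.subst θ (Sum.elim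
    (fun x => Term.var (Sum.inl (Sum.inl x))) (fun _ => t))), fun e xs => ?_⟩
  refine (BoundedFormula.realize_relabel (M := Expansion M I)).trans ?_
  refine (BoundedFormula.realize_subst (M := Expansion M I)).trans ?_
  refine Iff.trans ?_ (hθ fun _ => valueIn J t (Sum.elim (Sum.elim id e) xs))
  refine iff_of_eq (congrArg₂ _ (funext ?_) (Subsingleton.elim _ _))
  rintro (x | _)
  · rfl
  · exact valueIn_eq_valueIn I J t _

theorem DefinableIn₁.exists_boundedFormula_iff {J : Set M} (hJ : DefinableIn₁ I J)
    (φ : LAI.BoundedFormula (M ⊕ α) n) : ∃ ψ : LAI.BoundedFormula (M ⊕ α) n,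
      ∀ (e : α → M) (xs : Fin n → M),
        BoundedFormula.Realize (M := Expansion M I) ψ (Sum.elim id e) xs ↔
          BoundedFormula.Realize (M := Expansion M J) φ (Sum.elim id e) xs := by
  induction φ with
  | falsum => exact ⟨.falsum, fun _ _ => Iff.rfl⟩
  | equal t s =>
    refine ⟨.equal t s, fun e xs => iff_of_eq (congrArg₂ (fun a b : M => a = b) ?_ ?_)⟩
    · exact valueIn_eq_valueIn I J t (Sum.elim (Sum.elim id e) xs)
    · exact valueIn_eq_valueIn I J s (Sum.elim (Sum.elim id e) xs)
  | imp φ ψ ihφ ihψ =>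
    obtain ⟨φ', hφ⟩ := ihφ
    obtain ⟨ψ', hψ⟩ := ihψ
    exact ⟨.imp φ' ψ', fun e xs => imp_congr (hφ e xs) (hψ e xs)⟩
  | all φ ih =>
    obtain ⟨φ', hφ⟩ := ih
    exact ⟨.all φ', fun e xs => forall_congr' fun x => hφ e _⟩
  | @rel n l R ts =>
    rcases R with R | R
    · refine ⟨.rel (Sum.inl R) ts, fun e xs => ?_⟩
      refine iff_of_eq (congrArg (Structure.RelMap (L := LA) (M := M) R) (funext fun i => ?_))
      exact valueIn_eq_valueIn I J (ts i) (Sum.elim (Sum.elim id e) xs)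
    · cases R
      exact hJ.exists_boundedFormula_mem (ts 0)

theorem DefinableIn.trans {J : Set M} {S : Set (α → M)} (hS : DefinableIn J S)
    (hJ : DefinableIn₁ I J) : DefinableIn I S := by
  obtain ⟨φ, hφ⟩ := definableIn_iff_exists_formula.1 hS
  obtain ⟨ψ, hψ⟩ := hJ.exists_boundedFormula_iff φ
  exact definableIn_iff_exists_formula.2 ⟨ψ, fun e => (hψ e _).trans (hφ e)⟩

theorem isInterpretation_id {J : Set M} (hJ : DefinableIn₁ I J) :
    IsInterpretation LAI (Expansion M J) (Expansion M I) (id : M → M) where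
  injective := Function.injective_id
  universe_definable := (Set.range_id (α := M)).symm ▸ Set.definable_univ
  function_definable n F := by
    refine DefinableIn.trans (J := J) (definableIn_iff_exists_formula.2 ⟨Term.equal
      (Term.var (Sum.inr (Fin.last n))) (Term.func F fun i => Term.var (Sum.inr i.castSucc)),
      fun e => (Formula.realize_equal (M := Expansion M J)).trans ⟨fun h => ?_, ?_⟩⟩) hJ
    · exact ⟨Fin.init e, ((congrArg _ h.symm).trans (Fin.snoc_init_self e)).symm⟩
    · rintro ⟨y, rfl⟩
      refine (Fin.snoc_last (α := fun _ => M) _ _).trans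
        (congrArg (Structure.funMap (L := LAI) (M := Expansion M J) F) (funext fun i => ?_))
      exact (Fin.snoc_castSucc (α := fun _ => M) _ _ i).symm
  relation_definable n R := by
    refine DefinableIn.trans (J := J) (definableIn_iff_exists_formula.2 ⟨Relations.formula R
      fun i => Term.var (Sum.inr i), fun e => (Formula.realize_rel (M := Expansion M J)).trans
        ⟨fun h => ⟨e, rfl, h⟩, ?_⟩⟩) hJ
    rintro ⟨y, rfl, h⟩
    exact h

end Expansion

/-! ## Models of `PA(I)` -/

section PAofI

variable {M : Type u} [LA.Structure M] {I : Set M}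

theorem PAofI.model_Q (h : Expansion M I ⊨ PAofI) :
    M ⊨ Q :=
  (LHom.onTheory_model (M := Expansion M I) LHom.sumInl Q).1 (Theory.model_union_iff.1 h).1

theorem model_PAofI_iff : Expansion M I ⊨ PAofI ↔ M ⊨ Q ∧
    ∀ (n : ℕ) (φ : LAI.Formula (Fin (n + 1))), Expansion M I ⊨ induction φ := by
  refine Theory.model_union_iff.trans (and_congr
    (LHom.onTheory_model (M := Expansion M I) LHom.sumInl Q) ⟨fun h n φ => ?_, fun h => ⟨?_⟩⟩)
  · exact h.realize_of_mem _ ⟨n, φ, rfl⟩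
  · rintro _ ⟨n, φ, rfl⟩
    exact h n φ

variable [Zero M] [One M] [Add M] [Mul M] [LT M] [ArithCompat M]

theorem model_induction_iff {n : ℕ} (φ : LAI.Formula (Fin (n + 1))) :
    Expansion M I ⊨ induction φ ↔ ∀ p : Fin n → M,
      TrueIn I φ (Fin.snoc (α := fun _ => M) p 0) →
      (∀ x, TrueIn I φ (Fin.snoc (α := fun _ => M) p x) →
        TrueIn I φ (Fin.snoc (α := fun _ => M) p (x + 1))) →
      ∀ x, TrueIn I φ (Fin.snoc (α := fun _ => M) p x) := by
  refine (model_closure I _).trans (forall_congr' fun p => ?_)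
  simp only [trueIn_imp, trueIn_allF, trueIn_subst, valueIn_snoc, valueIn_var, valueIn_liftT,
    realize_zero, realize_sc, realize_v, Fin.snoc_castSucc, Fin.snoc_last]

theorem PAofI.induct (h : Expansion M I ⊨ PAofI) {P : M → Prop} (hP : DefinableIn₁ I {x | P x})
    (h0 : P 0) (hs : ∀ x, P x → P (x + 1)) (x : M) : P x := by
  obtain ⟨n, φ, p, hφ⟩ := hP.exists_formula
  have hind := (model_induction_iff φ).1 ((model_PAofI_iff.1 h).2 n φ) p
  simp only [hφ] at hind
  exact hind h0 hs x

theorem PAofI.of_definableIn {J : Set M} (h : Expansion M I ⊨ PAofI) (hJ : DefinableIn₁ I J) :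
    Expansion M J ⊨ PAofI :=
  model_PAofI_iff.2 ⟨PAofI.model_Q h, fun _ φ => (model_induction_iff φ).2 fun p =>
    PAofI.induct h (P := fun x => TrueIn J φ (Fin.snoc (α := fun _ => M) p x))
      (DefinableIn.trans (J := J) (definableIn₁_of_formula φ p) hJ)⟩

theorem PAofI.eq_self_of_definableMap (h : Expansion M I ⊨ PAofI) {f : M → M}
    (hf : DefinableMap LAI (Expansion M I) f) (h0 : f 0 = 0) (hs : ∀ x, f (x + 1) = f x + 1)
    (x : M) : f x = x := by
  refine (PAofI.induct h (P := fun x => x = f x) ?_ h0.symm (fun x hx => ?_) x).symm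
  · exact Set.Definable.preimage_comp (fun _ : Fin 2 => (0 : Fin 1)) hf
  · rw [hs, ← hx]

end PAofI

theorem PAofI.nonempty_peanoModel {M : Type u} [LA.Structure M] {I : Set M}
    (h : Expansion M I ⊨ PAofI) : Nonempty (PeanoModel M) := by
  obtain ⟨_, _, _, _, _, compat, zero_add_one⟩ := exists_arithCompat (PAofI.model_Q h)
  have : PeanoAxioms M :=
    { compat with
      ind := fun {n} φ p => by
        have hind := (model_induction_iff (lift φ)).1 ((model_PAofI_iff.1 h).2 n (lift φ)) p
        simpa only [trueIn_lift] using hind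
      zero_add_one := zero_add_one
      model_Q := PAofI.model_Q h }
  exact PeanoAxioms.nonempty_peanoModel M

theorem definably_rigid {M : Type u} [LA.Structure M] {I : Set M} (h : Expansion M I ⊨ PAofI)
    (f : M ≃[LA] M) (hf : DefinableMap LAI (Expansion M I) (f : M → M)) (x : M) : f x = x := by
  obtain ⟨_, _, _, _, _, _, -⟩ := exists_arithCompat (PAofI.model_Q h)
  refine PAofI.eq_self_of_definableMap h hf ?_ (fun x => ?_) x
  · simpa only [ArithCompat.funMap_zero] using f.map_fun (ArithFunc.zero : LA.Functions 0) ![]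
  · simpa [ArithCompat.funMap_succ] using f.map_fun (ArithFunc.succ : LA.Functions 1) ![x]

theorem eq_of_definable_iso {M : Type u} [LA.Structure M] {I J : Set M}
    (h : Expansion M I ⊨ PAofI) (f : Expansion M I ≃[LAI] Expansion M J)
    (hf : DefinableMap LAI (Expansion M I) (f : M → M)) : I = J := by
  let arithIso : M ≃[LA] M :=
    { toEquiv := f.toEquiv
      map_fun' := fun F x => f.map_fun' (Sum.inl F) x
      map_rel' := fun R x => f.map_rel' (Sum.inl R) x }
  have f_eq_self (x : M) : arithIso x = x := definably_rigid h arithIso hf x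
  ext x
  refine (f.map_rel' (Sum.inr IndRel.mem : LAI.Relations 1) ![x]).symm.trans ?_
  exact iff_of_eq (congrArg (· ∈ J) (f_eq_self x))

/-! ## Models of `PAI` and `PAI°` -/

/-- Any two increasing tuples from `S` agree on `φ`. -/
def Indiscernible {M : Type u} [LA.Structure M] [Preorder M] {n : ℕ} (S : Set M)
    (φ : LA.Formula (Fin n)) : Prop :=
  ∀ ⦃x y : Fin n → M⦄, (∀ i, x i ∈ S) → StrictMono x → (∀ i, y i ∈ S) → StrictMono y →
    (φ.Realize x ↔ φ.Realize y)

theorem Indiscernible.mono {M : Type u} [LA.Structure M] [Preorder M] {n : ℕ} {S T : Set M}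
    {φ : LA.Formula (Fin n)} (h : Indiscernible T φ) (hST : S ⊆ T) : Indiscernible S φ :=
  fun _ _ hxS hx hyS hy => h (fun i => hST (hxS i)) hx (fun i => hST (hyS i)) hy

section Model

variable {M : Type u} [LA.Structure M] {I : Set M} {n : ℕ}

theorem definableIn₁_diff_singleton (a : M) : DefinableIn₁ I (I \ {a}) := by
  convert definableIn₁_of_formula (I := I) (memI (v 1) ⊓ (lift (eqF (v 1) (v 0))).not) ![a] using 1
  ext x
  simp

theorem definableIn₁_of_diff_singleton {a : M} (ha : a ∈ I) : DefinableIn₁ (I \ {a}) I := by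
  convert definableIn₁_of_formula (I := I \ {a}) (memI (v 1) ⊔ lift (eqF (v 1) (v 0))) ![a] using 1
  ext x
  by_cases h : x = a <;> simp [h, ha]

variable [PeanoModel M]

theorem model_Ubd : Expansion M I ⊨ Ubd ↔ ¬ BddAbove I := by
  rw [not_bddAbove_iff]
  refine (model_closure I _).trans ⟨fun h x => ?_, fun h e => ?_⟩
  · simpa using h ![x]
  · simpa [Fin.snoc] using h (e 0)

theorem trueIn_incrI {α : Type} (t : Fin n → LA.Term α) (e : α → M) :
    TrueIn I (incrI t) e ↔ (∀ i, (t i).realize e ∈ I) ∧ StrictMono fun i => (t i).realize e := by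
  simp only [incrI, trueIn_inf, trueIn_iInf, trueIn_memI, trueIn_lift, realize_ltF,
    Subtype.forall, Prod.forall, StrictMono]

theorem model_Indis (φ : LA.Formula (Fin n)) : Expansion M I ⊨ Indis φ ↔ Indiscernible I φ := by
  refine (model_closure I _).trans ?_
  simp only [trueIn_imp, trueIn_inf, trueIn_incrI, trueIn_iff, trueIn_lift, realize_substF]
  constructor
  · intro h x y hxI hx hyI hy
    exact h (Sum.elim x y) ⟨⟨hxI, hx⟩, hyI, hy⟩
  · rintro h e ⟨⟨hxI, hx⟩, hyI, hy⟩
    exact h hxI hx hyI hy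

theorem model_IndisCirc (φ : LA.Formula (Fin n)) :
    Expansion M I ⊨ IndisCirc φ ↔ Indiscernible (I ∩ Set.Ioi (gn φ : M)) φ := by
  refine (model_closure I _).trans ?_
  simp only [trueIn_imp, trueIn_inf, trueIn_incrI, trueIn_iff, trueIn_lift, realize_substF,
    trueIn_iInf, realize_ltF, realize_num, Subtype.forall]
  constructor
  · intro h x y hxI hx hyI hy
    exact h (Sum.elim x y)
      ⟨⟨⟨fun i => (hxI i).1, hx⟩, fun i => (hyI i).1, hy⟩, fun i _ => ⟨(hxI i).2, (hyI i).2⟩⟩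
  · rintro h e ⟨⟨⟨hxI, hx⟩, hyI, hy⟩, h0⟩
    have first_le (i : Fin n) : (⟨0, i.pos⟩ : Fin n) ≤ i := Nat.zero_le _
    exact h (fun i => ⟨hxI i, (h0 _ rfl).1.trans_le (hx.monotone (first_le i))⟩) hx
      (fun i => ⟨hyI i, (h0 _ rfl).2.trans_le (hy.monotone (first_le i))⟩) hy

theorem model_PAI_iff : Expansion M I ⊨ PAI ↔ Expansion M I ⊨ PAofI ∧ ¬ BddAbove I ∧
    ∀ (n : ℕ) (φ : LA.Formula (Fin n)), Indiscernible I φ := by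
  rw [PAI, Theory.model_union_iff, Theory.model_union_iff, Theory.model_singleton_iff, model_Ubd,
    and_assoc, Theory.model_iff (T := {_s | _})]
  refine and_congr_right fun _ => and_congr_right fun _ => ⟨fun h n φ => ?_, ?_⟩
  · exact (model_Indis φ).1 (h _ ⟨n, φ, rfl⟩)
  · rintro h _ ⟨n, φ, rfl⟩
    exact (model_Indis φ).2 (h n φ)

theorem model_PAICirc_iff : Expansion M I ⊨ PAICirc ↔ Expansion M I ⊨ PAofI ∧ ¬ BddAbove I ∧
    ∀ (n : ℕ) (φ : LA.Formula (Fin n)), Indiscernible (I ∩ Set.Ioi (gn φ : M)) φ := by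
  rw [PAICirc, Theory.model_union_iff, Theory.model_union_iff, Theory.model_singleton_iff,
    model_Ubd, and_assoc, Theory.model_iff (T := {_s | _})]
  refine and_congr_right fun _ => and_congr_right fun _ => ⟨fun h n φ => ?_, ?_⟩
  · exact (model_IndisCirc φ).1 (h _ ⟨n, φ, rfl⟩)
  · rintro h _ ⟨n, φ, rfl⟩
    exact (model_IndisCirc φ).2 (h n φ)

/-! ## Removing an element -/

theorem not_bddAbove_diff_singleton (hI : ¬ BddAbove I) (a : M) : ¬ BddAbove (I \ {a}) :=
  fun h => hI ((h.insert a).mono (Set.subset_insert_sdiff_singleton a I))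

theorem model_PAI_diff_singleton (h : Expansion M I ⊨ PAI) (a : M) :
    Expansion M (I \ {a}) ⊨ PAI := by
  obtain ⟨hPA, hI, indisc⟩ := model_PAI_iff.1 h
  exact model_PAI_iff.2 ⟨PAofI.of_definableIn hPA (definableIn₁_diff_singleton a),
    not_bddAbove_diff_singleton hI a, fun n φ => (indisc n φ).mono Set.sdiff_subset⟩

theorem model_PAICirc_diff_singleton (h : Expansion M I ⊨ PAICirc) (a : M) :
    Expansion M (I \ {a}) ⊨ PAICirc := by
  obtain ⟨hPA, hI, indisc⟩ := model_PAICirc_iff.1 h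
  exact model_PAICirc_iff.2 ⟨PAofI.of_definableIn hPA (definableIn₁_diff_singleton a),
    not_bddAbove_diff_singleton hI a,
    fun n φ => (indisc n φ).mono (Set.inter_subset_inter_left _ Set.sdiff_subset)⟩

theorem PAofI.exists_isLeast (h : Expansion M I ⊨ PAofI) (hI : I.Nonempty) : ∃ i, IsLeast I i := by
  by_contra! no_least
  obtain ⟨i, hi⟩ := hI
  suffices below_notMem : ∀ x y : M, y < x → y ∉ I from below_notMem (i + 1) i (lt_add_one i) hi
  refine PAofI.induct h ?_ (fun y hy => absurd hy not_lt_zero) fun x ih y hy hyI => ?_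
  · convert definableIn₁_of_formula (I := I)
      (allF ((lift (ltF (v 1) (v 0))).imp (memI (v 1)).not)) ![] using 1
    ext x
    simp
  · refine no_least y ⟨hyI, fun z hz => ?_⟩
    by_contra! hzy
    exact ih z (hzy.trans_le (Order.lt_add_one_iff.1 hy)) hz

/-! ## Doubling -/

theorem mem_double {x : M} : x ∈ double I ↔ ∃ i ∈ I, i + i = x := by
  simp only [double, Set.mem_ofPred_eq, ArithCompat.funMap_add, eq_comm (b := x)]
  rfl

theorem add_self_strictMono : StrictMono fun x : M => x + x := strictMono_id.add strictMono_id

theorem definableIn₁_double : DefinableIn₁ I (double I) := by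
  convert definableIn₁_of_formula (I := I) (exF (memI (v 1) ⊓ lift (eqF (v 1 + v 1) (v 0)))) ![]
    using 1
  ext x
  simp [mem_double]

theorem add_self_mem_double {x : M} : x + x ∈ double I ↔ x ∈ I := by
  simp [mem_double, add_self_strictMono.injective.eq_iff]

theorem definableIn₁_of_double : DefinableIn₁ (double I) I := by
  convert definableIn₁_of_formula (I := double I) (memI (v 0 + v 0)) ![] using 1
  ext x
  simp [add_self_mem_double]

theorem Indiscernible.double {φ : LA.Formula (Fin n)}
    (h : Indiscernible I (BoundedFormula.subst φ fun i => v i + v i)) :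
    Indiscernible (double I) φ := by
  intro x y hxI hx hyI hy
  choose x' hx'I hxx' using fun i => mem_double.1 (hxI i)
  choose y' hy'I hyy' using fun i => mem_double.1 (hyI i)
  have of_add_self {z z' : Fin n → M} (hz : StrictMono z) (hzz' : ∀ i, z' i + z' i = z i) :
      StrictMono z' := fun i j hij =>
    add_self_strictMono.lt_iff_lt.1 (by simpa only [hzz'] using hz hij)
  simpa only [realize_substF, realize_add, realize_v, hxx', hyy'] using
    h hx'I (of_add_self hx hxx') hy'I (of_add_self hy hyy')

theorem model_PAI_double (h : Expansion M I ⊨ PAI) : Expansion M (double I) ⊨ PAI := by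
  obtain ⟨hPA, hI, indisc⟩ := model_PAI_iff.1 h
  refine model_PAI_iff.2 ⟨PAofI.of_definableIn hPA definableIn₁_double,
    not_bddAbove_iff.2 fun x => ?_, fun n φ => (indisc n _).double⟩
  obtain ⟨y, hy, hxy⟩ := not_bddAbove_iff.1 hI x
  exact ⟨y + y, add_self_mem_double.2 hy, hxy.trans_le le_self_add⟩

/-- If `I = 2I`, then `I` contains some `j > 0` along with `2j` and `4j`; but `y = 2x` separates the
pairs `j < 2j` and `j < 4j`. -/
theorem ne_double (h : Expansion M I ⊨ PAI) : I ≠ double I := by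
  intro hI
  obtain ⟨-, unbounded, indisc⟩ := model_PAI_iff.1 h
  obtain ⟨j, hj, hj0⟩ := not_bddAbove_iff.1 unbounded 0
  have mem_add_self {x : M} (hx : x ∈ I) : x + x ∈ I := by
    rw [hI]
    exact add_self_mem_double.2 hx
  have lt_add_self {x : M} (hx : 0 < x) : x < x + x := lt_add_of_pos_left x hx
  have hjj := lt_add_self hj0
  have hjjj := lt_add_self (hj0.trans hjj)
  have separated := indisc 2 (eqF (v 1) (v 0 + v 0)) (x := ![j, j + j]) (y := ![j, j + j + (j + j)])
    (by simp [Fin.forall_fin_two, hj, mem_add_self])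
    (by simpa [Fin.strictMono_iff_lt_succ] using hjj)
    (by simp [Fin.forall_fin_two, hj, mem_add_self])
    (by simpa [Fin.strictMono_iff_lt_succ] using hjj.trans hjjj)
  simp only [realize_eqF, realize_add, realize_v] at separated
  exact hjjj.ne' (separated.1 rfl)

end Model

theorem double_isInterpreted {M : Type u} [LA.Structure M] {I : Set M} (h : Expansion M I ⊨ PAI) :
    Expansion M (double I) ⊨ PAI ∧
      IsInterpretation LAI (Expansion M (double I)) (Expansion M I) (id : M → M) ∧
      IsInterpretation LAI (Expansion M I) (Expansion M (double I)) (id : M → M) ∧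
      ¬ ∃ f : Expansion M I ≃[LAI] Expansion M (double I),
        DefinableMap LAI (Expansion M I) (f : M → M) := by
  have hPA : Expansion M I ⊨ PAofI := h.mono (Set.subset_union_left.trans Set.subset_union_left)
  obtain ⟨_⟩ := PAofI.nonempty_peanoModel hPA
  refine ⟨model_PAI_double h, isInterpretation_id definableIn₁_double,
    isInterpretation_id definableIn₁_of_double, ?_⟩
  rintro ⟨f, hf⟩
  exact ne_double h (eq_of_definable_iso hPA f hf)

/-! ## The formula `σ` and the sentence `α` in models -/

section Alpha

theorem diff_singleton_inter_of_notMem {α : Type*} {I S : Set α} {a : α} (h : a ∉ S) :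
    I \ {a} ∩ S = I ∩ S := by
  rw [← Set.inter_sdiff_right_comm, Set.sdiff_singleton_eq_self fun h' => h h'.2]

variable {M : Type u} [LA.Structure M] [PeanoModel M]

/-- `j` is larger than the code `φ` and than all entries of the tuple `a`. -/
def Exceeds (φ a j : M) : Prop := φ < j ∧ ∀ i x, Entry a i x → x < j

/-- The element `j` from which `σ` starts: the first element of `I` that exceeds `φ` and `a`. -/
def IsStart (I : Set M) (φ a j : M) : Prop := IsLeast (I ∩ {w | Exceeds φ a w}) j

/-- `w` is above `j` and above the entries of `g` of index below `i`. -/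
def IsAbove (j g i w : M) : Prop := j < w ∧ ∀ i' x, i' < i ∧ Entry g i' x → x < w

/-- The tuple `g` lists the first elements of `I` above `j`. -/
def ListsFirst (I : Set M) (j g : M) : Prop :=
  ∀ i x, Entry g i x → IsLeast (I ∩ {w | IsAbove j g i w}) x

/-- The instance `φ*(a, i₁, …, iₖ)` is true, where `i₁, …, iₖ` are the first elements of `I`
above `j`. -/
def SigmaFrom (I : Set M) (j φ a : M) : Prop :=
  ∃ m ψ k g, IsForm m φ ∧ IsTup m a ∧ IsStar 0 φ ψ ∧ IsDepth φ k ∧ IsTup k g ∧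
    ListsFirst I j g ∧ Sat g ψ a 1

/-- The relation defined by `σ`. -/
def SigmaHolds (I : Set M) (φ a : M) : Prop := ∃ j, IsStart I φ a j ∧ SigmaFrom I j φ a

theorem realize_belowF (φ a j : M) : belowF.Realize ![φ, a, j] ↔ Exceeds φ a j := by
  simp [belowF, Exceeds]

theorem realize_aboveF (j g i w : M) : aboveF.Realize ![j, g, i, w] ↔ IsAbove j g i w := by
  simp [aboveF, IsAbove]

variable {I : Set M}

theorem trueIn_startF (φ a j : M) : TrueIn I startF ![φ, a, j] ↔ IsStart I φ a j := by
  simp only [startF, trueIn_inf, trueIn_memI, trueIn_lift, trueIn_allF, trueIn_imp,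
    realize_substF, realize_vecCons, realize_vecEmpty, snoc_vecCons, snoc_vecEmpty, realize_leF,
    realize_v, realize_belowF]
  rfl

theorem trueIn_firstF (j g : M) : TrueIn I firstF ![j, g] ↔ ListsFirst I j g := by
  simp only [firstF, trueIn_inf, trueIn_memI, trueIn_lift, trueIn_allF, trueIn_imp,
    realize_substF, realize_vecCons, realize_vecEmpty, snoc_vecCons, snoc_vecEmpty, realize_leF,
    realize_v, realize_aboveF, realize_entry]
  exact forall₂_congr fun _ _ => imp_congr_right fun _ => and_congr_left fun _ =>
    and_congr_right fun _ => realize_aboveF ..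

theorem trueIn_sigma {n : ℕ} (φ a : LA.Term (Fin n)) (e : Fin n → M) :
    TrueIn I (sigma φ a) e ↔ SigmaHolds I (φ.realize e) (a.realize e) := by
  simp only [sigma, sigmaF, trueIn_subst, valueIn_vecCons, valueIn_vecEmpty, valueIn_liftT,
    trueIn_exF, trueIn_inf, trueIn_lift, snoc_vecCons, snoc_vecEmpty, realize_v, trueIn_startF,
    trueIn_firstF, realize_isForm, realize_isTup, realize_isStar, realize_isDepth, realize_sat,
    Formula.realize_inf]
  constructor
  · rintro ⟨m, ψ, k, j, g, ⟨⟨⟨⟨⟨⟨form, tup⟩, star⟩, depth⟩, start⟩, tup'⟩, first⟩, holds⟩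
    exact ⟨j, start, m, ψ, k, g, form, tup, star, depth, tup', first, holds⟩
  · rintro ⟨j, start, m, ψ, k, g, form, tup, star, depth, tup', first, holds⟩
    exact ⟨m, ψ, k, j, g, ⟨⟨⟨⟨⟨⟨form, tup⟩, star⟩, depth⟩, start⟩, tup'⟩, first⟩, holds⟩

/-- The relation `S` satisfies Tarski's conditions for all codes of arithmetical formulas. -/
structure IsSatisfactionClass (S : M → M → Prop) : Prop where
  eq_iff : ∀ {m a t s}, IsTup m a → IsTermIn 0 m 0 t → IsTermIn 0 m 0 s →
    (S (eqCode t s) a ↔ ∃ x, Val a 0 t x ∧ Val a 0 s x)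
  lt_iff : ∀ {m a t s}, IsTup m a → IsTermIn 0 m 0 t → IsTermIn 0 m 0 s →
    (S (ltCode t s) a ↔ ∃ x y, Val a 0 t x ∧ Val a 0 s y ∧ x < y)
  neg_iff : ∀ {m a φ}, IsTup m a → IsForm m φ → (S (negCode φ) a ↔ ¬ S φ a)
  or_iff : ∀ {m a φ ψ}, IsTup m a → IsForm m φ → IsForm m ψ →
    (S (orCode φ ψ) a ↔ S φ a ∨ S ψ a)
  ex_iff : ∀ {m a φ}, IsTup m a → IsForm (m + 1) φ →
    (S (exCode φ) a ↔ ∃ b, S φ (consCode b a))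

theorem model_alpha : Expansion M I ⊨ alpha ↔ IsSatisfactionClass (SigmaHolds I) := by
  have : Expansion M I ⊨ alpha ↔ ∀ m a : M, IsTup m a →
      ((((∀ t s, IsTermIn 0 m 0 t ∧ IsTermIn 0 m 0 s →
        (SigmaHolds I (eqCode t s) a ↔ ∃ x, Val a 0 t x ∧ Val a 0 s x) ∧
        (SigmaHolds I (ltCode t s) a ↔ ∃ x y, Val a 0 t x ∧ Val a 0 s y ∧ x < y)) ∧
      ∀ φ, IsForm m φ → (SigmaHolds I (negCode φ) a ↔ ¬ SigmaHolds I φ a)) ∧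
      ∀ φ ψ, IsForm m φ ∧ IsForm m ψ →
        (SigmaHolds I (orCode φ ψ) a ↔ SigmaHolds I φ a ∨ SigmaHolds I ψ a)) ∧
      ∀ φ, IsForm (m + 1) φ →
        (SigmaHolds I (exCode φ) a ↔ ∃ b, SigmaHolds I φ (consCode b a))) := by
    refine (model_closure I _).trans ((FinVec.forall_iff _).symm.trans ?_)
    refine forall₂_congr fun m a => ?_
    simp [trueIn_sigma, isTerm, cEq, cLt, cNeg, cOr, cEx, cons, and_assoc]
  rw [this]
  constructor
  · intro h
    exact
      { eq_iff := fun ha ht hs => ((h _ _ ha).1.1.1 _ _ ⟨ht, hs⟩).1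
        lt_iff := fun ha ht hs => ((h _ _ ha).1.1.1 _ _ ⟨ht, hs⟩).2
        neg_iff := fun ha => (h _ _ ha).1.1.2 _
        or_iff := fun ha hφ hψ => (h _ _ ha).1.2 _ _ ⟨hφ, hψ⟩
        ex_iff := fun ha => (h _ _ ha).2 _ }
  · intro h m a ha
    exact ⟨⟨⟨fun t s hts => ⟨h.eq_iff ha hts.1 hts.2, h.lt_iff ha hts.1 hts.2⟩,
      fun φ => h.neg_iff ha⟩, fun φ ψ hφψ => h.or_iff ha hφψ.1 hφψ.2⟩, fun φ => h.ex_iff ha⟩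

theorem IsStart.sigmaHolds_iff {φ a j : M} (h : IsStart I φ a j) :
    SigmaHolds I φ a ↔ SigmaFrom I j φ a := by
  refine ⟨?_, fun hσ => ⟨j, h, hσ⟩⟩
  rintro ⟨j', h', hσ⟩
  rwa [h.unique h']

/-! ## Padding a formula with the false disjunct `t < 0` -/

theorem IsSatisfactionClass.or_lt_zero_iff {S : M → M → Prop} (hS : IsSatisfactionClass S)
    {m φ a t : M} (ha : IsTup m a) (hφ : IsForm m φ) (ht : IsTermIn 0 m 0 t) :
    S (orCode φ (ltCode t zeroCode)) a ↔ S φ a := by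
  rw [hS.or_iff ha hφ (isForm_ltCode.2 ⟨ht, isTermIn_zeroCode⟩), hS.lt_iff ha ht isTermIn_zeroCode,
    or_iff_left]
  rintro ⟨x, y, -, hy, hxy⟩
  rw [val_zeroCode.1 hy] at hxy
  exact not_lt_zero hxy

theorem sigmaFrom_or_lt_zero_iff {j φ a t : M} (ht : ∀ m, IsTermIn 0 m 0 t) :
    SigmaFrom I j (orCode φ (ltCode t zeroCode)) a ↔ SigmaFrom I j φ a := by
  constructor
  · rintro ⟨m, ψ', k, g, form, tup, star, depth, tup', first, holds⟩
    obtain ⟨ψ, χ, star_φ, star_lt, rfl⟩ := isStar_orCode.1 star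
    obtain rfl := isStar_ltCode.1 star_lt
    obtain ⟨l, l', depth_φ, depth_lt, max⟩ := isDepth_orCode.1 depth
    obtain rfl := isDepth_ltCode.1 depth_lt
    have hk : k = l := by
      rcases max with ⟨-, rfl⟩ | ⟨hl, rfl⟩
      · rfl
      · exact le_antisymm zero_le hl
    subst hk
    exact ⟨m, ψ, k, g, (isForm_orCode.1 form).1, tup, star_φ, depth_φ, tup', first,
      (sat_orCode_one.1 holds).resolve_right not_sat_ltCode_zeroCode⟩
  · rintro ⟨m, ψ, k, g, form, tup, star, depth, tup', first, holds⟩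
    exact ⟨m, orCode ψ (ltCode t zeroCode), k, g,
      isForm_orCode.2 ⟨form, isForm_ltCode.2 ⟨ht m, isTermIn_zeroCode⟩⟩, tup,
      isStar_orCode.2 ⟨ψ, _, star, isStar_ltCode.2 rfl, rfl⟩,
      isDepth_orCode.2 ⟨k, 0, depth, isDepth_ltCode.2 rfl, Or.inl ⟨zero_le, rfl⟩⟩, tup', first,
      sat_orCode_one.2 (Or.inl holds)⟩

theorem exists_le_closed_term (x : M) : ∃ t : M, x ≤ t ∧ ∀ m, IsTermIn 0 m 0 t := by
  refine arith_induction (exF (leF (v 0) (v 1) ⊓ allF (isTerm (v 2) (v 1)))) ![]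
    (fun x : M => ∃ t : M, x ≤ t ∧ ∀ m, IsTermIn 0 m 0 t) (by simp [isTerm])
    ⟨zeroCode, zero_le, fun m => isTermIn_zeroCode⟩ ?_ x
  rintro x ⟨t, hxt, ht⟩
  have lt_succCode : t < succCode t :=
    (le_pr_right 2 t).trans_lt (pr_lt_of_add_lt (by gcongr; norm_num))
  exact ⟨succCode t, Order.add_one_le_of_lt (hxt.trans_lt lt_succCode),
    fun m => isTermIn_succCode.2 (ht m)⟩

/-- The statement is arithmetical in `i` and `j`, and true of `i` and all sufficiently large
elements of `I`, hence by indiscernibility of `i` and `j`. -/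
theorem exists_closed_term_or_lt {i j : M} (h : Expansion M I ⊨ PAI) (hi : i ∈ I) (hj : j ∈ I)
    (hij : i < j) :
    ∃ t : M, (∀ m, IsTermIn 0 m 0 t) ∧ i ≤ t ∧ orCode i (ltCode t zeroCode) < j := by
  obtain ⟨-, unbounded, indisc⟩ := model_PAI_iff.1 h
  obtain ⟨t, hit, ht⟩ := exists_le_closed_term i
  obtain ⟨y, hy, hty⟩ := not_bddAbove_iff.1 unbounded (i + orCode i (ltCode t zeroCode))
  have agree := indisc 2 (exF (allF (isTerm (v 3) (v 2)) ⊓ leF (v 0) (v 2) ⊓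
    ltF (cOr (v 0) (cLt (v 2) cZero)) (v 1))) (x := ![i, y]) (y := ![i, j])
    (by simp [Fin.forall_fin_two, hi, hy])
    (by simpa [Fin.strictMono_iff_lt_succ] using le_self_add.trans_lt hty)
    (by simp [Fin.forall_fin_two, hi, hj])
    (by simpa [Fin.strictMono_iff_lt_succ] using hij)
  have agree' : (∃ t, (∀ m, IsTermIn 0 m 0 t) ∧ i ≤ t ∧ orCode i (ltCode t zeroCode) < y) ↔
      ∃ t, (∀ m, IsTermIn 0 m 0 t) ∧ i ≤ t ∧ orCode i (ltCode t zeroCode) < j := by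
    simpa [isTerm, cOr, cLt, cZero, and_assoc] using agree
  exact agree'.1 ⟨t, ht, hit, le_add_self.trans_lt hty⟩

/-! ## Removing the first indiscernible -/

variable {i₀ : M}

theorem Exceeds.of_le {φ a j w : M} (h : Exceeds φ a j) (hjw : j ≤ w) : Exceeds φ a w :=
  ⟨h.1.trans_le hjw, fun i x hx => (h.2 i x hx).trans_le hjw⟩

theorem listsFirst_diff_singleton_iff {j g : M} (hj : i₀ ≤ j) :
    ListsFirst (I \ {i₀}) j g ↔ ListsFirst I j g := by
  refine forall₂_congr fun i x => imp_congr_right fun _ => ?_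
  rw [diff_singleton_inter_of_notMem fun h => h.1.not_ge hj]

theorem sigmaFrom_diff_singleton_iff {j φ a : M} (hj : i₀ ≤ j) :
    SigmaFrom (I \ {i₀}) j φ a ↔ SigmaFrom I j φ a := by
  simp only [SigmaFrom, listsFirst_diff_singleton_iff hj]

theorem sigmaHolds_diff_singleton_of_not_exceeds (hi₀ : IsLeast I i₀) {φ a : M}
    (h : ¬ Exceeds φ a i₀) : SigmaHolds (I \ {i₀}) φ a ↔ SigmaHolds I φ a := by
  refine exists_congr fun j => ?_
  have start_iff : IsStart (I \ {i₀}) φ a j ↔ IsStart I φ a j := by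
    rw [IsStart, IsStart, diff_singleton_inter_of_notMem (S := {w | Exceeds φ a w}) h]
  rw [start_iff]
  exact and_congr_right fun hj => sigmaFrom_diff_singleton_iff (hi₀.2 hj.1.1)

theorem sigmaHolds_diff_singleton_of_exceeds (hPAI : Expansion M I ⊨ PAI)
    (hα : Expansion M I ⊨ alpha) (hi₀ : IsLeast I i₀) {m φ a : M} (hφ : IsForm m φ)
    (ha : IsTup m a) (h : Exceeds φ a i₀) : SigmaHolds (I \ {i₀}) φ a ↔ SigmaHolds I φ a := by
  obtain ⟨hPA, unbounded, -⟩ := model_PAI_iff.1 hPAI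
  obtain ⟨y, hy, hiy⟩ := not_bddAbove_iff.1 unbounded i₀
  obtain ⟨i₁, hi₁⟩ := PAofI.exists_isLeast
    (PAofI.of_definableIn hPA (definableIn₁_diff_singleton i₀)) ⟨y, hy, hiy.ne'⟩
  have hlt : i₀ < i₁ := (hi₀.2 hi₁.1.1).lt_of_ne' hi₁.1.2
  obtain ⟨t, ht, hit, hpad⟩ := exists_closed_term_or_lt hPAI hi₀.1 hi₁.1.1 hlt
  set φ' := orCode φ (ltCode t zeroCode)
  have hφ'_ge : i₀ ≤ φ' :=
    calc i₀ ≤ t := hit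
      _ ≤ pr t zeroCode := le_pr_left _ _
      _ ≤ ltCode t zeroCode := le_pr_right _ _
      _ ≤ pr φ (ltCode t zeroCode) := le_pr_right _ _
      _ ≤ φ' := le_pr_right _ _
  have hφ'_lt : φ' < i₁ := by
    refine (pr_lt_of_add_lt ?_).trans hpad
    gcongr
    exact pr_lt_of_add_lt (by gcongr; exact h.1)
  have start_diff : IsStart (I \ {i₀}) φ a i₁ := ⟨⟨hi₁.1, h.of_le hlt.le⟩, fun w hw => hi₁.2 hw.1⟩
  have start_padded : IsStart I φ' a i₁ := by
    refine ⟨⟨hi₁.1.1, hφ'_lt, (h.of_le hlt.le).2⟩, fun w hw => hi₁.2 ⟨hw.1, ?_⟩⟩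
    rintro rfl
    exact hw.2.1.not_ge hφ'_ge
  calc SigmaHolds (I \ {i₀}) φ a ↔ SigmaFrom (I \ {i₀}) i₁ φ a := start_diff.sigmaHolds_iff
    _ ↔ SigmaFrom I i₁ φ a := sigmaFrom_diff_singleton_iff hlt.le
    _ ↔ SigmaFrom I i₁ φ' a := (sigmaFrom_or_lt_zero_iff ht).symm
    _ ↔ SigmaHolds I φ' a := start_padded.sigmaHolds_iff.symm
    _ ↔ SigmaHolds I φ a := (model_alpha.1 hα).or_lt_zero_iff ha hφ (ht m)

theorem sigmaHolds_diff_singleton (hPAI : Expansion M I ⊨ PAI) (hα : Expansion M I ⊨ alpha)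
    (hi₀ : IsLeast I i₀) : SigmaHolds (I \ {i₀}) = SigmaHolds I := by
  ext φ a
  by_cases h : Exceeds φ a i₀
  · have of_form {m : M} (hφ : IsForm m φ) (ha : IsTup m a) :=
      sigmaHolds_diff_singleton_of_exceeds hPAI hα hi₀ hφ ha h
    constructor
    all_goals
      intro hσ
      obtain ⟨-, -, m, -, -, -, hφ, ha, -⟩ := id hσ
    · exact (of_form hφ ha).1 hσ
    · exact (of_form hφ ha).2 hσ
  · exact sigmaHolds_diff_singleton_of_not_exceeds hi₀ h

theorem model_alpha_diff_singleton (hPAI : Expansion M I ⊨ PAI) (hα : Expansion M I ⊨ alpha)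
    (hi₀ : IsLeast I i₀) : Expansion M (I \ {i₀}) ⊨ alpha := by
  rw [model_alpha, sigmaHolds_diff_singleton hPAI hα hi₀]
  exact model_alpha.1 hα

end Alpha

/-! ## Failure of solidity -/

theorem exists_expansion_eq {M : Type u} (S : LAI.Structure M) :
    ∃ (_ : LA.Structure M) (I : Set M), S = (inferInstance : LAI.Structure (Expansion M I)) := by
  refine ⟨(LHom.sumInl : LA →ᴸ LAI).reduct M,
    {x | Structure.RelMap (L := LAI) (Sum.inr IndRel.mem : LAI.Relations 1) ![x]}, ?_⟩
  refine Structure.ext (funext fun n => funext fun f => ?_) (funext fun n => funext fun R => ?_)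
  · rcases f with f | f
    · rfl
    · exact f.elim
  · rcases R with R | R
    · rfl
    · cases R
      funext x
      refine congrArg (Structure.RelMap (L := LAI) (M := M) (Sum.inr IndRel.mem))
        (funext fun i => ?_)
      fin_cases i
      rfl

theorem definableMap_id (M : Type u) [LA.Structure M] (I : Set M) :
    DefinableMap LAI (Expansion M I) (id : M → M) :=
  definableIn_iff_exists_formula.2 ⟨Term.equal (Term.var (Sum.inr 1)) (Term.var (Sum.inr 0)),
    fun _ => Formula.realize_equal (M := Expansion M I)⟩

theorem not_solidAt {M : Type u} [LA.Structure M] {I J : Set M} {U : LAI.Theory}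
    [Nonempty (Expansion M I)] [Expansion M I ⊨ U] (hPA : Expansion M I ⊨ PAofI)
    (hJ : Expansion M J ⊨ U) (hIJ : DefinableIn₁ I J) (hJI : DefinableIn₁ J I) (ne : I ≠ J) :
    ¬ SolidAt U (Theory.ModelType.of U (Expansion M I)) := by
  intro solid
  have : Nonempty (Expansion M J) := ‹Nonempty (Expansion M I)›
  obtain ⟨f, hf⟩ := solid (Theory.ModelType.of U (Expansion M J))
    (Theory.ModelType.of U (Expansion M I)) id id (isInterpretation_id hIJ)
    (isInterpretation_id hJI) ⟨FirstOrder.Language.Equiv.refl LAI _, definableMap_id M I⟩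
  exact ne (eq_of_definable_iso hPA f hf)

theorem nowhereSolid_of_diff_isLeast {U : LAI.Theory} (hPA : PAofI ⊆ U) (hUbd : Ubd ∈ U)
    (model_diff : ∀ (M : Type u) [LA.Structure M] [PeanoModel M] (I : Set M) (i : M),
      Expansion M I ⊨ U → IsLeast I i → Expansion M (I \ {i}) ⊨ U) :
    NowhereSolid.{u} U := by
  rintro @⟨M, S, hM, hne⟩
  obtain ⟨_, I, rfl⟩ := exists_expansion_eq S
  have hU : Expansion M I ⊨ U := hM
  have hI : Expansion M I ⊨ PAofI := hU.mono hPA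
  obtain ⟨_⟩ := PAofI.nonempty_peanoModel hI
  have unbounded : ¬ BddAbove I := model_Ubd.1 ((Theory.model_iff _).1 hU _ hUbd)
  obtain ⟨i, hi⟩ := PAofI.exists_isLeast hI (nonempty_of_not_bddAbove unbounded)
  have : Nonempty (Expansion M I) := hne
  exact not_solidAt hI (model_diff M I i hU hi) (definableIn₁_diff_singleton i)
    (definableIn₁_of_diff_singleton hi.1) fun h => (h ▸ hi.1).2 rfl

theorem nowhereSolid_PAICirc : NowhereSolid.{u} PAICirc :=
  nowhereSolid_of_diff_isLeast (Set.subset_union_left.trans Set.subset_union_left)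
    (Or.inl (Or.inr rfl)) fun _ _ _ _ i h _ => model_PAICirc_diff_singleton h i

theorem nowhereSolid_PAI : NowhereSolid.{u} PAI :=
  nowhereSolid_of_diff_isLeast (Set.subset_union_left.trans Set.subset_union_left)
    (Or.inl (Or.inr rfl)) fun _ _ _ _ i h _ => model_PAI_diff_singleton h i

theorem nowhereSolid_PAIalpha : NowhereSolid.{u} PAIalpha := by
  have hPAI : PAI ⊆ PAIalpha := Set.subset_union_left
  refine nowhereSolid_of_diff_isLeast
    ((Set.subset_union_left.trans Set.subset_union_left).trans hPAI) (hPAI (Or.inl (Or.inr rfl)))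
    fun M _ _ I i h hi => ?_
  obtain ⟨modelPAI, modelAlpha⟩ := Theory.model_union_iff.1 h
  exact Theory.model_union_iff.2 ⟨model_PAI_diff_singleton modelPAI i,
    Theory.model_singleton_iff.2
      (model_alpha_diff_singleton modelPAI (Theory.model_singleton_iff.1 modelAlpha) hi)⟩

/-! ## Sparse homogeneous sets of natural numbers -/

section Ramsey

open Filter

theorem exists_diagonal_set {f : Filter ℕ} [f.NeBot] (hf : f ≤ atTop) {R : Finset ℕ → ℕ → Prop}
    (hR : ∀ s, ∀ᶠ x in f, R s x) :
    ∃ I : Set ℕ, ¬ BddAbove I ∧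
      ∀ (s : Finset ℕ) (x : ℕ), ↑s ⊆ I → x ∈ I → (∀ y ∈ s, y < x) → R s x := by
  -- The pair `(t, x)` stands for a stage at which `x` is added to a set contained in `t`.
  obtain ⟨stage, hstage, extends_⟩ := exists_seq_of_forall_finset_exists
    (fun c : Finset ℕ × ℕ => ∀ s ⊆ c.1, R s c.2) (fun c d => c.2 ∈ d.1 ∧ c.2 < d.2)
    fun S _ => by
      have lt : ∀ᶠ x in f, ∀ y ∈ S.image Prod.snd, y < x :=
        (eventually_all_finset _).2 fun y _ => (eventually_gt_atTop y).filter_mono hf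
      have holds : ∀ᶠ x in f, ∀ s ∈ (S.image Prod.snd).powerset, R s x :=
        (eventually_all_finset _).2 fun s _ => hR s
      obtain ⟨x, hlt, hx⟩ := (lt.and holds).exists
      exact ⟨(S.image Prod.snd, x), fun s hs => hx s (Finset.mem_powerset.2 hs), fun c hc =>
        ⟨Finset.mem_image_of_mem _ hc, hlt _ (Finset.mem_image_of_mem _ hc)⟩⟩
  have mono : StrictMono fun k => (stage k).2 := fun k l hkl => (extends_ k l hkl).2
  refine ⟨Set.range fun k => (stage k).2, mono.not_bddAbove_range_of_wellFoundedLT, ?_⟩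
  rintro s _ hs ⟨k, rfl⟩ hsk
  refine hstage k s fun y hy => ?_
  obtain ⟨l, rfl⟩ := hs hy
  exact (extends_ l k (mono.lt_iff_lt.1 (hsk _ hy))).1

/-- The property that adding `k` generic numbers to a set makes `p` true, `generic` meaning along
the ultrafilter `U`. -/
def GenericallyExtends (U : Ultrafilter ℕ) (p : Finset ℕ → Prop) : ℕ → Finset ℕ → Prop
  | 0, s => p s
  | k + 1, s => ∀ᶠ x in (U : Filter ℕ), GenericallyExtends U p k (insert x s)

theorem eventually_genericallyExtends_iff (U : Ultrafilter ℕ) (p : Finset ℕ → Prop) (k : ℕ)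
    (s : Finset ℕ) : ∀ᶠ x in (U : Filter ℕ),
      (GenericallyExtends U p k (insert x s) ↔ GenericallyExtends U p (k + 1) s) := by
  by_cases h : GenericallyExtends U p (k + 1) s
  · filter_upwards [h] with x hx using iff_of_true hx h
  · filter_upwards [Ultrafilter.eventually_not.2 h] with x hx using iff_of_false hx h

theorem exists_sparse_homogeneous_finset {ι : Type*} [Finite ι] (n : ι → ℕ)
    (p : ι → Finset ℕ → Prop) (F : ℕ → ℕ) :
    ∃ I : Set ℕ, ¬ BddAbove I ∧ (∀ i ∈ I, ∀ j ∈ I, i < j → F i ≤ j) ∧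
      ∀ (a : ι) (s t : Finset ℕ), ↑s ⊆ I → s.card = n a → ↑t ⊆ I → t.card = n a →
        (p a s ↔ p a t) := by
  let G a := GenericallyExtends (hyperfilter ℕ) (p a)
  obtain ⟨I, unbounded, hI⟩ := exists_diagonal_set (f := (hyperfilter ℕ : Filter ℕ))
    (R := fun s x => (∀ a, ∀ k ∈ Finset.range (n a), (G a k (insert x s) ↔ G a (k + 1) s)) ∧
      ∀ y ∈ s, F y ≤ x) Nat.hyperfilter_le_atTop
    fun s => .and (eventually_all.2 fun a => (eventually_all_finset _).2 fun k _ =>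
        eventually_genericallyExtends_iff _ _ k s)
      ((eventually_all_finset _).2 fun y _ =>
        (eventually_ge_atTop (F y)).filter_mono Nat.hyperfilter_le_atTop)
  have generic a (s : Finset ℕ) : ↑s ⊆ I → ∀ k, k + s.card = n a → (G a k s ↔ G a (n a) ∅) := by
    induction s using Finset.induction_on_max with
    | empty =>
      rintro - k rfl
      rfl
    | insert x s hx ih =>
      intro hs k hk
      rw [Finset.coe_insert, Set.insert_subset_iff] at hs
      rw [Finset.card_insert_of_notMem fun h => (hx x h).false] at hk
      rw [(hI s x hs.2 hs.1 hx).1 a k (Finset.mem_range.2 (by omega))]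
      exact ih hs.2 (k + 1) (by omega)
  refine ⟨I, unbounded, fun i hi j hj hij => ?_, fun a s t hs hsn ht htn => ?_⟩
  · exact (hI {i} j (by simpa using hi) hj (by simpa using hij)).2 i (by simp)
  · exact (generic a s hs 0 (by omega)).trans (generic a t ht 0 (by omega)).symm

theorem exists_sparse_homogeneous {ι : Type*} [Finite ι] (n : ι → ℕ)
    (p : ∀ a, (Fin (n a) → ℕ) → Prop) (F : ℕ → ℕ) :
    ∃ I : Set ℕ, ¬ BddAbove I ∧ (∀ i ∈ I, ∀ j ∈ I, i < j → F i ≤ j) ∧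
      ∀ ⦃a⦄ ⦃x y : Fin (n a) → ℕ⦄, (∀ i, x i ∈ I) → StrictMono x → (∀ i, y i ∈ I) →
        StrictMono y → (p a x ↔ p a y) := by
  obtain ⟨I, unbounded, sparse, homogeneous⟩ := exists_sparse_homogeneous_finset n
    (fun a s => ∃ x : Fin (n a) → ℕ, StrictMono x ∧ Finset.univ.image x = s ∧ p a x) F
  refine ⟨I, unbounded, sparse, fun a => ?_⟩
  have of_image {x : Fin (n a) → ℕ} (hx : StrictMono x) :
      (∃ z, StrictMono z ∧ Finset.univ.image z = Finset.univ.image x ∧ p a z) ↔ p a x := by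
    refine ⟨?_, fun h => ⟨x, hx, rfl, h⟩⟩
    rintro ⟨z, hz, hzx, hpz⟩
    have range_eq : Set.range z = Set.range x := by
      simpa using congrArg (fun s : Finset ℕ => (s : Set ℕ)) hzx
    rwa [← (hz.range_inj hx).1 range_eq]
  intro x y hxI hx hyI hy
  rw [← of_image hx, ← of_image hy]
  refine homogeneous a _ _ ?_ ?_ ?_ ?_ <;>
    simp [Set.range_subset_iff, Finset.card_image_of_injective, hx.injective, hy.injective, hxI,
      hyI]

end Ramsey

/-! ## Truth in the standard model -/

/-- The standard model of arithmetic. -/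
instance natStructure : LA.Structure ℕ where
  funMap := fun {_} f => match f with
    | ArithFunc.zero => fun _ => 0
    | ArithFunc.succ => fun x => x 0 + 1
    | ArithFunc.add => fun x => x 0 + x 1
    | ArithFunc.mul => fun x => x 0 * x 1
  RelMap := fun {_} R => match R with
    | ArithRel.lt => fun x => x 0 < x 1

instance : PeanoModel ℕ where
  funMap_zero _ := rfl
  funMap_succ _ := rfl
  funMap_add _ := rfl
  funMap_mul _ := rfl
  relMap_lt _ := Iff.rfl
  ind _ _ h0 hs x := Nat.rec h0 hs x

/-- Terms of arithmetic with the variables of arithmetized syntax. -/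
inductive RawTerm
  | var (i : ℕ)
  | zero
  | succ (t : RawTerm)
  | add (t s : RawTerm)
  | mul (t s : RawTerm)

/-- Formulas of arithmetic with the connectives of arithmetized syntax, where `ex` binds the
variable `0` and shifts the others. -/
inductive RawFormula
  | eq (t s : RawTerm)
  | lt (t s : RawTerm)
  | neg (φ : RawFormula)
  | or (φ ψ : RawFormula)
  | ex (φ : RawFormula)

theorem lt_pr_of_pos {a b : ℕ} (ha : 0 < a) : b < pr a b := by
  unfold pr
  nlinarith

theorem left_lt_pr_pr {k a b : ℕ} (hk : 0 < k) : a < pr k (pr a b) :=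
  (le_pr_left a b).trans_lt (lt_pr_of_pos hk)

theorem right_lt_pr_pr {k a b : ℕ} (hk : 0 < k) : b < pr k (pr a b) :=
  (le_pr_right a b).trans_lt (lt_pr_of_pos hk)

namespace RawTerm

/-- The Gödel number of a term. -/
def code : RawTerm → ℕ
  | var i => varCode i
  | zero => zeroCode
  | succ t => succCode t.code
  | add t s => addCode t.code s.code
  | mul t s => mulCode t.code s.code

/-- The least number above all indices of variables. -/
def varBound : RawTerm → ℕ
  | var i => i + 1
  | zero => 0
  | succ t => t.varBound
  | add t s => max t.varBound s.varBound
  | mul t s => max t.varBound s.varBound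

/-- The value of a term, the variable `i` being the entry of the list with index `i`. -/
def eval (l : List ℕ) : RawTerm → ℕ
  | var i => l.getD i 0
  | zero => 0
  | succ t => t.eval l + 1
  | add t s => t.eval l + s.eval l
  | mul t s => t.eval l * s.eval l

theorem code_inj {t s : RawTerm} : t.code = s.code ↔ t = s := by
  induction t generalizing s <;> cases s <;> simp [code, *]

theorem eval_take {m : ℕ} (l : List ℕ) {t : RawTerm} (ht : t.varBound ≤ m) :
    t.eval (l.take m) = t.eval l := by
  induction t with
  | var i => simp [eval, List.getElem?_take_of_lt ht]
  | zero => rfl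
  | succ t ih => simp only [eval, ih ht]
  | add t s iht ihs | mul t s iht ihs =>
    simp only [eval, iht (le_of_max_le_left ht), ihs (le_of_max_le_right ht)]

theorem isTermIn_code {m : ℕ} (t : RawTerm) : IsTermIn 0 m 0 t.code ↔ t.varBound ≤ m := by
  induction t with
  | var | zero =>
    rw [isTermIn_iff]
    simp [TermStep, code, varBound]
  | succ t ih => exact isTermIn_succCode.trans ih
  | add t s iht ihs | mul t s iht ihs =>
    rw [isTermIn_iff]
    simp [TermStep, code, varBound, iht, ihs]

theorem exists_code_eq {m t : ℕ} (h : IsTermIn 0 m 0 t) : ∃ T : RawTerm, T.code = t := by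
  induction t using Nat.strong_induction_on with
  | _ t ih =>
    obtain ⟨i, -, rfl⟩ | ⟨i, hi, -⟩ | rfl | ⟨t, ht, rfl⟩ | ⟨t, s, ⟨ht, hs⟩, rfl | rfl⟩ :=
      (isTermIn_iff _ _ _ _).1 h
    · exact ⟨.var i, rfl⟩
    · exact absurd hi (Nat.not_lt_zero i)
    · exact ⟨.zero, rfl⟩
    · obtain ⟨T, rfl⟩ := ih t (lt_pr_of_pos (by norm_num)) ht
      exact ⟨.succ T, rfl⟩
    · obtain ⟨T, rfl⟩ := ih t (left_lt_pr_pr (by norm_num)) ht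
      obtain ⟨S, rfl⟩ := ih s (right_lt_pr_pr (by norm_num)) hs
      exact ⟨.add T S, rfl⟩
    · obtain ⟨T, rfl⟩ := ih t (left_lt_pr_pr (by norm_num)) ht
      obtain ⟨S, rfl⟩ := ih s (right_lt_pr_pr (by norm_num)) hs
      exact ⟨.mul T S, rfl⟩

end RawTerm

namespace RawFormula

/-- The Gödel number of a formula. -/
def code : RawFormula → ℕ
  | eq t s => eqCode t.code s.code
  | lt t s => ltCode t.code s.code
  | neg φ => negCode φ.code
  | or φ ψ => orCode φ.code ψ.code
  | ex φ => exCode φ.code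

/-- The least number above all indices of free variables. -/
def varBound : RawFormula → ℕ
  | eq t s => max t.varBound s.varBound
  | lt t s => max t.varBound s.varBound
  | neg φ => φ.varBound
  | or φ ψ => max φ.varBound ψ.varBound
  | ex φ => φ.varBound - 1

/-- Truth in the standard model, the variable `i` being the entry of the list with index `i`. -/
def Holds : List ℕ → RawFormula → Prop
  | l, eq t s => t.eval l = s.eval l
  | l, lt t s => t.eval l < s.eval l
  | l, neg φ => ¬ φ.Holds l
  | l, or φ ψ => φ.Holds l ∨ ψ.Holds l
  | l, ex φ => ∃ y, φ.Holds (y :: l)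

/-- The quantifier depth of a formula. -/
def depth : RawFormula → ℕ
  | eq _ _ => 0
  | lt _ _ => 0
  | neg φ => φ.depth
  | or φ ψ => max φ.depth ψ.depth
  | ex φ => φ.depth + 1

/-- The Gödel number of the formula `φ*` with quantifiers bounded by `z_s, z_{s+1}, …`. -/
def star : ℕ → RawFormula → ℕ
  | _, eq t s => eqCode t.code s.code
  | _, lt t s => ltCode t.code s.code
  | s, neg φ => negCode (φ.star s)
  | s, or φ ψ => orCode (φ.star s) (ψ.star s)
  | s, ex φ => bexCode (zCode s) (φ.star (s + 1))

theorem code_inj {φ ψ : RawFormula} : φ.code = ψ.code ↔ φ = ψ := by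
  induction φ generalizing ψ <;> cases ψ <;> simp [code, RawTerm.code_inj, *]

theorem holds_take {φ : RawFormula} {m : ℕ} (l : List ℕ) (hm : φ.varBound ≤ m) :
    φ.Holds (l.take m) ↔ φ.Holds l := by
  induction φ generalizing m l with
  | eq t s | lt t s =>
    simp only [Holds, RawTerm.eval_take l (le_of_max_le_left hm),
      RawTerm.eval_take l (le_of_max_le_right hm)]
  | neg φ ih => exact not_congr (ih l hm)
  | or φ ψ ih ih' =>
    exact or_congr (ih l (le_of_max_le_left hm)) (ih' l (le_of_max_le_right hm))
  | ex φ ih => exact exists_congr fun y => ih (y :: l) (tsub_le_iff_right.1 hm)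

theorem isForm_code {m : ℕ} (φ : RawFormula) : IsForm m φ.code ↔ φ.varBound ≤ m := by
  induction φ generalizing m with
  | eq t s | lt t s =>
    rw [isForm_iff]
    simp [FormStep, code, varBound, RawTerm.isTermIn_code]
  | neg φ ih | ex φ ih =>
    have h : ∀ {m : ℕ}, Gen FormStep (pr m φ.code) ↔ φ.varBound ≤ m := ih
    simp [isForm_iff, FormStep, code, varBound, h]
  | or φ ψ ih ih' => simp [code, varBound, ih, ih']

theorem isStar_code {s ψ : ℕ} (φ : RawFormula) : IsStar s φ.code ψ ↔ ψ = φ.star s := by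
  induction φ generalizing s ψ with
  | eq t u | lt t u => simp [isStar_iff, StarStep, code, star]
  | neg φ ih | ex φ ih =>
    have h : ∀ {s q : ℕ}, Gen StarStep (pr s (pr φ.code q)) ↔ q = φ.star s := ih
    simp [isStar_iff, StarStep, code, star, h]
  | or φ ψ ih ih' => simp [isStar_orCode, code, star, ih, ih']

theorem isDepth_code {k : ℕ} (φ : RawFormula) : IsDepth φ.code k ↔ k = φ.depth := by
  induction φ generalizing k with
  | eq t u | lt t u => simp [isDepth_iff, DepthStep, code, depth]
  | neg φ ih | ex φ ih =>
    have h : ∀ {k : ℕ}, Gen DepthStep (pr φ.code k) ↔ k = φ.depth := ih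
    simp [isDepth_iff, DepthStep, code, depth, h]
  | or φ ψ ih ih' =>
    simp only [code, depth, isDepth_orCode, ih, ih', exists_and_left, exists_eq_left]
    omega

theorem exists_code_eq {m n : ℕ} (h : IsForm m n) : ∃ φ : RawFormula, φ.code = n := by
  induction n using Nat.strong_induction_on generalizing m with
  | _ n ih =>
    obtain ⟨m', p, q, ⟨⟨hp, hq⟩, h⟩ | ⟨hp, h⟩ | ⟨⟨hp, hq⟩, h⟩ | ⟨hp, h⟩⟩ := (isForm_iff _ _).1 h
    · obtain ⟨T, rfl⟩ := RawTerm.exists_code_eq hp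
      obtain ⟨S, rfl⟩ := RawTerm.exists_code_eq hq
      obtain ⟨-, rfl⟩ | ⟨-, rfl⟩ := h.imp pr_inj.1 pr_inj.1
      · exact ⟨.eq T S, rfl⟩
      · exact ⟨.lt T S, rfl⟩
    · obtain ⟨rfl, rfl⟩ := pr_inj.1 h
      obtain ⟨φ, rfl⟩ := ih p (lt_pr_of_pos (by norm_num)) hp
      exact ⟨.neg φ, rfl⟩
    · obtain ⟨rfl, rfl⟩ := pr_inj.1 h
      obtain ⟨φ, rfl⟩ := ih p (left_lt_pr_pr (by norm_num)) hp
      obtain ⟨ψ, rfl⟩ := ih q (right_lt_pr_pr (by norm_num)) hq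
      exact ⟨.or φ ψ, rfl⟩
    · obtain ⟨rfl, rfl⟩ := pr_inj.1 h
      obtain ⟨φ, rfl⟩ := ih p (lt_pr_of_pos (by norm_num)) hp
      exact ⟨.ex φ, rfl⟩

theorem exists_witness_bound (φ : RawFormula) (h : ℕ) : ∃ B, ∀ l : List ℕ, (∀ x ∈ l, x < h) →
    (∃ y, φ.Holds (y :: l)) → ∃ y < B, φ.Holds (y :: l) := by
  set m := φ.varBound
  have htake (y : ℕ) (l : List ℕ) : φ.Holds (y :: l.take m) ↔ φ.Holds (y :: l) :=
    holds_take (m := m + 1) (y :: l) (Nat.le_succ m)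
  have hfin : {l : List ℕ | l.length ≤ m ∧ ∀ x ∈ l, x < h}.Finite := by
    refine ((List.finite_length_le (Fin h) m).image (List.map Fin.val)).subset ?_
    rintro l ⟨hl, hlt⟩
    exact ⟨l.pmap Fin.mk hlt, by simpa using hl, by simp [List.map_pmap]⟩
  choose! w hw using fun l : List ℕ => (id : (∃ y, φ.Holds (y :: l)) → _)
  obtain ⟨B, hB⟩ := (hfin.image w).bddAbove
  refine ⟨B + 1, fun l hl ⟨y, hy⟩ => ⟨w (l.take m), ?_, ?_⟩⟩
  · exact Nat.lt_succ_of_le <|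
      hB ⟨_, ⟨List.length_take_le m l, fun x hx => hl x (List.mem_of_mem_take hx)⟩, rfl⟩
  · exact (htake _ _).1 (hw _ ⟨y, (htake y l).2 hy⟩)

end RawFormula

/-- Whenever `i < j` are in `I`, every existential formula with code and parameters below `i` that
is true in `ℕ` has a witness below `j`. -/
def ReflectsWitnesses (I : Set ℕ) : Prop :=
  ∀ i ∈ I, ∀ j ∈ I, i < j → ∀ φ : RawFormula, φ.code < i → ∀ l : List ℕ, (∀ x ∈ l, x < i) →
    (∃ y, φ.Holds (y :: l)) → ∃ y < j, φ.Holds (y :: l)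

theorem exists_reflectsWitnesses : ∃ F : ℕ → ℕ, ∀ I : Set ℕ,
    (∀ i ∈ I, ∀ j ∈ I, i < j → F i ≤ j) → ReflectsWitnesses I := by
  choose B hB using RawFormula.exists_witness_bound
  have hbdd (h : ℕ) : BddAbove ((B · h) '' {φ : RawFormula | φ.code < h}) :=
    (((Set.finite_Iio h).preimage fun _ _ _ _ => RawFormula.code_inj.1).image _).bddAbove
  choose F hF using hbdd
  refine ⟨F, fun I hI i hi j hj hij φ hφ l hl hex => ?_⟩
  obtain ⟨y, hyB, hy⟩ := hB φ i l hl hex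
  exact ⟨y, (hyB.trans_le (hF i ⟨φ, hφ, rfl⟩)).trans_le (hI i hi j hj hij), hy⟩

/-- The tuple with the entries of a list. -/
def listCode : List ℕ → ℕ
  | [] => 0
  | b :: l => consCode b (listCode l)

theorem isTup_iff_exists_listCode_eq {m a : ℕ} :
    IsTup m a ↔ ∃ l : List ℕ, l.length = m ∧ listCode l = a := by
  induction m generalizing a with
  | zero =>
    rw [isTup_iff]
    simp [listCode, eq_comm]
  | succ m ih =>
    rw [isTup_iff]
    constructor
    · rintro (⟨⟨⟩, -⟩ | ⟨m', a', b, h, hm, rfl⟩)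
      obtain rfl := Nat.succ_injective hm
      obtain ⟨l, rfl, rfl⟩ := ih.1 h
      exact ⟨b :: l, rfl, rfl⟩
    · rintro ⟨_ | ⟨b, l⟩, hl, rfl⟩
      · cases hl
      exact Or.inr ⟨m, _, b, ih.2 ⟨l, Nat.succ_injective hl, rfl⟩, rfl, rfl⟩

theorem entry_listCode {l : List ℕ} {i x : ℕ} : Entry (listCode l) i x ↔ l[i]? = some x := by
  induction l generalizing i with
  | nil =>
    rw [entry_iff]
    simp [listCode]
  | cons b l ih =>
    rw [entry_iff]
    cases i <;> simp [listCode, ← ih, eq_comm]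

theorem val_zCode {a g s x : ℕ} : Val a g (zCode s) x ↔ Entry g s x := by
  simp [val_iff, ValStep]

theorem RawTerm.val_code {l : List ℕ} {g x : ℕ} {t : RawTerm} (ht : t.varBound ≤ l.length) :
    Val (listCode l) g t.code x ↔ x = t.eval l := by
  induction t generalizing x with
  | var i =>
    have hi : i < l.length := ht
    simp [val_iff, ValStep, code, eval, entry_listCode, hi, eq_comm]
  | zero => exact val_zeroCode
  | succ t ih =>
    have ih {x : ℕ} : Gen (ValStep (listCode l) g) (pr t.code x) ↔ x = t.eval l := ih ht
    simp [val_iff, ValStep, code, eval, ih]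
  | add t s iht ihs | mul t s iht ihs =>
    have iht {x : ℕ} : Gen (ValStep (listCode l) g) (pr t.code x) ↔ x = t.eval l :=
      iht (le_of_max_le_left ht)
    have ihs {x : ℕ} : Gen (ValStep (listCode l) g) (pr s.code x) ↔ x = s.eval l :=
      ihs (le_of_max_le_right ht)
    simp [val_iff, ValStep, code, eval, iht, ihs]

instance {M : Type*} {Ψ : ℕ → (M → Prop) → Prop} [∀ z, Finitary (Ψ z)] (x : ℕ) :
    Finitary fun P => ∀ z, z < x → Ψ z P where
  monotone _ _ hPQ hP z hz := Finitary.monotone hPQ (hP z hz)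
  exists_finite hP := by
    choose! F hF hFP hΨ using fun z (hz : z < x) => Finitary.exists_finite (hP z hz)
    refine ⟨⋃ z ∈ Set.Iio x, F z, (Set.finite_Iio x).biUnion hF, ?_, fun z hz => ?_⟩
    · simp only [Set.mem_iUnion]
      rintro y ⟨z, hz, hy⟩
      exact hFP z hz y hy
    · exact Finitary.monotone (fun y hy => Set.mem_biUnion (Set.mem_Iio.2 hz) hy) (hΨ z hz)

theorem sat_iff (g ψ a b : ℕ) : Sat g ψ a b ↔ SatStep g (Gen (SatStep g)) (pr ψ (pr a b)) :=
  Gen.iff (fun x => by unfold SatStep; infer_instance) _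

/-- The satisfaction predicate for formulas with bounded quantifiers assigns to `ψ` at `a`, `g`
exactly one truth value, namely that of `p`. -/
def HasTruthValue (g ψ a : ℕ) (p : Prop) : Prop := (Sat g ψ a 1 ↔ p) ∧ (Sat g ψ a 0 ↔ ¬ p)

namespace HasTruthValue

variable {g ψ ψ' t u a x y s w : ℕ} {p q : Prop}

theorem eq (ht : ∀ z, Val a g t z ↔ z = x) (hu : ∀ z, Val a g u z ↔ z = y) :
    HasTruthValue g (eqCode t u) a (x = y) := by
  simp [HasTruthValue, sat_iff, SatStep, ht, hu]

theorem lt (ht : ∀ z, Val a g t z ↔ z = x) (hu : ∀ z, Val a g u z ↔ z = y) :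
    HasTruthValue g (ltCode t u) a (x < y) := by
  simp [HasTruthValue, sat_iff, SatStep, ht, hu]

theorem neg (h : HasTruthValue g ψ a p) : HasTruthValue g (negCode ψ) a (¬ p) := by
  obtain ⟨h₁, h₀⟩ := h
  unfold Sat at h₁ h₀
  simp [HasTruthValue, sat_iff, SatStep, h₁, h₀]

theorem or (h : HasTruthValue g ψ a p) (h' : HasTruthValue g ψ' a q) :
    HasTruthValue g (orCode ψ ψ') a (p ∨ q) := by
  obtain ⟨⟨h₁, h₀⟩, h₁', h₀'⟩ := And.intro h h'
  unfold Sat at h₁ h₀ h₁' h₀'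
  simp [HasTruthValue, sat_iff, SatStep, h₁, h₀, h₁', h₀']

theorem bex {p : ℕ → Prop} (hw : ∀ x, Entry g s x ↔ x = w)
    (h : ∀ z < w, HasTruthValue g ψ (consCode z a) (p z)) :
    HasTruthValue g (bexCode (zCode s) ψ) a (∃ z < w, p z) := by
  have hs : ∃ k, s < k := ⟨s + 1, Nat.lt_succ_self s⟩
  have h₁ : ∀ z, (z < w ∧ Gen (SatStep g) (pr ψ (pr (consCode z a) 1))) ↔ z < w ∧ p z :=
    fun z => and_congr_right fun hz => (h z hz).1
  have h₀ : ∀ z, (z < w → Gen (SatStep g) (pr ψ (pr (consCode z a) 0))) ↔ (z < w → ¬ p z) :=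
    fun z => imp_congr_right fun hz => (h z hz).2
  simp [HasTruthValue, sat_iff, SatStep, hs, val_zCode, hw, h₁, h₀]

end HasTruthValue

theorem RawFormula.hasTruthValue_star {I : Set ℕ} (hI : ReflectsWitnesses I) {g l : List ℕ}
    {h s : ℕ} {φ : RawFormula} (hmem : ∀ x ∈ h :: g.drop s, x ∈ I)
    (hsort : (h :: g.drop s).Pairwise (· < ·)) (hdepth : φ.depth ≤ (g.drop s).length)
    (hcode : φ.code < h) (hl : ∀ x ∈ l, x < h) (hvar : φ.varBound ≤ l.length) :
    HasTruthValue (listCode g) (φ.star s) (listCode l) (φ.Holds l) := by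
  induction φ generalizing h s l with
  | eq t u =>
    exact .eq (fun _ => RawTerm.val_code (le_of_max_le_left hvar))
      (fun _ => RawTerm.val_code (le_of_max_le_right hvar))
  | lt t u =>
    exact .lt (fun _ => RawTerm.val_code (le_of_max_le_left hvar))
      (fun _ => RawTerm.val_code (le_of_max_le_right hvar))
  | neg φ ih => exact .neg (ih hmem hsort hdepth ((lt_pr_of_pos (by norm_num)).trans hcode) hl hvar)
  | or φ ψ ihφ ihψ =>
    exact .or
      (ihφ hmem hsort (le_of_max_le_left hdepth) ((left_lt_pr_pr (by norm_num)).trans hcode) hl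
        (le_of_max_le_left hvar))
      (ihψ hmem hsort (le_of_max_le_right hdepth) ((right_lt_pr_pr (by norm_num)).trans hcode) hl
        (le_of_max_le_right hvar))
  | ex φ ih =>
    have hs : s < g.length := by
      rw [List.length_drop, depth] at hdepth
      omega
    rw [List.drop_eq_getElem_cons hs] at hmem hsort hdepth
    set w := g[s]
    have hhw : h < w := List.rel_of_pairwise_cons hsort List.mem_cons_self
    have hφh : φ.code < h := (lt_pr_of_pos (by norm_num)).trans hcode
    have hw (x : ℕ) : Entry (listCode g) s x ↔ x = w := by
      rw [entry_listCode, List.getElem?_eq_getElem hs, Option.some_inj, eq_comm]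
    have hφ : ∀ y < w, HasTruthValue (listCode g) (φ.star (s + 1)) (consCode y (listCode l))
        (φ.Holds (y :: l)) := fun y hy =>
      ih (l := y :: l) (fun x hx => hmem x (List.mem_cons_of_mem h hx)) hsort.of_cons
        (Nat.le_of_succ_le_succ hdepth) (hφh.trans hhw)
        (List.forall_mem_cons.2 ⟨hy, fun x hx => (hl x hx).trans hhw⟩) (tsub_le_iff_right.1 hvar)
    have hbound : (∃ y, φ.Holds (y :: l)) ↔ ∃ y < w, φ.Holds (y :: l) :=
      ⟨hI h (hmem h List.mem_cons_self) w (hmem w (by simp)) hhw φ hφh l hl,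
        fun ⟨y, _, hy⟩ => ⟨y, hy⟩⟩
    rw [Holds, hbound]
    exact .bex hw hφ

section Sparse

variable {I : Set ℕ}

theorem exists_isStart (hI : ¬ BddAbove I) (φ : ℕ) (l : List ℕ) :
    ∃ j, IsStart I φ (listCode l) j := by
  obtain ⟨w, hw, hlt⟩ := not_bddAbove_iff.1 hI (φ + l.sum)
  have exceeds : Exceeds φ (listCode l) w := by
    refine ⟨le_self_add.trans_lt hlt, fun i x hx => ?_⟩
    calc x ≤ l.sum := List.le_sum_of_mem (List.mem_of_getElem? (entry_listCode.1 hx))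
      _ ≤ φ + l.sum := le_add_self
      _ < w := hlt
  exact ⟨_, isLeast_csInf ⟨w, hw, exceeds⟩⟩

theorem exists_listsFirst (hI : ¬ BddAbove I) (j k : ℕ) :
    ∃ g : List ℕ, g.length = k ∧ ListsFirst I j (listCode g) := by
  set p : ℕ → Prop := fun w => w ∈ I ∧ j < w
  have infinite : {w | p w}.Infinite := by
    refine Set.infinite_of_not_bddAbove (not_bddAbove_iff.2 fun b => ?_)
    obtain ⟨w, hw, hlt⟩ := not_bddAbove_iff.1 hI (j + b)
    exact ⟨w, ⟨hw, le_self_add.trans_lt hlt⟩, le_add_self.trans_lt hlt⟩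
  refine ⟨(List.range k).map (Nat.nth p), by simp, fun i x hx => ?_⟩
  obtain ⟨hik, rfl⟩ : i < k ∧ Nat.nth p i = x := by
    simpa [entry_listCode, List.getElem?_eq_some_iff] using hx
  have set_eq : I ∩ {w | IsAbove j (listCode ((List.range k).map (Nat.nth p))) i w} =
      {w | p w ∧ ∀ i' < i, Nat.nth p i' < w} := by
    refine Set.ext fun w => and_assoc.symm.trans (and_congr_right fun _ => Iff.intro ?_ ?_)
    · intro above i' hi'
      exact above i' _ ⟨hi', entry_listCode.2 (by simp [hi'.trans hik])⟩
    · rintro above i' x ⟨hi', hx⟩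
      obtain ⟨-, rfl⟩ : i' < k ∧ Nat.nth p i' = x := by
        simpa [entry_listCode, List.getElem?_eq_some_iff] using hx
      exact above i' hi'
  exact set_eq ▸ Nat.isLeast_nth_of_infinite infinite i

theorem ListsFirst.mem {j : ℕ} {g : List ℕ} (h : ListsFirst I j (listCode g)) :
    ∀ x ∈ g, x ∈ I := fun x hx => by
  obtain ⟨i, hi⟩ := List.mem_iff_getElem?.1 hx
  exact (h i x (entry_listCode.2 hi)).1.1

theorem ListsFirst.pairwise {j : ℕ} {g : List ℕ} (h : ListsFirst I j (listCode g)) :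
    (j :: g).Pairwise (· < ·) := by
  refine List.pairwise_cons.2 ⟨fun x hx => ?_, List.pairwise_iff_getElem.2 ?_⟩
  · obtain ⟨i, hi⟩ := List.mem_iff_getElem?.1 hx
    exact (h i x (entry_listCode.2 hi)).1.2.1
  · intro i i' hi hi' hlt
    exact (h i' g[i'] (entry_listCode.2 (List.getElem?_eq_getElem hi'))).1.2.2 i g[i]
      ⟨hlt, entry_listCode.2 (List.getElem?_eq_getElem hi)⟩

theorem sat_star_iff (hI : ReflectsWitnesses I) {φ : RawFormula} {l g : List ℕ} {j : ℕ}
    (hvar : φ.varBound ≤ l.length) (start : IsStart I φ.code (listCode l) j)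
    (first : ListsFirst I j (listCode g)) (hdepth : φ.depth = g.length) :
    Sat (listCode g) (φ.star 0) (listCode l) 1 ↔ φ.Holds l := by
  refine (RawFormula.hasTruthValue_star (s := 0) (g := g) hI
    (List.forall_mem_cons.2 ⟨start.1.1, first.mem⟩) first.pairwise hdepth.le start.1.2.1
    (fun x hx => ?_) hvar).1
  obtain ⟨i, hi⟩ := List.mem_iff_getElem?.1 hx
  exact start.1.2.2 i x (entry_listCode.2 hi)

theorem sigmaHolds_code (unbounded : ¬ BddAbove I) (hI : ReflectsWitnesses I) {φ : RawFormula}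
    {l : List ℕ} (hvar : φ.varBound ≤ l.length) :
    SigmaHolds I φ.code (listCode l) ↔ φ.Holds l := by
  obtain ⟨j, start⟩ := exists_isStart unbounded φ.code l
  rw [start.sigmaHolds_iff]
  constructor
  · rintro ⟨m, ψ, k, g, -, -, star, depth, tup, first, holds⟩
    obtain rfl := φ.isStar_code.1 star
    obtain rfl := φ.isDepth_code.1 depth
    obtain ⟨g, hg, rfl⟩ := isTup_iff_exists_listCode_eq.1 tup
    exact (sat_star_iff hI hvar start first hg.symm).1 holds
  · intro holds
    obtain ⟨g, hg, first⟩ := exists_listsFirst unbounded j φ.depth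
    exact ⟨l.length, φ.star 0, φ.depth, listCode g, φ.isForm_code.2 hvar,
      isTup_iff_exists_listCode_eq.2 ⟨l, rfl, rfl⟩, φ.isStar_code.2 rfl, φ.isDepth_code.2 rfl,
      isTup_iff_exists_listCode_eq.2 ⟨g, hg, rfl⟩, first,
      (sat_star_iff hI hvar start first hg.symm).2 holds⟩

theorem isSatisfactionClass_sigmaHolds (unbounded : ¬ BddAbove I) (hI : ReflectsWitnesses I) :
    IsSatisfactionClass (SigmaHolds I) := by
  have key {φ : RawFormula} {l : List ℕ} (hvar : φ.varBound ≤ l.length) :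
    SigmaHolds I φ.code (listCode l) ↔ φ.Holds l := sigmaHolds_code unbounded hI hvar
  constructor <;> intro m a
  · intro t s ha ht hs
    obtain ⟨l, rfl, rfl⟩ := isTup_iff_exists_listCode_eq.1 ha
    obtain ⟨T, rfl⟩ := RawTerm.exists_code_eq ht
    obtain ⟨S, rfl⟩ := RawTerm.exists_code_eq hs
    rw [RawTerm.isTermIn_code] at ht hs
    refine (key (φ := .eq T S) (max_le ht hs)).trans ?_
    simp [RawFormula.Holds, RawTerm.val_code ht, RawTerm.val_code hs]
  · intro t s ha ht hs
    obtain ⟨l, rfl, rfl⟩ := isTup_iff_exists_listCode_eq.1 ha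
    obtain ⟨T, rfl⟩ := RawTerm.exists_code_eq ht
    obtain ⟨S, rfl⟩ := RawTerm.exists_code_eq hs
    rw [RawTerm.isTermIn_code] at ht hs
    refine (key (φ := .lt T S) (max_le ht hs)).trans ?_
    simp [RawFormula.Holds, RawTerm.val_code ht, RawTerm.val_code hs]
  · intro φ ha hφ
    obtain ⟨l, rfl, rfl⟩ := isTup_iff_exists_listCode_eq.1 ha
    obtain ⟨φ, rfl⟩ := RawFormula.exists_code_eq hφ
    have hvar := φ.isForm_code.1 hφ
    exact (key (φ := .neg φ) hvar).trans (not_congr (key hvar).symm)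
  · intro φ ψ ha hφ hψ
    obtain ⟨l, rfl, rfl⟩ := isTup_iff_exists_listCode_eq.1 ha
    obtain ⟨φ, rfl⟩ := RawFormula.exists_code_eq hφ
    obtain ⟨ψ, rfl⟩ := RawFormula.exists_code_eq hψ
    have hvar := φ.isForm_code.1 hφ
    have hvar' := ψ.isForm_code.1 hψ
    exact (key (φ := .or φ ψ) (max_le hvar hvar')).trans (or_congr (key hvar).symm (key hvar').symm)
  · intro φ ha hφ
    obtain ⟨l, rfl, rfl⟩ := isTup_iff_exists_listCode_eq.1 ha
    obtain ⟨φ, rfl⟩ := RawFormula.exists_code_eq hφ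
    have hvar := φ.isForm_code.1 hφ
    exact (key (φ := .ex φ) (tsub_le_iff_right.2 hvar)).trans
      (exists_congr fun y => (key (l := y :: l) hvar).symm)

end Sparse

/-! ## Satisfiability -/

theorem nat_model_Q : ℕ ⊨ Q := by
  simp only [Q, Theory.model_iff, Set.mem_insert_iff, Set.mem_singleton_iff, forall_eq_or_imp,
    forall_eq, realize_closure, Formula.realize_imp, Formula.realize_not, Formula.realize_iff,
    realize_eqF, realize_ltF, realize_exF, realize_v, realize_zero, realize_sc, realize_add,
    realize_mul]
  refine ⟨fun e => Nat.succ_ne_zero _, fun e => Nat.succ.inj, fun e h => ?_, fun e => rfl,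
    fun e => rfl, fun e => rfl, fun e => rfl, fun e => ?_⟩
  · exact ⟨e 0 - 1, (Nat.succ_pred_eq_of_ne_zero h).symm⟩
  · change e 0 < e 1 ↔ ∃ x, x + 1 + e 0 = e 1
    exact ⟨fun h => ⟨e 1 - e 0 - 1, by omega⟩, fun ⟨x, hx⟩ => by omega⟩

theorem nat_model_PAofI (I : Set ℕ) : Expansion ℕ I ⊨ PAofI :=
  model_PAofI_iff.2 ⟨nat_model_Q, fun _ φ => (model_induction_iff φ).2 fun _ h0 hs => Nat.rec h0 hs⟩

theorem isSatisfiable_PAIalpha : PAIalpha.IsSatisfiable := by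
  let T (q : Σ n, LA.Formula (Fin n)) : LAI.Theory := (PAofI ∪ {Ubd} ∪ {Indis q.2}) ∪ {alpha}
  have subset_iUnion : PAIalpha ⊆ ⋃ q, T q := by
    let q₀ : Σ n, LA.Formula (Fin n) := ⟨0, ⊥⟩
    rintro s ((h | ⟨n, φ, rfl⟩) | h)
    · exact Set.mem_iUnion.2 ⟨q₀, Or.inl (Or.inl h)⟩
    · exact Set.mem_iUnion.2 ⟨⟨n, φ⟩, Or.inl (Or.inr rfl)⟩
    · exact Set.mem_iUnion.2 ⟨q₀, Or.inr h⟩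
  refine Theory.IsSatisfiable.mono
    ((Theory.isSatisfiable_iUnion_iff_isSatisfiable_iUnion_finset T).2 fun s => ?_) subset_iUnion
  obtain ⟨F, hF⟩ := exists_reflectsWitnesses
  obtain ⟨I, unbounded, sparse, homogeneous⟩ := exists_sparse_homogeneous
    (fun q : s => q.1.1) (fun q x => q.1.2.Realize x) F
  have model (q : s) : Expansion ℕ I ⊨ T q := by
    simp only [T, Theory.model_union_iff, Theory.model_singleton_iff, model_Ubd, model_Indis,
      model_alpha]
    exact ⟨⟨⟨nat_model_PAofI I, unbounded⟩, @homogeneous q⟩,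
      isSatisfactionClass_sigmaHolds unbounded (hF I sparse)⟩
  have : Expansion ℕ I ⊨ ⋃ q ∈ s, T q := by
    refine (Theory.model_iff _).2 fun ψ hψ => ?_
    obtain ⟨q, hq, hψ⟩ := Set.mem_iUnion₂.1 hψ
    exact (Theory.model_iff _).1 (model ⟨q, hq⟩) ψ hψ
  have : Nonempty (Expansion ℕ I) := ⟨(0 : ℕ)⟩
  exact ⟨Theory.ModelType.of _ (Expansion ℕ I)⟩

theorem isSatisfiable_PAI : PAI.IsSatisfiable :=
  isSatisfiable_PAIalpha.mono Set.subset_union_left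

theorem model_PAICirc_of_model_PAI {M : Type u} [LA.Structure M] [PeanoModel M] {I : Set M}
    (h : Expansion M I ⊨ PAI) : Expansion M I ⊨ PAICirc := by
  obtain ⟨hPA, hI, indisc⟩ := model_PAI_iff.1 h
  exact model_PAICirc_iff.2 ⟨hPA, hI, fun n φ => (indisc n φ).mono Set.inter_subset_left⟩

theorem isSatisfiable_PAICirc : PAICirc.IsSatisfiable := by
  obtain ⟨@⟨M, S, hM, hne⟩⟩ := isSatisfiable_PAI
  obtain ⟨_, I, rfl⟩ := exists_expansion_eq S
  have hPAI : Expansion M I ⊨ PAI := hM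
  obtain ⟨_⟩ := PAofI.nonempty_peanoModel
    (hPAI.mono (Set.subset_union_left.trans Set.subset_union_left))
  have := model_PAICirc_of_model_PAI hPAI
  have : Nonempty (Expansion M I) := hne
  exact ⟨Theory.ModelType.of _ (Expansion M I)⟩

theorem NowhereSolid.not_solid {L : FirstOrder.Language.{0, 0}} {U : L.Theory}
    (hU : NowhereSolid.{u} U) (hsat : U.IsSatisfiable) : ¬ Solid.{u} U := by
  obtain ⟨M⟩ := hsat
  exact fun solid => hU (Theory.ModelType.ulift.{0, 0, 0, u} M) (solid _)

end ArithInd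

theorem theorem5p5 :
    (∀ U ∈ ({PAICirc, PAI, PAIalpha} : Set LAI.Theory),
      NowhereSolid.{u} U ∧ ¬ Solid.{u} U) ∧
    (∀ (M : Type u) [LA.Structure M] (I : Set M), Expansion M I ⊨ PAI →
      Expansion M (double I) ⊨ PAI ∧
      IsInterpretation LAI (Expansion M (double I)) (Expansion M I) (id : M → M) ∧
      IsInterpretation LAI (Expansion M I) (Expansion M (double I)) (id : M → M) ∧
      ¬ ∃ f : Expansion M I ≃[LAI] Expansion M (double I),
        DefinableMap LAI (Expansion M I) (f : M → M)) ∧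
    (∀ (M : Type u) [LA.Structure M] (I : Set M), Expansion M I ⊨ PAofI →
      ∀ f : M ≃[LA] M, DefinableMap LAI (Expansion M I) (f : M → M) → ∀ x, f x = x) := by
  refine ⟨?_, fun M _ I h => double_isInterpreted h, fun M _ I h f hf => definably_rigid h f hf⟩
  rintro U (rfl | rfl | rfl)
  · exact ⟨nowhereSolid_PAICirc, nowhereSolid_PAICirc.not_solid isSatisfiable_PAICirc⟩
  · exact ⟨nowhereSolid_PAI, nowhereSolid_PAI.not_solid isSatisfiable_PAI⟩
  · exact ⟨nowhereSolid_PAIalpha, nowhereSolid_PAIalpha.not_solid isSatisfiable_PAIalpha⟩
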